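/- **Setting.** Fix $d$ and constants $M,\delta,\rho,\kappa,\sigma_1,\dots,\sigma_5>0$, $r_1,r_2>2$, $\alpha\in(0,1/2]$, $c_w>0$, $\gamma\ge 0$, $\zeta<1/2$. Consider a sequence, indexed by $n$, of multitask problems; everything below except these constants and the rate function $s$ may depend on $n$. There are $m$ tasks, partitioned into nonempty clusters $S_1,\dots,S_K$ with $m_k=|S_k|$. Task $j$ has a target $\theta_j^*\in\Theta\subseteq\mathbb R^d$ ($\Theta$ convex, containing a neighbourhood of every ball $\mathcal B_{\theta_j^*,M}$), a nuisance $\eta_j^*$ in a normed space $\mathcal H_j$, a distribution $P_j$ and a loss $\ell_j(\theta,\eta,z)$ with risk $\mathcal R_j(\theta,\eta)=\mathbb E_{P_j}\ell_j(\theta,\eta,Z)$; $\theta_j^*$ minimizes $\mathcal R_j(\cdot,\eta_j^*)$ over $\Theta$, $\theta_j^*=\beta_k^*$ for $j\in S_k$, and $\|\beta_k^*-\beta_{k'}^*\|\ge\delta$ for $k\ne k'$. Observations $Z_{ji}\sim P_j$, $i\le n_j$ ($n_j\ge1$), are independent over $i$ and $j$, and for each $j$ the nuisance estimator $\hat\eta_j$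 is independent of $(Z_{ji})_i$ (sample splitting). Put $n_{\min}=\min_j n_j$, $n_{\max}=\max_j n_j$, $N_k=\sum_{j\in S_k}n_j$, $N_{\min}=\min_kN_k$. $\mathcal B_{x,M}$ is the closed ball of radius $M$ around $x$, and $D_\eta$, $D_\eta^2$ are Gateaux derivatives. **Assumptions on the loss.** For all $j$: $\ell_j(\cdot,\eta,z)$ is convex on $\Theta$ and twice differentiable on $\mathcal B_{\theta_j^*,M}$ for all $z$ and $\eta\in\mathcal B_{\eta_j^*,M}$; and 1. $H_j(\theta)=\nabla_\theta^2\mathcal R_j(\theta,\eta_j^*)$ satisfies $\rho I\preceq H_j(\theta)\preceq\kappa I$ on $\mathcal B_{\theta_j^*,M}$; 2. $\nabla_\theta\mathcal R_j(\theta_j^*,\eta_j^*)=0$ and $\mathbb E_{P_j}\|\nabla_\theta\ell_j(\theta_j^*,\eta_j^*,Z)\|^{r_1}\le\sigma_1$; 3. $\mathbb E_{P_j}|\langle v,(\nabla^2_\theta\ell_j(\theta,\eta_j^*,Z)-H_j(\theta))v\rangle|^{r_2}\le\sigma_2$ for $\|v\|=1$, $\theta\in\mathcal B_{\theta_j^*,M}$;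 4. $\mathbb E_{P_j}\sup\frac{\|\nabla^2_\theta\ell_j(\theta,\eta,Z)-\nabla^2_\theta\ell_j(\theta',\eta',Z)\|_2}{\|\theta-\theta'\|+\|\eta-\eta'\|}\le\sigma_3$, the supremum over pairs $(\theta,\eta)\ne(\theta',\eta')$ in $\mathcal B_{\theta_j^*,M}\times\mathcal B_{\eta_j^*,M}$; 5. there are sets $\mathcal T_j\subseteq\mathcal H_j$ such that, with probability tending to one, $\hat\eta_j\in\mathcal T_j$ for all $j$, and $D_\eta\nabla_\theta\mathcal R_j(\theta_j^*,\eta_j^*)[\eta-\eta_j^*]=0$ for $\eta\in\mathcal T_j$ (with finite risk near the point of differentiation); 6. for $\eta\in\mathcal T_j$, $h=\eta-\eta_j^*$ and $\bar\eta$ on the segment from $\eta_j^*$ to $\eta$, the score $\nabla_\theta\ell_j(\theta_j^*,\cdot,z)$ exists and is twice differentiable in direction $h$ at $\bar\eta$, and $\mathbb E_{P_j}\|D_\eta\nabla_\theta\ell_j(\theta_j^*,\bar\eta,Z)[h]\|^2$ and $\mathbb E_{P_j}\|D_\eta^2\nabla_\theta\ell_j(\theta_j^*,\bar\eta,Z)[h,h]\|$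 are at most $\sigma_5\|h\|^2$. **Nuisance and pilot estimators.** There is a positive rate $s$ with $n^{1/4}=o(s(n))$, $s(n)=O(n^{1/2})$ and $\mathbb E\|\hat\eta_j-\eta_j^*\|^2\le\sigma_4/s(n_j)^2$ for all $j$. The pilot estimators satisfy, for every $\epsilon>0$, $\mathbb P(\forall j:\ n_j^{\alpha}\|\hat\theta_j^{\rm init}-\theta_j^*\|<\epsilon)\to1$. **Estimator.** Let $w_{jj'}=c_w\|\hat\theta_j^{\rm init}-\hat\theta_{j'}^{\rm init}\|^{-\gamma}$, and $\lambda_{jj'}=\varepsilon_n$ if $w_{jj'}\le\tau$, $\lambda_{jj'}=w_{jj'}$ if $w_{jj'}>\tau$. Let $f_j(\theta,\eta)=\sum_{i\le n_j}\ell_j(\theta,\eta,Z_{ji})$, and let $(\hat\theta_1,\dots,\hat\theta_m)$ minimize $\sum_jf_j(\theta_j,\hat\eta_j)+\sum_{j'<j}\lambda_{jj'}\|\theta_j-\theta_{j'}\|$ over $\Theta^m$ whenever a minimizer exists. The tuning parameters satisfy, for all large $n$, $n_{\min}^{\alpha\gamma}\ge c_0n_{\max}$, $0\le\varepsilon_n\le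 c_1m^{-2}N_{\min}^{\zeta}$ and $c_2<\tau<c_2n_{\min}^{\alpha\gamma}$, where $c_0,c_1>0$ and $c_2\ge c_w(\delta/2)^{-\gamma}$ are constants. The sample sizes satisfy $m^{-1}\min_j\{n_j^{r_2/(2(r_2+d))}\wedge s(n_j)\}\to\infty$ (for bounded $m$: $n_{\min}\to\infty$). **Theorem (asymptotic normality).** Suppose in addition that $K=O(1)$, and let $k=k_n$ be a cluster with $b_{k,n}=K\,m_k^{1/2}\max_{j\in S_k}n_j^{1/2}s(n_j)^{-2}=o(1)$. With $F_k(\beta)=\sum_{j\in S_k}f_j(\beta,\eta_j^*)$, the matrices $$\Psi_k=\mathbb E[N_k^{-1}\nabla^2F_k(\beta_k^*)],\qquad \Omega_k=\mathbb E[N_k^{-1}\nabla F_k(\beta_k^*)\nabla F_k(\beta_k^*)^\top]$$ are well defined, $\Psi_k$ is positive definite, and for every $j\in S_k$ $$\sqrt{N_k}\,(\hat\theta_j-\theta_j^*)\ \Rightarrow\ \mathcal N\big(0,\Psi_k^{-1}\Omega_k\Psi_k^{-1}\big).$$ As the normal law may depend on $n$, this means $\mathbb E\,g(\sqrt{N_k}(\hat\theta_j-\theta_j^*))-\int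 g\,d\mathcal N(0,\Psi_k^{-1}\Omega_k\Psi_k^{-1})\to0$ for every bounded continuous $g$. The same holds for $\sqrt{N_k}(\tilde\beta_k-\beta_k^*)$, where $\tilde\beta_k$ is the oracle estimator that knows the clustering and minimizes $\sum_{j\in S_k}f_j(\beta,\hat\eta_j)$ over $\Theta$ (whenever a minimizer exists). -/

import Mathlib

open MeasureTheory ProbabilityTheory Filter Topology Asymptotics
open scoped ENNReal BoundedContinuousFunction

universe u v w

noncomputable section

/-- The Euclidean space in which the target parameters live. -/
abbrev Euc (d : ℕ) : Type := EuclideanSpace ℝ (Fin d)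

/-- `f` is twice differentiable at `x`. -/
def TwiceDifferentiableAt {E F : Type*} [NormedAddCommGroup E] [NormedSpace ℝ E]
    [NormedAddCommGroup F] [NormedSpace ℝ F] (f : E → F) (x : E) : Prop :=
  (∀ᶠ y in 𝓝 x, DifferentiableAt ℝ f y) ∧ DifferentiableAt ℝ (fderiv ℝ f) x

/-- The Hessian of a real function, as a linear operator (so that its norm is the spectral norm). -/
def hessian {d : ℕ} (f : Euc d → ℝ) (x : Euc d) : Euc d →L[ℝ] Euc d :=
  fderiv ℝ (gradient f) x

/-- The Gateaux derivative of `G` at `η` in the direction `h`. -/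
def gateaux {H : Type*} [AddCommGroup H] [Module ℝ H] {d : ℕ}
    (G : H → Euc d) (η h : H) : Euc d :=
  deriv (fun t : ℝ => G (η + t • h)) 0

/-- The second Gateaux derivative of `G` at `η` in the directions `h, h`. -/
def gateauxTwo {H : Type*} [AddCommGroup H] [Module ℝ H] {d : ℕ}
    (G : H → Euc d) (η h : H) : Euc d :=
  iteratedDeriv 2 (fun t : ℝ => G (η + t • h)) 0

/-- The minimizers of `L` over the set `S`. -/
def argminOn {α β : Type*} [LE β] (L : α → β) (S : Set α) : Set α :=
  {x | x ∈ S ∧ ∀ y ∈ S, L x ≤ L y}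

/-- The objects of one clustered multitask problem with target dimension `d`, together with the
data and the preliminary estimators.  The asymptotic theory is about a sequence of these. -/
structure Experiment (d : ℕ) where
  /-- number of tasks -/
  m : ℕ
  /-- number of clusters -/
  K : ℕ
  /-- the cluster that contains a given task -/
  cluster : Fin m → Fin K
  /-- sample size of each task (of the split on which the orthogonal loss is evaluated) -/
  n : Fin m → ℕ
  /-- nuisance spaces -/
  H : Fin m → Type u
  [groupH : ∀ j, SeminormedAddCommGroup (H j)]
  [spaceH : ∀ j, NormedSpace ℝ (H j)]
  [measurableH : ∀ j, MeasurableSpace (H j)]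
  /-- observation spaces -/
  Obs : Fin m → Type v
  [measurableObs : ∀ j, MeasurableSpace (Obs j)]
  /-- distribution of one observation of each task -/
  P : ∀ j, Measure (Obs j)
  [probP : ∀ j, IsProbabilityMeasure (P j)]
  /-- parameter space -/
  Θ : Set (Euc d)
  /-- orthogonal losses `ℓ_j(θ, η, z)` -/
  loss : ∀ j, Euc d → H j → Obs j → ℝ
  /-- common true target parameter of each cluster -/
  β : Fin K → Euc d
  /-- true nuisance parameters -/
  ηstar : ∀ j, H j
  /-- nuisance realization sets -/
  T : ∀ j, Set (H j)
  /-- the probability space on which data and estimators live -/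
  Ω : Type w
  [measurableΩ : MeasurableSpace Ω]
  μ : Measure Ω
  [probμ : IsProbabilityMeasure μ]
  /-- the observations on which the orthogonal losses are evaluated -/
  Z : ∀ j, Fin (n j) → Ω → Obs j
  /-- nuisance estimators -/
  ηhat : ∀ j, Ω → H j
  /-- pilot estimators of the targets -/
  θinit : Fin m → Ω → Euc d

attribute [instance] Experiment.groupH Experiment.spaceH Experiment.measurableH
  Experiment.measurableObs Experiment.probP Experiment.measurableΩ Experiment.probμ

namespace Experiment

variable {d : ℕ} (X : Experiment.{u, v, w} d)

/-- True target parameter of task `j`: the parameter of its cluster. -/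
def θstar (j : Fin X.m) : Euc d := X.β (X.cluster j)

/-- The population risk `R_j(θ, η)`. -/
def risk (j : Fin X.m) (θ : Euc d) (η : X.H j) : ℝ := ∫ z, X.loss j θ η z ∂X.P j

/-- The population Hessian `H_j(θ)` of the risk at the true nuisance. -/
def popHessian (j : Fin X.m) (θ : Euc d) : Euc d →L[ℝ] Euc d :=
  hessian (fun ϑ => X.risk j ϑ (X.ηstar j)) θ

/-- The score `∇_θ ℓ_j(θ_j^*, η, z)` at the true target, as a function of the nuisance. -/
def score (j : Fin X.m) (η : X.H j) (z : X.Obs j) : Euc d :=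
  gradient (fun θ => X.loss j θ η z) (X.θstar j)

/-- Smallest sample size of a task. -/
def nMin : ℕ := ⨅ j, X.n j

/-- Largest sample size of a task. -/
def nMax : ℕ := ⨆ j, X.n j

/-- Pooled sample size `N_k` of a cluster. -/
def N (k : Fin X.K) : ℕ := ∑ j with X.cluster j = k, X.n j

/-- Smallest pooled sample size of a cluster. -/
def NMin : ℕ := ⨅ k, X.N k

/-- Number `m_k` of tasks in a cluster. -/
def clusterSize (k : Fin X.K) : ℕ := (Finset.univ.filter fun j => X.cluster j = k).card

/-- `b_k = K m_k^{1/2} max_{j ∈ S_k} n_j^{1/2} s(n_j)^{-2}`. -/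
def b (s : ℕ → ℝ) (k : Fin X.K) : ℝ :=
  X.K * Real.sqrt (X.clusterSize k) *
    ⨆ j : {j : Fin X.m // X.cluster j = k}, Real.sqrt (X.n j) / s (X.n j) ^ 2

/-- The empirical loss `f_j(θ, η)`. -/
def empLoss (j : Fin X.m) (θ : Euc d) (η : X.H j) (ω : X.Ω) : ℝ :=
  ∑ i, X.loss j θ η (X.Z j i ω)

/-- The pooled loss `F_k(θ, (η_j)_{j ∈ S_k})` of a cluster. -/
def clusterLoss (k : Fin X.K) (θ : Euc d) (η : ∀ j, X.H j) (ω : X.Ω) : ℝ :=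
  ∑ j with X.cluster j = k, X.empLoss j θ (η j) ω

/-- The adaptive weight `c_w ‖θinit_j - θinit_j'‖^{-γ}`, which is infinite for `γ > 0` if the
two pilot estimates coincide. -/
def weight (cw γ : ℝ) (j j' : Fin X.m) (ω : X.Ω) : ℝ≥0∞ :=
  ENNReal.ofReal cw * ‖X.θinit j ω - X.θinit j' ω‖ₑ ^ (-γ)

open Classical in
/-- The fusion penalty `λ_{jj'}`. -/
def penalty (cw γ τ ε : ℝ) (j j' : Fin X.m) (ω : X.Ω) : ℝ≥0∞ :=
  if X.weight cw γ j j' ω ≤ ENNReal.ofReal τ then ENNReal.ofReal ε else X.weight cw γ j j' ω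

/-- The objective of the second stage.  An infinite penalty forces the two parameters to agree
(`∞ * 0 = 0` in `ℝ≥0∞`). -/
def objective (cw γ τ ε : ℝ) (ω : X.Ω) (ϑ : Fin X.m → Euc d) : EReal :=
  ((∑ j, X.empLoss j (ϑ j) (X.ηhat j ω) ω : ℝ) : EReal) +
    ((∑ j, ∑ j' with j' < j, X.penalty cw γ τ ε j j' ω * ‖ϑ j - ϑ j'‖ₑ : ℝ≥0∞) : EReal)

/-- `θhat` is the adaptive fusion estimator: a random vector which almost surely minimizes the
objective of the second stage over `Θ^m`, whenever a minimizer exists. -/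
def IsFusionEstimator (cw γ τ ε : ℝ) (θhat : Fin X.m → X.Ω → Euc d) : Prop :=
  (∀ j, Measurable (θhat j)) ∧
  ∀ᵐ ω ∂X.μ, (argminOn (X.objective cw γ τ ε ω) {ϑ | ∀ j, ϑ j ∈ X.Θ}).Nonempty →
    (fun j => θhat j ω) ∈ argminOn (X.objective cw γ τ ε ω) {ϑ | ∀ j, ϑ j ∈ X.Θ}

/-- `βtilde` is the oracle estimator for cluster `k`, which knows the cluster: a random vector
which almost surely minimizes the pooled loss over `Θ`, whenever a minimizer exists. -/
def IsOracleEstimator (k : Fin X.K) (βtilde : X.Ω → Euc d) : Prop :=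
  Measurable βtilde ∧
  ∀ᵐ ω ∂X.μ,
    (argminOn (fun θ => X.clusterLoss k θ (fun j => X.ηhat j ω) ω) X.Θ).Nonempty →
    βtilde ω ∈ argminOn (fun θ => X.clusterLoss k θ (fun j => X.ηhat j ω) ω) X.Θ

/-- `N_k⁻¹ ∇² F_k(β_k^*, η^*)`, as a matrix. -/
def pooledHessian (k : Fin X.K) (ω : X.Ω) : Matrix (Fin d) (Fin d) ℝ :=
  Matrix.of fun a c => (X.N k : ℝ)⁻¹ *
    (hessian (fun θ => X.clusterLoss k θ X.ηstar ω) (X.β k) (EuclideanSpace.single c 1)) a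

/-- `N_k⁻¹ ∇F_k(β_k^*, η^*) ∇F_k(β_k^*, η^*)ᵀ`, as a matrix. -/
def pooledScoreOuter (k : Fin X.K) (ω : X.Ω) : Matrix (Fin d) (Fin d) ℝ :=
  Matrix.of fun a c => (X.N k : ℝ)⁻¹ *
    (gradient (fun θ => X.clusterLoss k θ X.ηstar ω) (X.β k) a *
      gradient (fun θ => X.clusterLoss k θ X.ηstar ω) (X.β k) c)

/-- `Ψ_k`, the normalized expected pooled Hessian. -/
def Psi (k : Fin X.K) : Matrix (Fin d) (Fin d) ℝ :=
  Matrix.of fun a c => ∫ ω, X.pooledHessian k ω a c ∂X.μ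

/-- `Ω_k`, the normalized covariance of the pooled score. -/
def Omega (k : Fin X.K) : Matrix (Fin d) (Fin d) ℝ :=
  Matrix.of fun a c => ∫ ω, X.pooledScoreOuter k ω a c ∂X.μ

/-- `Ψ_k⁻¹ Ω_k Ψ_k⁻¹`. -/
def asymptoticCov (k : Fin X.K) : Matrix (Fin d) (Fin d) ℝ :=
  (X.Psi k)⁻¹ * X.Omega k * (X.Psi k)⁻¹

/-- The setting: clusters are nonempty and `δ`-separated; the samples are i.i.d. within a task and
independent across tasks; each nuisance estimator is independent of the sample on which it is
used; the targets minimize the population risk.  The rest is measurability and the domain of the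
losses (`Θ` is convex and contains a neighbourhood of the balls of radius `M`). -/
structure Setting (M δ : ℝ) : Prop where
  n_pos : ∀ j, 0 < X.n j
  cluster_surjective : Function.Surjective X.cluster
  separation : ∀ k k', k ≠ k' → δ ≤ ‖X.β k - X.β k'‖
  convex_Θ : Convex ℝ X.Θ
  ball_subset : ∀ j, Metric.closedBall (X.θstar j) M ⊆ interior X.Θ
  measurable_loss : ∀ j, ∀ θ ∈ X.Θ,
    Measurable fun p : X.H j × X.Obs j => X.loss j θ p.1 p.2
  measurable_norm : ∀ j, Measurable fun η : X.H j => ‖η - X.ηstar j‖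
  measurable_segment : ∀ j, ∀ t : ℝ,
    Measurable fun η : X.H j => X.ηstar j + t • (η - X.ηstar j)
  measurableSet_T : ∀ j, MeasurableSet (X.T j)
  measurable_Z : ∀ j i, Measurable (X.Z j i)
  measurable_ηhat : ∀ j, Measurable (X.ηhat j)
  law_Z : ∀ j i, X.μ.map (X.Z j i) = X.P j
  indep_Z : iIndepFun (fun p : (j : Fin X.m) × Fin (X.n j) => X.Z p.1 p.2) X.μ
  indep_ηhat : ∀ j, IndepFun (X.ηhat j) (fun ω i => X.Z j i ω) X.μ
  integrable_loss : ∀ j, ∀ θ ∈ X.Θ, Integrable (X.loss j θ (X.ηstar j)) (X.P j)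
  isMin_risk : ∀ j, X.θstar j ∈ argminOn (fun θ => X.risk j θ (X.ηstar j)) X.Θ

/-- Regularity of the losses. -/
structure LossRegularity (M ρ κ σ₁ σ₂ σ₃ σ₅ r₁ r₂ : ℝ) : Prop where
  convex : ∀ j, ∀ η ∈ Metric.closedBall (X.ηstar j) M, ∀ z,
    ConvexOn ℝ X.Θ fun θ => X.loss j θ η z
  smooth : ∀ j, ∀ η ∈ Metric.closedBall (X.ηstar j) M, ∀ z,
    ∀ θ ∈ Metric.closedBall (X.θstar j) M,
      TwiceDifferentiableAt (fun ϑ => X.loss j ϑ η z) θ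
  /-- curvature -/
  curvature : ∀ j, ∀ θ ∈ Metric.closedBall (X.θstar j) M, ∀ v : Euc d,
    ρ * ‖v‖ ^ 2 ≤ inner ℝ v (X.popHessian j θ v) ∧
      inner ℝ v (X.popHessian j θ v) ≤ κ * ‖v‖ ^ 2
  /-- the score has mean zero -/
  score_mean : ∀ j, HasGradientAt (fun θ => X.risk j θ (X.ηstar j)) 0 (X.θstar j)
  /-- the score has a bounded moment of order `r₁` -/
  score_moment : ∀ j,
    ∫⁻ z, ‖X.score j (X.ηstar j) z‖ₑ ^ r₁ ∂X.P j ≤ ENNReal.ofReal σ₁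
  /-- Hessian moment -/
  hessian_moment : ∀ j, ∀ θ ∈ Metric.closedBall (X.θstar j) M, ∀ v : Euc d, ‖v‖ = 1 →
    ∫⁻ z, ‖inner ℝ v
      ((hessian (fun ϑ => X.loss j ϑ (X.ηstar j) z) θ - X.popHessian j θ) v)‖ₑ ^ r₂ ∂X.P j
      ≤ ENNReal.ofReal σ₂
  /-- uniform Lipschitz condition on the Hessian: the supremum of the difference quotients over
  the two balls is dominated by a variable `L` with mean at most `σ₃` -/
  hessian_lipschitz : ∀ j, ∃ L : X.Obs j → ℝ, Integrable L (X.P j) ∧ ∫ z, L z ∂X.P j ≤ σ₃ ∧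
    ∀ᵐ z ∂X.P j,
      ∀ θ ∈ Metric.closedBall (X.θstar j) M, ∀ θ' ∈ Metric.closedBall (X.θstar j) M,
      ∀ η ∈ Metric.closedBall (X.ηstar j) M, ∀ η' ∈ Metric.closedBall (X.ηstar j) M,
        ‖hessian (fun ϑ => X.loss j ϑ η z) θ - hessian (fun ϑ => X.loss j ϑ η' z) θ'‖ ≤
          L z * (‖θ - θ'‖ + ‖η - η'‖)
  /-- Neyman orthogonality: `D_η ∇_θ R_j(θ_j^*, η_j^*)[η - η_j^*]` exists and vanishes (the risk
  that is differentiated being finite) -/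
  orthogonality : ∀ j, ∀ η ∈ X.T j,
    (∀ᶠ t : ℝ in 𝓝 0, ∀ θ ∈ Metric.closedBall (X.θstar j) M,
      Integrable (X.loss j θ (X.ηstar j + t • (η - X.ηstar j))) (X.P j)) ∧
    HasDerivAt (fun t : ℝ =>
      gradient (fun θ => X.risk j θ (X.ηstar j + t • (η - X.ηstar j))) (X.θstar j)) 0 0
  /-- along the segments, the score exists and has two Gateaux derivatives in the nuisance -/
  smooth_nuisance : ∀ j, ∀ η ∈ X.T j, ∀ η' ∈ segment ℝ (X.ηstar j) η, ∀ z,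
    DifferentiableAt ℝ (fun θ => X.loss j θ η' z) (X.θstar j) ∧
    TwiceDifferentiableAt (fun t : ℝ => X.score j (η' + t • (η - X.ηstar j)) z) 0
  /-- bounds on moments of the Gateaux derivatives -/
  gateaux_moment : ∀ j, ∀ η ∈ X.T j, ∀ η' ∈ segment ℝ (X.ηstar j) η,
    ∫⁻ z, ‖gateaux (fun ζ => X.score j ζ z) η' (η - X.ηstar j)‖ₑ ^ 2 ∂X.P j
      ≤ ENNReal.ofReal (σ₅ * ‖η - X.ηstar j‖ ^ 2) ∧
    ∫⁻ z, ‖gateauxTwo (fun ζ => X.score j ζ z) η' (η - X.ηstar j)‖ₑ ∂X.P j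
      ≤ ENNReal.ofReal (σ₅ * ‖η - X.ηstar j‖ ^ 2)

end Experiment

variable {d : ℕ}

/-- Regularity of the nuisance estimators, along a sequence of problems: mean square error at most
`σ₄ / s(n_j)²` with a rate `s(n) = ω(n^{1/4})`, `s(n) ≲ n^{1/2}`; and the nuisance estimators
belong to the nuisance realization sets with probability tending to one. -/
structure NuisanceRegularity (X : ℕ → Experiment.{u, v, w} d) (s : ℕ → ℝ) (σ₄ : ℝ) : Prop where
  s_pos : ∀ n, 0 < n → 0 < s n
  s_fast : (fun n : ℕ => (n : ℝ) ^ (1 / 4 : ℝ)) =o[atTop] s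
  s_slow : s =O[atTop] fun n : ℕ => (n : ℝ) ^ (1 / 2 : ℝ)
  mse : ∀ n, ∀ j, ∫⁻ ω, ‖(X n).ηhat j ω - (X n).ηstar j‖ₑ ^ 2 ∂(X n).μ
    ≤ ENNReal.ofReal (σ₄ / s ((X n).n j) ^ 2)
  realization : Tendsto (fun n => (X n).μ {ω | ∃ j, (X n).ηhat j ω ∉ (X n).T j}) atTop (𝓝 0)

/-- Consistency of the pilot estimators: for every `e > 0`, with probability tending to one,
`n_j^α ‖θinit_j - θ_j^*‖ < e` for all tasks. -/
def PilotConsistency (X : ℕ → Experiment.{u, v, w} d) (α : ℝ) : Prop :=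
  ∀ e : ℝ, 0 < e → Tendsto (fun n => (X n).μ {ω | ¬ ∀ j,
    ((X n).n j : ℝ) ^ α * ‖(X n).θinit j ω - (X n).θstar j‖ < e}) atTop (𝓝 0)

/-- The random vectors `Y n` are asymptotically `N(0, V n)`: the difference between the law of
`Y n` and `N(0, V n)` converges to zero against every bounded continuous function.  If `V` does
not depend on `n`, this is convergence in distribution to `N(0, V)`. -/
def AsymptoticallyNormal (X : ℕ → Experiment.{u, v, w} d) (Y : ∀ n, (X n).Ω → Euc d)
    (V : ℕ → Matrix (Fin d) (Fin d) ℝ) : Prop :=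
  ∀ g : Euc d →ᵇ ℝ, Tendsto (fun n => ∫ ω, g (Y n ω) ∂(X n).μ -
    ∫ x, g x ∂(multivariateGaussian 0 (V n))) atTop (𝓝 0)

end

noncomputable section

section ConvexGradient

variable {E : Type*} [NormedAddCommGroup E] [InnerProductSpace ℝ E] [CompleteSpace E]

/-- A curve through a point at which it is minimal from the right has nonnegative derivative. -/
lemma deriv_nonneg_of_right_min {φ : ℝ → ℝ} {D : ℝ} (h : HasDerivAt φ D 0)
    {t₀ : ℝ} (ht₀ : 0 < t₀) (hmin : ∀ t ∈ Set.Ioo 0 t₀, φ 0 ≤ φ t) : 0 ≤ D := by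
  have h1 := h.tendsto_slope_zero_right
  refine ge_of_tendsto h1 ?_
  filter_upwards [Ioo_mem_nhdsGT ht₀] with t ht
  simp only [zero_add, smul_eq_mul]
  exact mul_nonneg (inv_nonneg.2 ht.1.le) (sub_nonneg.2 (hmin t ht))

lemma HasGradientAt.hasDerivAt_line {f : E → ℝ} {g x : E} (h : HasGradientAt f g x) (y : E) :
    HasDerivAt (fun t : ℝ => f (x + t • y)) (inner ℝ g y) 0 := by
  have h1 : HasFDerivAt f (InnerProductSpace.toDual ℝ E g) (x + (0 : ℝ) • y) := by
    simpa using h.hasFDerivAt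
  have h2 : HasDerivAt (fun t : ℝ => x + t • y) y 0 := by
    simpa using ((hasDerivAt_id (0 : ℝ)).smul_const y).const_add x
  exact (h1.comp_hasDerivAt 0 h2).congr_deriv (by simp)

/-- The gradient inequality of a convex function. -/
lemma ConvexOn.add_inner_gradient_le {Θ : Set E} {f : E → ℝ} (hf : ConvexOn ℝ Θ f) {g x y : E}
    (hx : x ∈ Θ) (hy : y ∈ Θ) (h : HasGradientAt f g x) :
    f x + inner ℝ g (y - x) ≤ f y := by
  have h1 : HasDerivAt (fun t : ℝ => (f x + t * (f y - f x)) - f (x + t • (y - x)))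
      ((f y - f x) - inner ℝ g (y - x)) 0 := by
    refine HasDerivAt.sub ?_ (h.hasDerivAt_line _)
    simpa using ((hasDerivAt_id (0 : ℝ)).mul_const (f y - f x)).const_add (f x)
  have := deriv_nonneg_of_right_min h1 one_pos fun t ht => by
    have h2 := hf.2 hx hy (sub_nonneg.2 ht.2.le) ht.1.le (by ring)
    have h3 : (1 - t) • x + t • y = x + t • (y - x) := by module
    rw [h3] at h2
    simp only [smul_eq_mul] at h2
    simp only [zero_mul, zero_smul, add_zero, sub_self]
    linarith
  linarith

/-- The gradient inequality is strict if the gradient is strongly monotone nearby. -/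
lemma ConvexOn.add_inner_gradient_lt {Θ : Set E} {f : E → ℝ} (hf : ConvexOn ℝ Θ f) {g : E → E}
    {x y c : E} {r a : ℝ} (ha : 0 < a) (hball : Metric.closedBall c r ⊆ Θ)
    (hg : ∀ z ∈ Metric.closedBall c r, HasGradientAt f (g z) z)
    (hmono : ∀ z ∈ Metric.closedBall c r, ∀ z' ∈ Metric.closedBall c r,
      a * ‖z - z'‖ ^ 2 ≤ inner ℝ (g z - g z') (z - z'))
    (hx : x ∈ Metric.ball c r) (hy : y ∈ Θ) (hxy : y ≠ x) :
    f x + inner ℝ (g x) (y - x) < f y := by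
  have hcont : Tendsto (fun t : ℝ => x + t • (y - x)) (𝓝 0) (𝓝 x) := by
    have : Continuous (fun t : ℝ => x + t • (y - x)) := by fun_prop
    simpa using this.tendsto 0
  have h1 : ∀ᶠ t : ℝ in 𝓝[>] 0, x + t • (y - x) ∈ Metric.ball c r ∧ t ∈ Set.Ioo (0 : ℝ) 1 :=
    ((hcont.eventually (Metric.isOpen_ball.mem_nhds hx)).filter_mono nhdsWithin_le_nhds).and
      (Ioo_mem_nhdsGT one_pos)
  obtain ⟨t, hz, ht⟩ := h1.exists
  set z := x + t • (y - x) with hzdef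
  have hxb := Metric.ball_subset_closedBall hx
  have hzb := Metric.ball_subset_closedBall hz
  have e1 := hf.add_inner_gradient_le (hball hzb) hy (hg z hzb)
  have e2 := hf.add_inner_gradient_le (hball hxb) (hball hzb) (hg x hxb)
  have e3 := hmono z hzb x hxb
  have hzx : z - x = t • (y - x) := by simp [hzdef]
  have hyz : y - z = (1 - t) • (y - x) := by rw [hzdef]; module
  rw [hyz, inner_smul_right] at e1
  rw [hzx, inner_smul_right] at e2
  rw [hzx, inner_smul_right, norm_smul, inner_sub_left] at e3
  have hpos : 0 < ‖y - x‖ := norm_pos_iff.2 (sub_ne_zero.2 hxy)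
  have e4 : 0 < a * (‖t‖ * ‖y - x‖) ^ 2 := by
    have : 0 < ‖t‖ := norm_pos_iff.2 ht.1.ne'
    positivity
  have e5 : 0 < inner ℝ (g z) (y - x) - inner ℝ (g x) (y - x) :=
    (mul_pos_iff_of_pos_left ht.1).1 (e4.trans_le e3)
  nlinarith [mul_pos (sub_pos.2 ht.2) e5]

lemma hasGradientAt_norm_sub {x y : E} (h : x ≠ y) :
    HasGradientAt (fun z : E => ‖z - y‖) (‖x - y‖⁻¹ • (x - y)) x := by
  have h0 : x - y ≠ 0 := sub_ne_zero.2 h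
  have h1 : HasStrictFDerivAt (fun z : E => ‖z - y‖ ^ 2) (2 • innerSL ℝ (x - y)) x := by
    have := (hasStrictFDerivAt_norm_sq (x - y)).comp x ((hasStrictFDerivAt_id x).sub_const y)
    simpa [Function.comp_def] using this
  have h2 := h1.hasFDerivAt.sqrt (pow_ne_zero 2 (norm_ne_zero_iff.2 h0))
  simp only [Real.sqrt_sq (norm_nonneg _)] at h2
  rw [hasGradientAt_iff_hasFDerivAt]
  refine h2.congr_fderiv ?_
  ext v
  simp
  field_simp

end ConvexGradient

section Fusion

lemma sum_lt_add_swap {ι : Type*} [Fintype ι] [LinearOrder ι] (a : ι → ι → ℝ)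
    (ha : ∀ i, a i i = 0) :
    ∑ i, ∑ i' with i' < i, (a i i' + a i' i) = ∑ i, ∑ i', a i i' := by
  have h1 : ∑ i, ∑ i' with i' < i, a i' i = ∑ i, ∑ i' with i < i', a i i' :=
    Finset.sum_comm' (by simp)
  simp only [Finset.sum_add_distrib]
  rw [h1, ← Finset.sum_add_distrib]
  refine Finset.sum_congr rfl fun i _ => ?_
  rw [← Finset.sum_filter_add_sum_filter_not Finset.univ (fun i' => i' < i)]
  congr 1
  rw [← Finset.sum_filter_add_sum_filter_not (Finset.univ.filter fun i' => ¬ i' < i)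
    (fun i' => i < i')]
  rw [Finset.filter_filter, Finset.filter_filter, Finset.sum_eq_zero (s := Finset.univ.filter
    fun i' => ¬ i' < i ∧ ¬ i < i'), add_zero]
  · exact Finset.sum_congr (by ext; simp; exact le_of_lt) fun _ _ => rfl
  · intro i' hi'
    simp only [Finset.mem_filter, Finset.mem_univ, true_and, not_lt] at hi'
    rw [le_antisymm hi'.1 hi'.2, ha]

variable {d m K : ℕ}

/-- A sum of losses with pairwise fusion penalties. -/
def fusionObjective (f : Fin m → Euc d → ℝ) (p : Fin m → Fin m → ℝ) (ϑ : Fin m → Euc d) : ℝ :=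
  ∑ j, f j (ϑ j) + ∑ j, ∑ j' with j' < j, p j j' * ‖ϑ j - ϑ j'‖

/-- Unit vectors pointing from the parameters of other clusters to that of task `j`. -/
def fusionDirection (c : Fin m → Fin K) (b : Fin K → Euc d) (j j' : Fin m) : Euc d :=
  if c j = c j' then 0 else ‖b (c j) - b (c j')‖⁻¹ • (b (c j) - b (c j'))

lemma norm_fusionDirection_le (c : Fin m → Fin K) (b : Fin K → Euc d) (j j' : Fin m) :
    ‖fusionDirection c b j j'‖ ≤ 1 := by
  unfold fusionDirection
  split_ifs
  · simp
  · rw [norm_smul, norm_inv, norm_norm]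
    exact inv_mul_le_one

lemma fusionDirection_swap (c : Fin m → Fin K) (b : Fin K → Euc d) (j j' : Fin m) :
    fusionDirection c b j' j = -fusionDirection c b j j' := by
  unfold fusionDirection
  by_cases h : c j = c j'
  · simp [h]
  · rw [if_neg h, if_neg (Ne.symm h), norm_sub_rev, ← smul_neg, neg_sub]

lemma sum_inner_fusionDirection (c : Fin m → Fin K) (b : Fin K → Euc d) (x : Fin m → Euc d) :
    ∑ j, ∑ j' with j' < j, inner ℝ (fusionDirection c b j j') (x j - x j') =
      ∑ j, inner ℝ (∑ j', fusionDirection c b j j') (x j) := by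
  simp only [sum_inner]
  rw [← sum_lt_add_swap (fun j j' => inner ℝ (fusionDirection c b j j') (x j))]
  · refine Finset.sum_congr rfl fun j _ => Finset.sum_congr rfl fun j' _ => ?_
    rw [fusionDirection_swap c b j j', inner_sub_right, inner_neg_left]
    ring
  · simp [fusionDirection]

/-- Gradient of the fused objective with respect to the parameter of one task. -/
def fusionGradient (c : Fin m → Fin K) (g : Fin m → Euc d → Euc d) (e : ℝ)
    (b : Fin K → Euc d) (j : Fin m) : Euc d :=
  g j (b (c j)) + e • ∑ j', fusionDirection c b j j'

lemma norm_sum_fusionDirection_le (c : Fin m → Fin K) (b : Fin K → Euc d) (j : Fin m) :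
    ‖∑ j', fusionDirection c b j j'‖ ≤ m :=
  (norm_sum_le _ _).trans <| (Finset.sum_le_sum fun j' _ => norm_fusionDirection_le c b j j').trans
    (by simp)

/-- The derivative of the fused objective along a fused direction. -/
lemma hasDerivAt_fusionObjective (c : Fin m → Fin K) {f : Fin m → Euc d → ℝ}
    {g : Fin m → Euc d → Euc d} {e Λ : ℝ} {b : Fin K → Euc d}
    (hg : ∀ j, HasGradientAt (f j) (g j (b (c j))) (b (c j)))
    (hb : ∀ k k', k ≠ k' → b k ≠ b k') (x : Fin K → Euc d) :
    HasDerivAt (fun t : ℝ => fusionObjective f (fun j j' => if c j = c j' then Λ else e)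
      (fun j => b (c j) + t • x (c j)))
      (∑ j, inner ℝ (fusionGradient c g e b j) (x (c j))) 0 := by
  unfold fusionObjective
  have h1 : HasDerivAt (fun t : ℝ => ∑ j, f j (b (c j) + t • x (c j)))
      (∑ j, inner ℝ (g j (b (c j))) (x (c j))) 0 :=
    HasDerivAt.fun_sum fun j _ => (hg j).hasDerivAt_line _
  have h2 : HasDerivAt (fun t : ℝ => ∑ j, ∑ j' with j' < j, (if c j = c j' then Λ else e) *
      ‖(b (c j) + t • x (c j)) - (b (c j') + t • x (c j'))‖)
      (∑ j, ∑ j' with j' < j, e * inner ℝ (fusionDirection c b j j') (x (c j) - x (c j'))) 0 := by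
    refine HasDerivAt.fun_sum fun j _ => HasDerivAt.fun_sum fun j' _ => ?_
    by_cases h : c j = c j'
    · simp only [h, sub_self, norm_zero, mul_zero, fusionDirection, if_true, inner_zero_left]
      exact hasDerivAt_const _ _
    · simp only [fusionDirection, if_neg h]
      refine HasDerivAt.const_mul e ?_
      have := (hasGradientAt_norm_sub (hb _ _ h)).hasDerivAt_line (x (c j) - x (c j'))
      refine this.congr_of_eventuallyEq (Eventually.of_forall fun t => ?_)
      simp only
      congr 1
      module
  refine (h1.add h2).congr_deriv ?_
  simp only [← Finset.mul_sum]
  rw [sum_inner_fusionDirection c b (fun j => x (c j)), Finset.mul_sum, ← Finset.sum_add_distrib]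
  refine Finset.sum_congr rfl fun j _ => ?_
  rw [fusionGradient, inner_add_left, real_inner_smul_left]

lemma exists_fused_minimizer (c : Fin m → Fin K) {f : Fin m → Euc d → ℝ}
    {g : Fin m → Euc d → Euc d} {e Λ r : ℝ} (β : Fin K → Euc d) (hr : 0 < r) (he : 0 ≤ e)
    (hsep : ∀ k k', k ≠ k' → 2 * r < ‖β k - β k'‖)
    (hg : ∀ j, ∀ z ∈ Metric.closedBall (β (c j)) r, HasGradientAt (f j) (g j z) z)
    {a : Fin m → ℝ}
    (hmono : ∀ j, ∀ z ∈ Metric.closedBall (β (c j)) r, ∀ z' ∈ Metric.closedBall (β (c j)) r,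
      a j * ‖z - z'‖ ^ 2 ≤ inner ℝ (g j z - g j z') (z - z'))
    (hsmall : ∀ k, ‖∑ j with c j = k, g j (β k)‖ +
      e * m * (Finset.univ.filter fun j => c j = k).card < r * ∑ j with c j = k, a j) :
    ∃ b : Fin K → Euc d, (∀ k, b k ∈ Metric.ball (β k) r) ∧
      ∀ k, ∑ j with c j = k, fusionGradient c g e b j = 0 := by
  set Q := fusionObjective f (fun j j' => if c j = c j' then Λ else e) with hQ
  have hcomp : IsCompact (Set.pi Set.univ fun k => Metric.closedBall (β k) r) :=
    isCompact_univ_pi fun k => isCompact_closedBall _ _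
  have hcont : ContinuousOn (fun b : Fin K → Euc d => Q fun j => b (c j))
      (Set.pi Set.univ fun k => Metric.closedBall (β k) r) := by
    rw [hQ]
    unfold fusionObjective
    refine ContinuousOn.add (continuousOn_finsetSum _ fun j _ => ?_) (by fun_prop)
    have h1 : ContinuousOn (f j) (Metric.closedBall (β (c j)) r) := fun z hz =>
      (hg j z hz).hasFDerivAt.continuousAt.continuousWithinAt
    exact h1.comp (by fun_prop) fun b hb => hb _ trivial
  obtain ⟨b, hb, hmin⟩ := hcomp.exists_isMinOn
    ⟨β, fun k _ => Metric.mem_closedBall_self hr.le⟩ hcont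
  have hbne : ∀ k k', k ≠ k' → b k ≠ b k' := by
    intro k k' hk h
    have h1 := hb k trivial
    have h2 := hb k' trivial
    rw [Metric.mem_closedBall, dist_eq_norm] at h1 h2
    have h3 : ‖β k - β k'‖ ≤ ‖b k' - β k'‖ + ‖b k - β k‖ := by
      have : β k - β k' = (b k' - β k') - (b k - β k) := by rw [h]; abel
      rw [this]
      exact norm_sub_le _ _
    linarith [hsep k k' hk]
  have hder := fun x => hasDerivAt_fusionObjective (Λ := Λ) (e := e) c
    (fun j => hg j _ (hb (c j) trivial)) hbne x
  have hdir : ∀ k : Fin K, ∀ w : Euc d, (∃ t₀ : ℝ, 0 < t₀ ∧ ∀ t ∈ Set.Ioo 0 t₀,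
      b k + t • w ∈ Metric.closedBall (β k) r) →
      0 ≤ inner ℝ (∑ j with c j = k, fusionGradient c g e b j) w := by
    rintro k w ⟨t₀, ht₀, hw⟩
    have h := deriv_nonneg_of_right_min (hder (Pi.single k w)) ht₀ fun t ht => by
      simp only [zero_smul, add_zero]
      refine hmin (a := b + t • (Pi.single k w : Fin K → Euc d)) fun k' _ => ?_
      by_cases hk : k' = k
      · subst hk
        simpa using hw t ht
      · simpa [hk] using hb k' trivial
    rw [sum_inner, Finset.sum_filter]
    convert h using 2 with j
    by_cases hk : c j = k
    · subst hk; simp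
    · simp [hk]
  have hbound : ∀ k, ‖∑ j with c j = k, (fusionGradient c g e b j - g j (b k))‖ ≤
      e * m * (Finset.univ.filter fun j => c j = k).card := by
    intro k
    refine (norm_sum_le _ _).trans ((Finset.sum_le_sum (g := fun _ => e * m) fun j hj => ?_).trans
      (by simp [mul_comm]))
    have hj : c j = k := by simpa using hj
    rw [fusionGradient, hj, add_sub_cancel_left, norm_smul, Real.norm_of_nonneg he]
    exact mul_le_mul_of_nonneg_left (norm_sum_fusionDirection_le c b j) he
  have hint : ∀ k, b k ∈ Metric.ball (β k) r := by
    intro k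
    rw [Metric.mem_ball, dist_eq_norm]
    have hk := hb k trivial
    by_contra! hcon
    have hxr : ‖b k - β k‖ = r := le_antisymm (by simpa [dist_eq_norm] using hk) hcon
    have h1 := hdir k (β k - b k) ⟨1, one_pos, fun t ht => by
      have : b k + t • (β k - b k) - β k = (1 - t) • (b k - β k) := by module
      rw [Metric.mem_closedBall, dist_eq_norm, this, norm_smul, hxr, Real.norm_of_nonneg
        (sub_nonneg.2 ht.2.le)]
      nlinarith [ht.1]⟩
    have h2 : (∑ j with c j = k, a j) * ‖b k - β k‖ ^ 2 ≤
        inner ℝ (∑ j with c j = k, (g j (b k) - g j (β k))) (b k - β k) := by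
      rw [sum_inner, Finset.sum_mul]
      refine Finset.sum_le_sum fun j hj => ?_
      have hj : c j = k := by simpa using hj
      subst hj
      exact hmono j _ hk _ (Metric.mem_closedBall_self hr.le)
    have h3 : ∑ j with c j = k, (g j (b k) - g j (β k)) =
        (∑ j with c j = k, fusionGradient c g e b j) -
        (∑ j with c j = k, (fusionGradient c g e b j - g j (b k))) -
        ∑ j with c j = k, g j (β k) := by
      simp only [Finset.sum_sub_distrib]; abel
    rw [h3, inner_sub_left, inner_sub_left] at h2
    rw [← neg_sub (b k), inner_neg_right] at h1
    have h4 := neg_le_of_abs_le (abs_real_inner_le_norm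
      (∑ j with c j = k, (fusionGradient c g e b j - g j (b k))) (b k - β k))
    have h5 := neg_le_of_abs_le (abs_real_inner_le_norm
      (∑ j with c j = k, g j (β k)) (b k - β k))
    rw [hxr] at h2 h4 h5
    have h6 := hsmall k
    have h7 := hbound k
    nlinarith
  refine ⟨b, hint, fun k => ?_⟩
  set V := ∑ j with c j = k, fusionGradient c g e b j with hV
  have h1 := hdir k (-V) (by
    have hc : Continuous fun t : ℝ => b k + t • -V := by fun_prop
    have h0 : b k + (0 : ℝ) • -V ∈ Metric.ball (β k) r := by simpa using hint k
    have := hc.continuousAt.preimage_mem_nhds (Metric.isOpen_ball.mem_nhds h0)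
    obtain ⟨t₀, ht₀, h⟩ := Metric.mem_nhds_iff.1 this
    refine ⟨t₀, ht₀, fun t ht => Metric.ball_subset_closedBall (h ?_)⟩
    simpa [abs_of_pos ht.1] using ht.2)
  rw [inner_neg_right, real_inner_self_eq_norm_sq] at h1
  have : ‖V‖ = 0 := by nlinarith [norm_nonneg V]
  exact norm_eq_zero.1 this

/-- The fused minimizer is the unique minimizer of the fusion objective with penalty `Λ` within
and `e` between clusters, if `Λ` dominates the gradients of all tasks. -/
lemma fused_unique_minimizer (c : Fin m → Fin K) {f : Fin m → Euc d → ℝ}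
    {g : Fin m → Euc d → Euc d} {e Λ r : ℝ} (β : Fin K → Euc d) (he : 0 ≤ e)
    (hsep : ∀ k k', k ≠ k' → 2 * r < ‖β k - β k'‖) {Θ : Set (Euc d)}
    (hΘ : ∀ j, Metric.closedBall (β (c j)) r ⊆ Θ)
    (hf : ∀ j, ConvexOn ℝ Θ (f j))
    (hg : ∀ j, ∀ z ∈ Metric.closedBall (β (c j)) r, HasGradientAt (f j) (g j z) z)
    {a : Fin m → ℝ} (ha : ∀ j, 0 < a j)
    (hmono : ∀ j, ∀ z ∈ Metric.closedBall (β (c j)) r, ∀ z' ∈ Metric.closedBall (β (c j)) r,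
      a j * ‖z - z'‖ ^ 2 ≤ inner ℝ (g j z - g j z') (z - z'))
    (hΛ : ∀ j, ∀ z ∈ Metric.closedBall (β (c j)) r, ‖g j z‖ + e * m ≤ Λ)
    {b : Fin K → Euc d} (hb : ∀ k, b k ∈ Metric.ball (β k) r)
    (hstat : ∀ k, ∑ j with c j = k, fusionGradient c g e b j = 0)
    {ϑ : Fin m → Euc d} (hϑ : ∀ j, ϑ j ∈ Θ) (hne : ϑ ≠ fun j => b (c j)) :
    fusionObjective f (fun j j' => if c j = c j' then Λ else e) (fun j => b (c j)) <
      fusionObjective f (fun j j' => if c j = c j' then Λ else e) ϑ := by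
  classical
  set x : Fin m → Euc d := fun j => ϑ j - b (c j) with hx
  have hb' : ∀ k, b k ∈ Metric.closedBall (β k) r := fun k => Metric.ball_subset_closedBall (hb k)
  have hbne : ∀ k k', k ≠ k' → b k ≠ b k' := by
    intro k k' hk h
    have h1 := hb' k
    have h2 := hb' k'
    rw [Metric.mem_closedBall, dist_eq_norm] at h1 h2
    have h3 : ‖β k - β k'‖ ≤ ‖b k' - β k'‖ + ‖b k - β k‖ := by
      have : β k - β k' = (b k' - β k') - (b k - β k) := by rw [h]; abel
      rw [this]
      exact norm_sub_le _ _
    linarith [hsep k k' hk]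
  -- the losses
  have hloss : ∑ j, (f j (b (c j)) + inner ℝ (g j (b (c j))) (x j)) < ∑ j, f j (ϑ j) := by
    have hex : ∃ j, ϑ j ≠ b (c j) := by
      by_contra! h
      exact hne (funext h)
    obtain ⟨j₀, hj₀⟩ := hex
    refine Finset.sum_lt_sum (fun j _ => ?_) ⟨j₀, Finset.mem_univ _, ?_⟩
    · exact (hf j).add_inner_gradient_le (hΘ j (hb' _)) (hϑ j) (hg j _ (hb' _))
    · exact (hf j₀).add_inner_gradient_lt (ha j₀) (hΘ j₀) (hg j₀) (hmono j₀) (hb _) (hϑ j₀) hj₀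
  -- the penalties
  have hpen : ∑ j, ∑ j' with j' < j, ((if c j = c j' then Λ else e) * ‖b (c j) - b (c j')‖ +
      e * inner ℝ (fusionDirection c b j j') (x j - x j') +
      if c j = c j' then Λ * ‖x j - x j'‖ else 0) ≤
      ∑ j, ∑ j' with j' < j, (if c j = c j' then Λ else e) * ‖ϑ j - ϑ j'‖ := by
    refine Finset.sum_le_sum fun j _ => Finset.sum_le_sum fun j' _ => ?_
    by_cases h : c j = c j'
    · simp [h, fusionDirection, hx]
    · simp only [if_neg h, add_zero, fusionDirection, ← mul_add]
      refine mul_le_mul_of_nonneg_left ?_ he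
      set D := b (c j) - b (c j') with hD
      have hD0 : 0 < ‖D‖ := norm_pos_iff.2 (sub_ne_zero.2 (hbne _ _ h))
      have e1 : ϑ j - ϑ j' = D + (x j - x j') := by simp only [hx, hD]; abel
      rw [e1, real_inner_smul_left]
      have e2 := real_inner_le_norm D (D + (x j - x j'))
      rw [inner_add_right, real_inner_self_eq_norm_sq] at e2
      rw [← mul_le_mul_iff_right₀ hD0, mul_add, mul_inv_cancel_left₀ hD0.ne']
      nlinarith
  simp only [Finset.sum_add_distrib, ← Finset.mul_sum, sum_inner_fusionDirection] at hpen hloss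
  -- within clusters, compare with the first task of the cluster
  have hrep : ∀ j, ∃ i, c i = c j ∧ ∀ i', c i' = c j → i ≤ i' := by
    intro j
    have hne : (Finset.univ.filter fun i => c i = c j).Nonempty := ⟨j, by simp⟩
    refine ⟨_, by simpa using Finset.min'_mem _ hne, fun i' hi' => Finset.min'_le _ _ ?_⟩
    simpa using hi'
  choose q hq hqmin using hrep
  have hqc : ∀ i j, c i = c j → q i = q j := fun i j h =>
    le_antisymm (hqmin i _ ((hq j).trans h.symm)) (hqmin j _ ((hq i).trans h))
  have hV : ∀ j, ‖fusionGradient c g e b j‖ ≤ Λ := fun j =>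
    (norm_add_le _ _).trans ((add_le_add le_rfl (by
      rw [norm_smul, Real.norm_of_nonneg he]
      exact mul_le_mul_of_nonneg_left (norm_sum_fusionDirection_le c b j) he)).trans
      (hΛ j _ (hb' _)))
  have hwithin : 0 ≤ ∑ j, inner ℝ (fusionGradient c g e b j) (x j) +
      ∑ j, ∑ j' with j' < j, if c j = c j' then Λ * ‖x j - x j'‖ else 0 := by
    have e1 : ∑ j, inner ℝ (fusionGradient c g e b j) (x (q j)) = 0 := by
      rw [← Finset.sum_fiberwise Finset.univ c]
      refine Finset.sum_eq_zero fun k _ => ?_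
      by_cases hk : ∃ i, c i = k
      · obtain ⟨i, hi⟩ := hk
        have : ∀ j ∈ Finset.univ.filter fun j => c j = k,
            inner ℝ (fusionGradient c g e b j) (x (q j)) =
            inner ℝ (fusionGradient c g e b j) (x (q i)) := by
          intro j hj
          rw [hqc j i (by rw [hi]; simpa using hj)]
        rw [Finset.sum_congr rfl this, ← sum_inner, hstat, inner_zero_left]
      · push Not at hk
        rw [Finset.sum_eq_zero]
        intro j hj
        exact absurd (by simpa using hj) (hk j)
    have e0 : ∑ j, inner ℝ (fusionGradient c g e b j) (x j) =
        ∑ j, inner ℝ (fusionGradient c g e b j) (x j - x (q j)) := by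
      simp only [inner_sub_right, Finset.sum_sub_distrib, e1, sub_zero]
    rw [e0, ← Finset.sum_add_distrib]
    refine Finset.sum_nonneg fun j _ => ?_
    have hΛ0 : 0 ≤ Λ := (norm_nonneg _).trans (hV j)
    have e2 : Λ * ‖x j - x (q j)‖ ≤ ∑ j' with j' < j, if c j = c j' then Λ * ‖x j - x j'‖ else 0 := by
      have hnn : ∀ j' ∈ Finset.univ.filter (fun j' => j' < j),
          0 ≤ if c j = c j' then Λ * ‖x j - x j'‖ else 0 := fun j' _ => by split_ifs <;> positivity
      rcases (hqmin j j rfl).lt_or_eq with h | h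
      · refine le_trans ?_ (Finset.single_le_sum hnn (a := q j) (by simpa using h))
        rw [if_pos (hq j).symm]
      · rw [h, sub_self, norm_zero, mul_zero]
        exact Finset.sum_nonneg hnn
    have e3 := neg_le_of_abs_le (abs_real_inner_le_norm (fusionGradient c g e b j) (x j - x (q j)))
    nlinarith [hV j, norm_nonneg (x j - x (q j))]
  have hsplit : ∑ j, inner ℝ (fusionGradient c g e b j) (x j) =
      ∑ j, inner ℝ (g j (b (c j))) (x j) +
      e * ∑ j, inner ℝ (∑ j', fusionDirection c b j j') (x j) := by
    rw [Finset.mul_sum, ← Finset.sum_add_distrib]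
    refine Finset.sum_congr rfl fun j _ => ?_
    rw [fusionGradient, inner_add_left, real_inner_smul_left]
  unfold fusionObjective
  linarith

end Fusion
end

noncomputable section

section Calculus

variable {d : ℕ}

lemma TwiceDifferentiableAt.differentiableAt {f : Euc d → ℝ} {x : Euc d}
    (h : TwiceDifferentiableAt f x) : DifferentiableAt ℝ f x := h.1.self_of_nhds

lemma TwiceDifferentiableAt.hasGradientAt {f : Euc d → ℝ} {x : Euc d}
    (h : TwiceDifferentiableAt f x) : HasGradientAt f (gradient f x) x :=
  h.differentiableAt.hasGradientAt

lemma TwiceDifferentiableAt.hasFDerivAt_gradient {f : Euc d → ℝ} {x : Euc d}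
    (h : TwiceDifferentiableAt f x) : HasFDerivAt (gradient f) (hessian f x) x := by
  have : DifferentiableAt ℝ (gradient f) x := by
    change DifferentiableAt ℝ (fun y => (InnerProductSpace.toDual ℝ (Euc d)).symm (fderiv ℝ f y)) x
    exact (InnerProductSpace.toDual ℝ (Euc d)).symm.differentiable.differentiableAt.comp x h.2
  exact this.hasFDerivAt

lemma inner_hessian_eq {f : Euc d → ℝ} {x : Euc d} (h : TwiceDifferentiableAt f x) (v w : Euc d) :
    inner ℝ v (hessian f x w) = fderiv ℝ (fderiv ℝ f) x w v := by
  have h1 : gradient f = fun y => (InnerProductSpace.toDual ℝ (Euc d)).symm (fderiv ℝ f y) := rfl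
  have h2 : HasFDerivAt (gradient f)
      (((InnerProductSpace.toDual ℝ (Euc d)).symm.toContinuousLinearEquiv.toContinuousLinearMap) ∘L
        fderiv ℝ (fderiv ℝ f) x) x := by
    rw [h1]
    exact ((InnerProductSpace.toDual ℝ (Euc d)).symm.toContinuousLinearEquiv.hasFDerivAt).comp x
      h.2.hasFDerivAt
  rw [hessian, h2.fderiv, real_inner_comm]
  exact InnerProductSpace.toDual_symm_apply

lemma inner_hessian_symm {f : Euc d → ℝ} {x : Euc d} (h : TwiceDifferentiableAt f x)
    (v w : Euc d) : inner ℝ v (hessian f x w) = inner ℝ w (hessian f x v) := by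
  rw [inner_hessian_eq h, inner_hessian_eq h]
  exact second_derivative_symmetric_of_eventually
    (h.1.mono fun y hy => hy.hasFDerivAt) h.2.hasFDerivAt _ _

section Sum

variable {ι : Type*} {s : Finset ι} {f : ι → Euc d → ℝ} {x : Euc d}

lemma HasGradientAt.fun_sum {g : ι → Euc d} (h : ∀ i ∈ s, HasGradientAt (f i) (g i) x) :
    HasGradientAt (fun y => ∑ i ∈ s, f i y) (∑ i ∈ s, g i) x := by
  rw [hasGradientAt_iff_hasFDerivAt, map_sum]
  exact HasFDerivAt.fun_sum fun i hi => (h i hi).hasFDerivAt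

lemma gradient_fun_sum (h : ∀ i ∈ s, DifferentiableAt ℝ (f i) x) :
    gradient (fun y => ∑ i ∈ s, f i y) x = ∑ i ∈ s, gradient (f i) x :=
  (HasGradientAt.fun_sum fun i hi => (h i hi).hasGradientAt).gradient

lemma TwiceDifferentiableAt.fun_sum (h : ∀ i ∈ s, TwiceDifferentiableAt (f i) x) :
    TwiceDifferentiableAt (fun y => ∑ i ∈ s, f i y) x := by
  have h1 : ∀ᶠ y in 𝓝 x, ∀ i ∈ s, DifferentiableAt ℝ (f i) y :=
    (Finset.eventually_all s).2 fun i hi => (h i hi).1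
  refine ⟨h1.mono fun y hy => DifferentiableAt.fun_sum hy, ?_⟩
  have h2 : fderiv ℝ (fun y => ∑ i ∈ s, f i y) =ᶠ[𝓝 x] fun y => ∑ i ∈ s, fderiv ℝ (f i) y :=
    h1.mono fun y hy => fderiv_fun_sum hy
  exact (DifferentiableAt.fun_sum fun i hi => (h i hi).2).congr_of_eventuallyEq h2

lemma hessian_fun_sum (h : ∀ i ∈ s, TwiceDifferentiableAt (f i) x) :
    hessian (fun y => ∑ i ∈ s, f i y) x = ∑ i ∈ s, hessian (f i) x := by
  have h1 : ∀ᶠ y in 𝓝 x, ∀ i ∈ s, DifferentiableAt ℝ (f i) y :=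
    (Finset.eventually_all s).2 fun i hi => (h i hi).1
  have h2 : gradient (fun y => ∑ i ∈ s, f i y) =ᶠ[𝓝 x] fun y => ∑ i ∈ s, gradient (f i) y :=
    h1.mono fun y hy => gradient_fun_sum hy
  rw [hessian, h2.fderiv_eq]
  exact (HasFDerivAt.fun_sum fun i hi => (h i hi).hasFDerivAt_gradient).fderiv

end Sum

/-- A derivative in a parameter depends measurably on the remaining argument. -/
lemma measurable_indicator_hasFDerivAt {α F : Type*} [MeasurableSpace α]
    [NormedAddCommGroup F] [NormedSpace ℝ F] [MeasurableSpace F] [BorelSpace F]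
    [SecondCountableTopology F] {G : Euc d → α → F} {G' : α → Euc d →L[ℝ] F} {x : Euc d} {e : ℝ}
    (he : 0 < e) {S : Set α}
    (hG : ∀ y ∈ Metric.ball x e, Measurable (S.indicator (G y)))
    (hd : ∀ z ∈ S, HasFDerivAt (fun y => G y z) (G' z) x) (v : Euc d) :
    Measurable (S.indicator fun z => G' z v) := by
  set t : ℕ → ℝ := fun n => e / (2 * (‖v‖ + 1)) / (n + 1) with ht
  have hv : 0 < ‖v‖ + 1 := by positivity
  have ht0 : ∀ n, 0 < t n := fun n => by positivity
  have htv : ∀ n, ‖t n • v‖ < e := by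
    intro n
    rw [norm_smul, Real.norm_of_nonneg (ht0 n).le]
    have h1 : t n ≤ e / (2 * (‖v‖ + 1)) := div_le_self (by positivity) (by simp)
    calc t n * ‖v‖ ≤ e / (2 * (‖v‖ + 1)) * (‖v‖ + 1) := by gcongr; linarith
      _ = e / 2 := by field_simp
      _ < e := by linarith
  have hlim : Tendsto t atTop (𝓝[>] 0) := by
    refine tendsto_nhdsWithin_iff.2 ⟨?_, Eventually.of_forall ht0⟩
    have := tendsto_one_div_add_atTop_nhds_zero_nat (𝕜 := ℝ)
    simpa [ht, div_eq_mul_inv] using this.const_mul (e / (2 * (‖v‖ + 1)))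
  refine measurable_of_tendsto_metrizable (f := fun n => fun z =>
    (t n)⁻¹ • (S.indicator (G (x + t n • v)) z - S.indicator (G x) z)) (fun n => ?_) ?_
  · refine ((hG _ ?_).sub (hG x (Metric.mem_ball_self he))).const_smul _
    simpa [Metric.mem_ball, dist_eq_norm] using htv n
  · refine tendsto_pi_nhds.2 fun z => ?_
    by_cases hz : z ∈ S
    · simp only [Set.indicator_of_mem hz]
      have h0 : HasFDerivAt (fun y => G y z) (G' z) (x + (0 : ℝ) • v) := by simpa using hd z hz
      have h2 : HasDerivAt (fun t : ℝ => x + t • v) v 0 := by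
        simpa using ((hasDerivAt_id (0 : ℝ)).smul_const v).const_add x
      have h3 := (h0.comp_hasDerivAt 0 h2).tendsto_slope_zero_right.comp hlim
      simpa [Function.comp_def] using h3
    · simp [Set.indicator_of_notMem hz]

lemma measurable_euc_of_inner {α : Type*} [MeasurableSpace α] {f : α → Euc d}
    (h : ∀ v : Euc d, Measurable fun z => inner ℝ v (f z)) : Measurable f := by
  have : f = fun z => ∑ a, inner ℝ (EuclideanSpace.basisFun (Fin d) ℝ a) (f z) •
      EuclideanSpace.basisFun (Fin d) ℝ a := by
    funext z
    exact ((EuclideanSpace.basisFun (Fin d) ℝ).sum_repr' (f z)).symm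
  rw [this]
  exact Finset.measurable_fun_sum _ fun a _ => (h _).smul_const _

lemma measurable_indicator_gradient {α : Type*} [MeasurableSpace α] {F : Euc d → α → ℝ}
    {x : Euc d} {e : ℝ} (he : 0 < e) {S : Set α} (hS : MeasurableSet S)
    (hF : ∀ y ∈ Metric.ball x e, Measurable (F y))
    (hd : ∀ z ∈ S, DifferentiableAt ℝ (fun y => F y z) x) :
    Measurable (S.indicator fun z => gradient (fun y => F y z) x) := by
  refine measurable_euc_of_inner fun v => ?_
  have := measurable_indicator_hasFDerivAt he (fun y hy => (hF y hy).indicator hS)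
    (fun z hz => (hd z hz).hasFDerivAt) v
  convert this using 2 with z
  by_cases hz : z ∈ S
  · simp only [Set.indicator_of_mem hz]
    rw [real_inner_comm]
    exact InnerProductSpace.toDual_symm_apply
  · simp [Set.indicator_of_notMem hz]

lemma measurable_gradient {α : Type*} [MeasurableSpace α] {F : Euc d → α → ℝ}
    {x : Euc d} {e : ℝ} (he : 0 < e)
    (hF : ∀ y ∈ Metric.ball x e, Measurable (F y))
    (hd : ∀ z, DifferentiableAt ℝ (fun y => F y z) x) :
    Measurable fun z => gradient (fun y => F y z) x := by
  simpa using measurable_indicator_gradient he MeasurableSet.univ hF fun z _ => hd z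

lemma measurable_hessian_apply {α : Type*} [MeasurableSpace α] {F : Euc d → α → ℝ}
    {x : Euc d} {e : ℝ} (he : 0 < e)
    (hF : ∀ y ∈ Metric.ball x e, Measurable (F y))
    (hd : ∀ z, ∀ y ∈ Metric.ball x e, TwiceDifferentiableAt (fun y => F y z) y) (v : Euc d) :
    Measurable fun z => hessian (fun y => F y z) x v := by
  have := measurable_indicator_hasFDerivAt (G := fun y z => gradient (fun y => F y z) y)
    (G' := fun z => hessian (fun y => F y z) x) (S := Set.univ) he (fun y hy => by
      rw [Set.indicator_univ]
      refine measurable_gradient (e := e - dist y x) (sub_pos.2 hy) (fun y' hy' => hF y' ?_)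
        fun z => (hd z y hy).differentiableAt
      have := dist_triangle y' y x
      rw [Metric.mem_ball] at hy' ⊢
      linarith)
    (fun z _ => (hd z x (Metric.mem_ball_self he)).hasFDerivAt_gradient) v
  simpa using this

/-- A linear operator is the sum of its columns. -/
lemma clm_eq_sum_columns (A : Euc d →L[ℝ] Euc d) :
    A = ∑ a, ContinuousLinearMap.smulRight
      (innerSL ℝ (EuclideanSpace.basisFun (Fin d) ℝ a)) (A (EuclideanSpace.basisFun (Fin d) ℝ a)) := by
  ext1 v
  conv_lhs => rw [← (EuclideanSpace.basisFun (Fin d) ℝ).sum_repr' v, map_sum]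
  simp only [sum_apply, ContinuousLinearMap.smulRight_apply, map_smul,
    innerSL_apply_apply]

lemma norm_clm_le_sum_columns (A : Euc d →L[ℝ] Euc d) :
    ‖A‖ ≤ ∑ a, ‖A (EuclideanSpace.basisFun (Fin d) ℝ a)‖ := by
  conv_lhs => rw [clm_eq_sum_columns A]
  refine (norm_sum_le _ _).trans (Finset.sum_le_sum fun a _ => ?_)
  rw [ContinuousLinearMap.norm_smulRight_apply, innerSL_apply_norm,
    (EuclideanSpace.basisFun (Fin d) ℝ).orthonormal.1 a, one_mul]

lemma aestronglyMeasurable_clm {α : Type*} [MeasurableSpace α] {μ : Measure α}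
    {A : α → Euc d →L[ℝ] Euc d} (h : ∀ v, AEStronglyMeasurable (fun z => A z v) μ) :
    AEStronglyMeasurable A μ := by
  have : A = fun z => ∑ a, ContinuousLinearMap.smulRight
      (innerSL ℝ (EuclideanSpace.basisFun (Fin d) ℝ a))
      (A z (EuclideanSpace.basisFun (Fin d) ℝ a)) := funext fun z => clm_eq_sum_columns (A z)
  rw [this]
  refine Finset.aestronglyMeasurable_fun_sum _ fun a _ => ?_
  exact ((ContinuousLinearMap.smulRightL ℝ (Euc d) (Euc d)
    (innerSL ℝ (EuclideanSpace.basisFun (Fin d) ℝ a))).continuous).comp_aestronglyMeasurable (h _)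

lemma integrable_clm {α : Type*} [MeasurableSpace α] {μ : Measure α}
    {A : α → Euc d →L[ℝ] Euc d} (h : ∀ v, Integrable (fun z => A z v) μ) : Integrable A μ := by
  refine Integrable.mono' (g := fun z => ∑ a, ‖A z (EuclideanSpace.basisFun (Fin d) ℝ a)‖)
    (integrable_finsetSum _ fun a _ => (h _).norm)
    (aestronglyMeasurable_clm fun v => (h v).aestronglyMeasurable)
    (Eventually.of_forall fun z => norm_clm_le_sum_columns _)

/-- The norm of a symmetric operator is bounded by its quadratic form. -/
lemma norm_clm_le_of_quadratic {A : Euc d →L[ℝ] Euc d} {κ : ℝ}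
    (hsymm : ∀ v w, inner ℝ v (A w) = inner ℝ w (A v))
    (h0 : ∀ v, 0 ≤ inner ℝ v (A v)) (h1 : ∀ v, inner ℝ v (A v) ≤ κ * ‖v‖ ^ 2) (hκ : 0 ≤ κ) :
    ‖A‖ ≤ κ := by
  have key : ∀ v w : Euc d, inner ℝ v (A w) ^ 2 ≤ inner ℝ v (A v) * inner ℝ w (A w) := by
    intro v w
    have : ∀ t : ℝ, 0 ≤ inner ℝ w (A w) * (t * t) + 2 * inner ℝ v (A w) * t + inner ℝ v (A v) := by
      intro t
      have := h0 (v + t • w)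
      simp only [map_add, map_smul, inner_add_left, inner_add_right, real_inner_smul_left,
        real_inner_smul_right, hsymm w v] at this
      linarith
    have := discrim_le_zero this
    rw [discrim] at this
    nlinarith
  refine A.opNorm_le_bound hκ fun w => ?_
  have h2 := key (A w) w
  rw [real_inner_self_eq_norm_sq] at h2
  have h3 := h1 (A w)
  have h4 := h1 w
  have h5 := h0 w
  by_contra! hcon
  have hp : 0 < ‖A w‖ := lt_of_le_of_lt (by positivity) hcon
  have h6 : inner ℝ (A w) (A (A w)) * inner ℝ w (A w) ≤ (κ * ‖A w‖ ^ 2) * (κ * ‖w‖ ^ 2) :=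
    mul_le_mul h3 h4 h5 (by positivity)
  have h7 : (κ * ‖w‖) ^ 2 < ‖A w‖ ^ 2 := by gcongr
  nlinarith [mul_lt_mul_of_pos_right h7 (pow_pos hp 2)]

end Calculus
end

noncomputable section

section Moments

variable {α F : Type*} [MeasurableSpace α] {μ : Measure α} [NormedAddCommGroup F]

lemma lintegral_enorm_rpow_le [IsProbabilityMeasure μ] {f : α → F} {p r σ : ℝ} (hp : 0 ≤ p)
    (hpr : p ≤ r) (h : ∫⁻ z, ‖f z‖ₑ ^ r ∂μ ≤ ENNReal.ofReal σ) :
    ∫⁻ z, ‖f z‖ₑ ^ p ∂μ ≤ ENNReal.ofReal (1 + |σ|) := by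
  calc ∫⁻ z, ‖f z‖ₑ ^ p ∂μ ≤ ∫⁻ z, (1 + ‖f z‖ₑ ^ r) ∂μ := by
        refine lintegral_mono fun z => ?_
        rcases le_total ‖f z‖ₑ 1 with h | h
        · exact (ENNReal.rpow_le_one h hp).trans le_self_add
        · exact (ENNReal.rpow_le_rpow_of_exponent_le h hpr).trans le_add_self
    _ = 1 + ∫⁻ z, ‖f z‖ₑ ^ r ∂μ := by rw [lintegral_add_left measurable_const]; simp
    _ ≤ 1 + ENNReal.ofReal |σ| := by
        gcongr
        exact h.trans (ENNReal.ofReal_le_ofReal (le_abs_self σ))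
    _ = ENNReal.ofReal (1 + |σ|) := by
        rw [ENNReal.ofReal_add zero_le_one (abs_nonneg σ), ENNReal.ofReal_one]

lemma memLp_two_of_lintegral_sq_le {f : α → F} (hf : AEStronglyMeasurable f μ) {C : ℝ}
    (h : ∫⁻ z, ‖f z‖ₑ ^ 2 ∂μ ≤ ENNReal.ofReal C) : MemLp f 2 μ := by
  refine ⟨hf, (eLpNorm_lt_top_iff_lintegral_rpow_enorm_lt_top two_ne_zero ENNReal.ofNat_ne_top).2 ?_⟩
  simpa using h.trans_lt ENNReal.ofReal_lt_top

lemma lintegral_enorm_sq_le_of_moment [IsProbabilityMeasure μ] {f : α → F} {r σ : ℝ}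
    (hr : 2 < r) (h : ∫⁻ z, ‖f z‖ₑ ^ r ∂μ ≤ ENNReal.ofReal σ) :
    ∫⁻ z, ‖f z‖ₑ ^ 2 ∂μ ≤ ENNReal.ofReal (1 + |σ|) := by
  simpa using lintegral_enorm_rpow_le zero_le_two hr.le h

lemma integral_norm_sq_le_of_lintegral {f : α → F} {C : ℝ} (hC : 0 ≤ C)
    (h : ∫⁻ z, ‖f z‖ₑ ^ 2 ∂μ ≤ ENNReal.ofReal C) : ∫ z, ‖f z‖ ^ 2 ∂μ ≤ C := by
  by_cases hf : AEStronglyMeasurable (fun z => ‖f z‖ ^ 2) μ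
  · rw [integral_eq_lintegral_of_nonneg_ae (Eventually.of_forall fun z => by positivity) hf]
    refine ENNReal.toReal_le_of_le_ofReal hC (le_trans (le_of_eq ?_) h)
    refine lintegral_congr fun z => ?_
    rw [ENNReal.ofReal_pow (norm_nonneg _), ofReal_norm]
  · rw [integral_non_aestronglyMeasurable hf]; exact hC

lemma lintegral_enorm_sq_eq {f : α → F} (h : MemLp f 2 μ) :
    ∫⁻ z, ‖f z‖ₑ ^ 2 ∂μ = ENNReal.ofReal (∫ z, ‖f z‖ ^ 2 ∂μ) := by
  rw [ofReal_integral_eq_lintegral_ofReal h.norm.integrable_sq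
    (Eventually.of_forall fun z => by positivity)]
  refine lintegral_congr fun z => ?_
  rw [ENNReal.ofReal_pow (norm_nonneg _), ofReal_norm]

end Moments

namespace Experiment

variable {d : ℕ} {X : Experiment.{u, v, w} d} {M δ ρ κ σ₁ σ₂ σ₃ σ₅ r₁ r₂ : ℝ}

/-- The Hessian of the loss at the true parameters. -/
def lossHessian (X : Experiment.{u, v, w} d) (j : Fin X.m) (z : X.Obs j) : Euc d →L[ℝ] Euc d :=
  hessian (fun ϑ => X.loss j ϑ (X.ηstar j) z) (X.θstar j)

/-- `L` dominates the difference quotients of the Hessian of the loss of task `j` at `z`. -/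
def HessianLipschitzAt (X : Experiment.{u, v, w} d) (M : ℝ) (j : Fin X.m) (L : ℝ)
    (z : X.Obs j) : Prop :=
  ∀ θ ∈ Metric.closedBall (X.θstar j) M, ∀ θ' ∈ Metric.closedBall (X.θstar j) M,
    ∀ η ∈ Metric.closedBall (X.ηstar j) M, ∀ η' ∈ Metric.closedBall (X.ηstar j) M,
      ‖hessian (fun ϑ => X.loss j ϑ η z) θ - hessian (fun ϑ => X.loss j ϑ η' z) θ'‖ ≤
        L * (‖θ - θ'‖ + ‖η - η'‖)

lemma LossRegularity.exists_lipschitz (hL : X.LossRegularity M ρ κ σ₁ σ₂ σ₃ σ₅ r₁ r₂) (hM : 0 < M)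
    (j : Fin X.m) : ∃ L : X.Obs j → ℝ, Measurable L ∧ (∀ z, 0 ≤ L z) ∧ Integrable L (X.P j) ∧
      ∫⁻ z, ENNReal.ofReal (L z) ∂X.P j ≤ ENNReal.ofReal σ₃ ∧
      ∀ᵐ z ∂X.P j, X.HessianLipschitzAt M j (L z) z := by
  obtain ⟨L, hLi, hLσ, hLip⟩ := hL.hessian_lipschitz j
  rcases Nat.eq_zero_or_pos d with hd | hd
  · subst hd
    refine ⟨0, measurable_const, fun _ => le_rfl, integrable_zero _ _ _, by simp,
      Eventually.of_forall fun z θ _ θ' _ η _ η' _ => ?_⟩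
    simp [Subsingleton.elim
      (hessian (fun ϑ => X.loss j ϑ η z) θ - hessian (fun ϑ => X.loss j ϑ η' z) θ') 0]
  · have hnn : ∀ᵐ z ∂X.P j, 0 ≤ L z := by
      filter_upwards [hLip] with z hz
      have h1 := hz (X.θstar j) (Metric.mem_closedBall_self hM.le)
        (X.θstar j + M • EuclideanSpace.single ⟨0, hd⟩ 1)
        (by simp [Metric.mem_closedBall, norm_smul, abs_of_pos hM])
        (X.ηstar j) (Metric.mem_closedBall_self hM.le)
        (X.ηstar j) (Metric.mem_closedBall_self hM.le)
      have h2 := (norm_nonneg _).trans h1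
      have h3 : ‖X.θstar j - (X.θstar j + M • EuclideanSpace.single ⟨0, hd⟩ (1 : ℝ))‖ = M := by
        simp [norm_smul, abs_of_pos hM]
      rw [h3, sub_self, norm_zero, add_zero] at h2
      exact nonneg_of_mul_nonneg_left h2 hM
    have hm := hLi.aestronglyMeasurable.aemeasurable
    have hae : (fun z => max (hm.mk L z) 0) =ᵐ[X.P j] L := by
      filter_upwards [hnn, hm.ae_eq_mk] with z hz hz'
      rw [← hz', max_eq_left hz]
    refine ⟨fun z => max (hm.mk L z) 0, hm.measurable_mk.max measurable_const,
      fun z => le_max_right _ _, hLi.congr hae.symm, ?_, ?_⟩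
    · have h1 : ∫⁻ z, ENNReal.ofReal (max (hm.mk L z) 0) ∂X.P j =
          ∫⁻ z, ENNReal.ofReal (L z) ∂X.P j :=
        lintegral_congr_ae (hae.mono fun z hz => congrArg ENNReal.ofReal hz)
      rw [h1, ← ofReal_integral_eq_lintegral_ofReal hLi hnn]
      exact ENNReal.ofReal_le_ofReal hLσ
    · filter_upwards [hLip, hae] with z hz hz'
      rw [HessianLipschitzAt, hz']
      exact hz

lemma Setting.measurable_loss_apply (hS : X.Setting M δ) (j : Fin X.m) {θ : Euc d} (hθ : θ ∈ X.Θ)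
    (η : X.H j) : Measurable (X.loss j θ η) :=
  (hS.measurable_loss j θ hθ).comp measurable_prodMk_left

lemma Setting.closedBall_subset (hS : X.Setting M δ) (j : Fin X.m) :
    Metric.closedBall (X.θstar j) M ⊆ X.Θ := (hS.ball_subset j).trans interior_subset

lemma measurable_lossGradient (hS : X.Setting M δ) (hL : X.LossRegularity M ρ κ σ₁ σ₂ σ₃ σ₅ r₁ r₂)
    (j : Fin X.m) {θ : Euc d} (hθ : θ ∈ Metric.ball (X.θstar j) M) {η : X.H j}
    (hη : η ∈ Metric.closedBall (X.ηstar j) M) :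
    Measurable fun z => gradient (fun ϑ => X.loss j ϑ η z) θ := by
  refine measurable_gradient (F := fun ϑ z => X.loss j ϑ η z) (e := M - dist θ (X.θstar j))
    (sub_pos.2 hθ) (fun y hy => hS.measurable_loss_apply j (hS.closedBall_subset j ?_) η)
    fun z => (hL.smooth j η hη z θ (Metric.ball_subset_closedBall hθ)).differentiableAt
  have := dist_triangle y θ (X.θstar j)
  rw [Metric.mem_ball] at hy
  rw [Metric.mem_closedBall]
  linarith

lemma measurable_score (hS : X.Setting M δ) (hL : X.LossRegularity M ρ κ σ₁ σ₂ σ₃ σ₅ r₁ r₂)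
    (hM : 0 < M) (j : Fin X.m) : Measurable (X.score j (X.ηstar j)) :=
  measurable_lossGradient hS hL j (Metric.mem_ball_self hM) (Metric.mem_closedBall_self hM.le)

lemma measurable_lossHessian (hS : X.Setting M δ)
    (hL : X.LossRegularity M ρ κ σ₁ σ₂ σ₃ σ₅ r₁ r₂) (hM : 0 < M) (j : Fin X.m) (v : Euc d) :
    Measurable fun z => X.lossHessian j z v :=
  measurable_hessian_apply (F := fun ϑ z => X.loss j ϑ (X.ηstar j) z) hM
    (fun _ hy => hS.measurable_loss_apply j
      (hS.closedBall_subset j (Metric.ball_subset_closedBall hy)) _)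
    (fun z y hy => hL.smooth j _ (Metric.mem_closedBall_self hM.le) z y
      (Metric.ball_subset_closedBall hy)) v

lemma lossHessian_symm (hL : X.LossRegularity M ρ κ σ₁ σ₂ σ₃ σ₅ r₁ r₂) (hM : 0 < M) (j : Fin X.m)
    (z : X.Obs j) (v w : Euc d) :
    inner ℝ v (X.lossHessian j z w) = inner ℝ w (X.lossHessian j z v) :=
  inner_hessian_symm (hL.smooth j _ (Metric.mem_closedBall_self hM.le) z _
    (Metric.mem_closedBall_self hM.le)) v w

/-- Deviation of the quadratic form of the Hessian from its mean. -/
def hessianDeviation (X : Experiment.{u, v, w} d) (j : Fin X.m) (z : X.Obs j) :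
    Euc d →L[ℝ] Euc d := X.lossHessian j z - X.popHessian j (X.θstar j)

lemma measurable_hessianDeviation (hS : X.Setting M δ)
    (hL : X.LossRegularity M ρ κ σ₁ σ₂ σ₃ σ₅ r₁ r₂) (hM : 0 < M) (j : Fin X.m) (v : Euc d) :
    Measurable fun z => X.hessianDeviation j z v :=
  (measurable_lossHessian hS hL hM j v).sub_const _

lemma quadratic_sq_moment (hL : X.LossRegularity M ρ κ σ₁ σ₂ σ₃ σ₅ r₁ r₂) (hM : 0 < M)
    (hr₂ : 2 < r₂) (j : Fin X.m) (v : Euc d) :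
    ∫⁻ z, ‖inner ℝ v (X.hessianDeviation j z v)‖ₑ ^ 2 ∂X.P j ≤
      ENNReal.ofReal (‖v‖ ^ 4 * (1 + |σ₂|)) := by
  rcases eq_or_ne v 0 with rfl | hv
  · simp
  have hv' : 0 < ‖v‖ := norm_pos_iff.2 hv
  have h1 := lintegral_enorm_sq_le_of_moment hr₂ (hL.hessian_moment j _
    (Metric.mem_closedBall_self hM.le) (‖v‖⁻¹ • v) (by rw [norm_smul, norm_inv, norm_norm,
      inv_mul_cancel₀ hv'.ne']))
  have h2 : ∀ z, ‖inner ℝ v (X.hessianDeviation j z v)‖ₑ ^ 2 = ENNReal.ofReal (‖v‖ ^ 4) *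
      ‖inner ℝ (‖v‖⁻¹ • v) (X.hessianDeviation j z (‖v‖⁻¹ • v))‖ₑ ^ 2 := by
    intro z
    rw [map_smul, real_inner_smul_left, real_inner_smul_right, ← ofReal_norm, ← ofReal_norm,
      ← ENNReal.ofReal_pow (norm_nonneg _), ← ENNReal.ofReal_pow (norm_nonneg _),
      ← ENNReal.ofReal_mul (by positivity)]
    congr 1
    rw [norm_mul, norm_mul, norm_inv, norm_norm]
    field_simp
  simp_rw [h2]
  rw [lintegral_const_mul' _ _ ENNReal.ofReal_ne_top, ENNReal.ofReal_mul (by positivity)]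
  gcongr
  exact h1

lemma memLp_quadratic (hS : X.Setting M δ) (hL : X.LossRegularity M ρ κ σ₁ σ₂ σ₃ σ₅ r₁ r₂)
    (hM : 0 < M) (hr₂ : 2 < r₂) (j : Fin X.m) (v : Euc d) :
    MemLp (fun z => inner ℝ v (X.hessianDeviation j z v)) 2 (X.P j) :=
  memLp_two_of_lintegral_sq_le
    (measurable_const.inner (measurable_hessianDeviation hS hL hM j v)).aestronglyMeasurable
    (quadratic_sq_moment hL hM hr₂ j v)

lemma integrable_lossHessian (hS : X.Setting M δ) (hL : X.LossRegularity M ρ κ σ₁ σ₂ σ₃ σ₅ r₁ r₂)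
    (hM : 0 < M) (hr₂ : 2 < r₂) (j : Fin X.m) : Integrable (X.lossHessian j) (X.P j) := by
  have hq : ∀ v : Euc d, Integrable (fun z => inner ℝ v (X.lossHessian j z v)) (X.P j) := by
    intro v
    have := ((memLp_quadratic hS hL hM hr₂ j v).integrable one_le_two).add
      (integrable_const (inner ℝ v (X.popHessian j (X.θstar j) v)))
    refine this.congr (Eventually.of_forall fun z => ?_)
    simp [hessianDeviation, inner_sub_right]
  have hb : ∀ v w : Euc d, Integrable (fun z => inner ℝ v (X.lossHessian j z w)) (X.P j) := by
    intro v w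
    have := (((hq (v + w)).sub (hq v)).sub (hq w)).const_mul (1 / 2)
    refine this.congr (Eventually.of_forall fun z => ?_)
    simp only [Pi.sub_apply, map_add, inner_add_left, inner_add_right,
      lossHessian_symm hL hM j z w v]
    ring
  refine integrable_clm fun w => ?_
  have : (fun z => X.lossHessian j z w) = fun z => ∑ a,
      inner ℝ (EuclideanSpace.basisFun (Fin d) ℝ a) (X.lossHessian j z w) •
        EuclideanSpace.basisFun (Fin d) ℝ a :=
    funext fun z => ((EuclideanSpace.basisFun (Fin d) ℝ).sum_repr' _).symm
  rw [this]
  exact integrable_finsetSum _ fun a _ => (hb _ _).smul_const _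

lemma hasFDerivAt_lossGradient (hL : X.LossRegularity M ρ κ σ₁ σ₂ σ₃ σ₅ r₁ r₂)
    (j : Fin X.m) {θ : Euc d} (hθ : θ ∈ Metric.closedBall (X.θstar j) M) {η : X.H j}
    (hη : η ∈ Metric.closedBall (X.ηstar j) M) (z : X.Obs j) :
    HasFDerivAt (gradient fun ϑ => X.loss j ϑ η z) (hessian (fun ϑ => X.loss j ϑ η z) θ) θ :=
  (hL.smooth j η hη z θ hθ).hasFDerivAt_gradient

lemma norm_hessian_le {j : Fin X.m} {z : X.Obs j} {L : ℝ} (hM : 0 < M)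
    (hLip : X.HessianLipschitzAt M j L z) {θ : Euc d}
    (hθ : θ ∈ Metric.closedBall (X.θstar j) M) {η : X.H j}
    (hη : η ∈ Metric.closedBall (X.ηstar j) M) :
    ‖hessian (fun ϑ => X.loss j ϑ η z) θ‖ ≤
      ‖X.lossHessian j z‖ + L * (‖θ - X.θstar j‖ + ‖η - X.ηstar j‖) := by
  have := hLip θ hθ _ (Metric.mem_closedBall_self hM.le) η hη _ (Metric.mem_closedBall_self hM.le)
  have h2 := norm_le_norm_add_norm_sub (X.lossHessian j z) (hessian (fun ϑ => X.loss j ϑ η z) θ)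
  rw [norm_sub_rev] at h2
  exact h2.trans (add_le_add le_rfl this)

/-- The gradient of the risk is the mean of the gradient of the loss. -/
lemma hasGradientAt_risk (hS : X.Setting M δ) (hL : X.LossRegularity M ρ κ σ₁ σ₂ σ₃ σ₅ r₁ r₂)
    (hM : 0 < M) (hr₂ : 2 < r₂) (j : Fin X.m) {η : X.H j}
    (hη : η ∈ Metric.closedBall (X.ηstar j) M)
    (hint : ∀ θ ∈ Metric.closedBall (X.θstar j) M, Integrable (X.loss j θ η) (X.P j))
    (hscore : Integrable (X.score j η) (X.P j)) {θ : Euc d}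
    (hθ : θ ∈ Metric.ball (X.θstar j) M) :
    Integrable (fun z => gradient (fun ϑ => X.loss j ϑ η z) θ) (X.P j) ∧
    HasGradientAt (fun ϑ => X.risk j ϑ η) (∫ z, gradient (fun ϑ => X.loss j ϑ η z) θ ∂X.P j) θ := by
  obtain ⟨L, -, hL0, hLi, -, hLip⟩ := hL.exists_lipschitz hM j
  set B : X.Obs j → ℝ := fun z =>
    ‖X.score j η z‖ + (‖X.lossHessian j z‖ + L z * (M + ‖η - X.ηstar j‖)) * M with hB
  have hBi : Integrable B (X.P j) := hscore.norm.add
    (((integrable_lossHessian hS hL hM hr₂ j).norm.add (hLi.mul_const _)).mul_const _)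
  have hbound : ∀ᵐ z ∂X.P j, ∀ y ∈ Metric.ball (X.θstar j) M,
      ‖gradient (fun ϑ => X.loss j ϑ η z) y‖ ≤ B z := by
    filter_upwards [hLip] with z hz y hy
    have h1 := (convex_closedBall (X.θstar j) M).norm_image_sub_le_of_norm_hasFDerivWithin_le
      (f := gradient fun ϑ => X.loss j ϑ η z)
      (C := ‖X.lossHessian j z‖ + L z * (M + ‖η - X.ηstar j‖))
      (fun x hx => (hasFDerivAt_lossGradient hL j hx hη z).hasFDerivWithinAt)
      (fun x hx => (norm_hessian_le hM hz hx hη).trans (by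
        have := hL0 z
        rw [Metric.mem_closedBall, dist_eq_norm] at hx
        gcongr))
      (Metric.mem_closedBall_self hM.le) (Metric.ball_subset_closedBall hy)
    have h2 := norm_le_norm_add_norm_sub (X.score j η z) (gradient (fun ϑ => X.loss j ϑ η z) y)
    rw [norm_sub_rev] at h2
    refine h2.trans (add_le_add le_rfl (h1.trans ?_))
    rw [Metric.mem_ball, dist_eq_norm] at hy
    have := hL0 z
    gcongr
  have hmeas : ∀ y ∈ Metric.ball (X.θstar j) M,
      Measurable fun z => gradient (fun ϑ => X.loss j ϑ η z) y :=
    fun y hy => measurable_lossGradient hS hL j hy hη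
  have hi : Integrable (fun z => gradient (fun ϑ => X.loss j ϑ η z) θ) (X.P j) :=
    hBi.mono' (hmeas θ hθ).aestronglyMeasurable (hbound.mono fun z hz => hz θ hθ)
  refine ⟨hi, ?_⟩
  have hnhds := Metric.isOpen_ball.mem_nhds hθ
  have := hasFDerivAt_integral_of_dominated_of_fderiv_le (μ := X.P j)
    (F := fun ϑ z => X.loss j ϑ η z) (bound := B)
    (F' := fun y z => InnerProductSpace.toDual ℝ (Euc d) (gradient (fun ϑ => X.loss j ϑ η z) y))
    hnhds
    (by
      filter_upwards [hnhds] with y hy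
      exact (hint y (Metric.ball_subset_closedBall hy)).aestronglyMeasurable)
    (hint θ (Metric.ball_subset_closedBall hθ))
    ((InnerProductSpace.toDual ℝ (Euc d)).continuous.comp_aestronglyMeasurable
      hi.aestronglyMeasurable)
    (by
      filter_upwards [hbound] with z hz y hy
      rw [LinearIsometryEquiv.norm_map]
      exact hz y hy) hBi
    (Eventually.of_forall fun z y hy =>
      (hL.smooth j η hη z y (Metric.ball_subset_closedBall hy)).hasGradientAt.hasFDerivAt)
  rw [hasGradientAt_iff_hasFDerivAt]
  refine this.congr_fderiv ?_
  exact ((InnerProductSpace.toDual ℝ (Euc d)).toContinuousLinearEquiv.toContinuousLinearMap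
    ).integral_comp_comm hi

lemma memLp_score (hS : X.Setting M δ) (hL : X.LossRegularity M ρ κ σ₁ σ₂ σ₃ σ₅ r₁ r₂)
    (hM : 0 < M) (hr₁ : 2 < r₁) (j : Fin X.m) : MemLp (X.score j (X.ηstar j)) 2 (X.P j) :=
  memLp_two_of_lintegral_sq_le (measurable_score hS hL hM j).aestronglyMeasurable
    (lintegral_enorm_sq_le_of_moment hr₁ (hL.score_moment j))

lemma hasGradientAt_risk_ηstar (hS : X.Setting M δ)
    (hL : X.LossRegularity M ρ κ σ₁ σ₂ σ₃ σ₅ r₁ r₂)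
    (hM : 0 < M) (hr₁ : 2 < r₁) (hr₂ : 2 < r₂) (j : Fin X.m) {θ : Euc d}
    (hθ : θ ∈ Metric.ball (X.θstar j) M) :
    Integrable (fun z => gradient (fun ϑ => X.loss j ϑ (X.ηstar j) z) θ) (X.P j) ∧
    HasGradientAt (fun ϑ => X.risk j ϑ (X.ηstar j))
      (∫ z, gradient (fun ϑ => X.loss j ϑ (X.ηstar j) z) θ ∂X.P j) θ :=
  hasGradientAt_risk hS hL hM hr₂ j (Metric.mem_closedBall_self hM.le)
    (fun θ hθ => hS.integrable_loss j θ (hS.closedBall_subset j hθ))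
    ((memLp_score hS hL hM hr₁ j).integrable one_le_two) hθ

/-- The score has mean zero. -/
lemma integral_score (hS : X.Setting M δ) (hL : X.LossRegularity M ρ κ σ₁ σ₂ σ₃ σ₅ r₁ r₂)
    (hM : 0 < M) (hr₁ : 2 < r₁) (hr₂ : 2 < r₂) (j : Fin X.m) :
    ∫ z, X.score j (X.ηstar j) z ∂X.P j = 0 :=
  (hasGradientAt_risk_ηstar hS hL hM hr₁ hr₂ j (Metric.mem_ball_self hM)).2.unique
    (hL.score_mean j)

/-- The Hessian of the risk is the mean of the Hessian of the loss. -/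
lemma popHessian_eq_integral (hS : X.Setting M δ)
    (hL : X.LossRegularity M ρ κ σ₁ σ₂ σ₃ σ₅ r₁ r₂)
    (hM : 0 < M) (hr₁ : 2 < r₁) (hr₂ : 2 < r₂) (j : Fin X.m) :
    X.popHessian j (X.θstar j) = ∫ z, X.lossHessian j z ∂X.P j := by
  obtain ⟨L, -, hL0, hLi, -, hLip⟩ := hL.exists_lipschitz hM j
  have hη : X.ηstar j ∈ Metric.closedBall (X.ηstar j) M := Metric.mem_closedBall_self hM.le
  have hnhds : Metric.ball (X.θstar j) M ∈ 𝓝 (X.θstar j) := Metric.ball_mem_nhds _ hM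
  have hH := integrable_lossHessian hS hL hM hr₂ j
  have h1 := hasFDerivAt_integral_of_dominated_of_fderiv_le (μ := X.P j)
    (F := fun y z => gradient (fun ϑ => X.loss j ϑ (X.ηstar j) z) y)
    (F' := fun y z => hessian (fun ϑ => X.loss j ϑ (X.ηstar j) z) y)
    (bound := fun z => ‖X.lossHessian j z‖ + L z * M) hnhds
    (by
      filter_upwards [hnhds] with y hy
      exact (measurable_lossGradient hS hL j hy hη).aestronglyMeasurable)
    (hasGradientAt_risk_ηstar hS hL hM hr₁ hr₂ j (Metric.mem_ball_self hM)).1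
    hH.aestronglyMeasurable
    (by
      filter_upwards [hLip] with z hz y hy
      have := norm_hessian_le hM hz (Metric.ball_subset_closedBall hy) hη
      rw [sub_self, norm_zero, add_zero] at this
      rw [Metric.mem_ball, dist_eq_norm] at hy
      have := hL0 z
      refine ‹_ ≤ _›.trans ?_
      gcongr)
    (hH.norm.add (hLi.mul_const _))
    (Eventually.of_forall fun z y hy =>
      hasFDerivAt_lossGradient hL j (Metric.ball_subset_closedBall hy) hη z)
  have h2 : gradient (fun ϑ => X.risk j ϑ (X.ηstar j)) =ᶠ[𝓝 (X.θstar j)]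
      fun y => ∫ z, gradient (fun ϑ => X.loss j ϑ (X.ηstar j) z) y ∂X.P j := by
    filter_upwards [hnhds] with y hy
    exact (hasGradientAt_risk_ηstar hS hL hM hr₁ hr₂ j hy).2.gradient
  rw [popHessian, hessian, h2.fderiv_eq, h1.fderiv]
  rfl

lemma popHessian_apply (hS : X.Setting M δ)
    (hL : X.LossRegularity M ρ κ σ₁ σ₂ σ₃ σ₅ r₁ r₂)
    (hM : 0 < M) (hr₁ : 2 < r₁) (hr₂ : 2 < r₂) (j : Fin X.m) (v : Euc d) :
    X.popHessian j (X.θstar j) v = ∫ z, X.lossHessian j z v ∂X.P j := by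
  rw [popHessian_eq_integral hS hL hM hr₁ hr₂ j]
  exact (ContinuousLinearMap.integral_apply (integrable_lossHessian hS hL hM hr₂ j) v)

lemma popHessian_symm (hS : X.Setting M δ)
    (hL : X.LossRegularity M ρ κ σ₁ σ₂ σ₃ σ₅ r₁ r₂)
    (hM : 0 < M) (hr₁ : 2 < r₁) (hr₂ : 2 < r₂) (j : Fin X.m) (v w : Euc d) :
    inner ℝ v (X.popHessian j (X.θstar j) w) = inner ℝ w (X.popHessian j (X.θstar j) v) := by
  have hH := integrable_lossHessian hS hL hM hr₂ j
  rw [popHessian_apply hS hL hM hr₁ hr₂, popHessian_apply hS hL hM hr₁ hr₂,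
    ← integral_inner (hH.apply_continuousLinearMap w), ←
    integral_inner (hH.apply_continuousLinearMap v)]
  exact integral_congr_ae (Eventually.of_forall fun z => lossHessian_symm hL hM j z v w)

lemma norm_popHessian_le (hS : X.Setting M δ)
    (hL : X.LossRegularity M ρ κ σ₁ σ₂ σ₃ σ₅ r₁ r₂) (hρ : 0 < ρ)
    (hM : 0 < M) (hr₁ : 2 < r₁) (hr₂ : 2 < r₂) (j : Fin X.m) :
    ‖X.popHessian j (X.θstar j)‖ ≤ |κ| := by
  have hc := hL.curvature j _ (Metric.mem_closedBall_self hM.le)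
  exact norm_clm_le_of_quadratic (popHessian_symm hS hL hM hr₁ hr₂ j)
    (fun v => le_trans (by positivity) (hc v).1)
    (fun v => (hc v).2.trans (mul_le_mul_of_nonneg_right (le_abs_self κ) (by positivity)))
    (abs_nonneg κ)

/-- Mean square of the columns of the Hessian deviation. -/
lemma hessianDeviation_sq_moment (hS : X.Setting M δ)
    (hL : X.LossRegularity M ρ κ σ₁ σ₂ σ₃ σ₅ r₁ r₂)
    (hM : 0 < M) (hr₁ : 2 < r₁) (hr₂ : 2 < r₂) (j : Fin X.m) (c : Fin d) :
    ∫⁻ z, ‖X.hessianDeviation j z (EuclideanSpace.basisFun (Fin d) ℝ c)‖ₑ ^ 2 ∂X.P j ≤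
      ENNReal.ofReal (d * (18 * (1 + |σ₂|))) := by
  set e := EuclideanSpace.basisFun (Fin d) ℝ with he
  have hn : ∀ a, ‖e a‖ = 1 := e.orthonormal.1
  set q : Euc d → X.Obs j → ℝ := fun v z => inner ℝ v (X.hessianDeviation j z v) with hq
  have hsymm : ∀ z v w, inner ℝ v (X.hessianDeviation j z w) =
      inner ℝ w (X.hessianDeviation j z v) := by
    intro z v w
    simp only [hessianDeviation, sub_apply, inner_sub_right]
    rw [lossHessian_symm hL hM j z v w, popHessian_symm hS hL hM hr₁ hr₂ j v w]
  have hqi : ∀ v, Integrable (fun z => q v z ^ 2) (X.P j) := fun v =>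
    (memLp_quadratic hS hL hM hr₂ j v).integrable_sq
  have hqb : ∀ v, ∫ z, q v z ^ 2 ∂X.P j ≤ ‖v‖ ^ 4 * (1 + |σ₂|) := fun v => by
    have := integral_norm_sq_le_of_lintegral (by positivity) (quadratic_sq_moment hL hM hr₂ j v)
    simpa only [Real.norm_eq_abs, sq_abs] using this
  set B : X.Obs j → ℝ := fun z => ∑ a, (q (e a + e c) z ^ 2 + q (e a) z ^ 2 + q (e c) z ^ 2) with hB
  have hpt : ∀ z, ‖X.hessianDeviation j z (e c)‖ ^ 2 ≤ B z := by
    intro z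
    rw [← e.sum_sq_norm_inner_right (X.hessianDeviation j z (e c))]
    refine Finset.sum_le_sum fun a _ => ?_
    have : inner ℝ (e a) (X.hessianDeviation j z (e c)) =
        1 / 2 * (q (e a + e c) z - q (e a) z - q (e c) z) := by
      simp only [hq, map_add, inner_add_left, inner_add_right, hsymm z (e c) (e a)]
      ring
    rw [this, Real.norm_eq_abs, sq_abs]
    nlinarith [sq_nonneg (q (e a + e c) z + q (e a) z), sq_nonneg (q (e a + e c) z + q (e c) z),
      sq_nonneg (q (e a) z - q (e c) z)]
  have hBi : Integrable B (X.P j) :=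
    integrable_finsetSum _ fun a _ => ((hqi _).add (hqi _)).add (hqi _)
  have hBb : ∫ z, B z ∂X.P j ≤ d * (18 * (1 + |σ₂|)) := by
    have h0 : ∫ z, B z ∂X.P j =
        ∑ a, ∫ z, (q (e a + e c) z ^ 2 + q (e a) z ^ 2 + q (e c) z ^ 2) ∂X.P j :=
      integral_finsetSum _ fun a _ => ((hqi _).add (hqi _)).add (hqi _)
    rw [h0]
    calc _ ≤ ∑ a : Fin d, 18 * (1 + |σ₂|) := by
          refine Finset.sum_le_sum fun a _ => ?_
          have h6 : ∫ z, (q (e a + e c) z ^ 2 + q (e a) z ^ 2 + q (e c) z ^ 2) ∂X.P j =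
              ∫ z, q (e a + e c) z ^ 2 ∂X.P j + ∫ z, q (e a) z ^ 2 ∂X.P j +
                ∫ z, q (e c) z ^ 2 ∂X.P j :=
            (integral_add ((hqi _).add (hqi _)) (hqi _)).trans
              (congrArg (· + _) (integral_add (hqi _) (hqi _)))
          rw [h6]
          have h1 := hqb (e a)
          have h2 := hqb (e c)
          have h3 := hqb (e a + e c)
          rw [hn, one_pow, one_mul] at h1 h2
          have h4 : ‖e a + e c‖ ≤ 2 := (norm_add_le _ _).trans (by rw [hn, hn]; norm_num)
          have h5 : ‖e a + e c‖ ^ 4 ≤ 2 ^ 4 := by gcongr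
          nlinarith [abs_nonneg σ₂]
      _ = d * (18 * (1 + |σ₂|)) := by simp
  refine le_trans (lintegral_mono fun z => ?_) ((ofReal_integral_eq_lintegral_ofReal hBi
    (Eventually.of_forall fun z => (sq_nonneg _).trans (hpt z))).symm.le.trans
      (ENNReal.ofReal_le_ofReal hBb))
  rw [← ofReal_norm, ← ENNReal.ofReal_pow (norm_nonneg _)]
  exact ENNReal.ofReal_le_ofReal (hpt z)

end Experiment
end

noncomputable section

section Curves

variable {F : Type*} [NormedAddCommGroup F] [NormedSpace ℝ F]

lemma enorm_sub_le_lintegral_deriv [CompleteSpace F] {ψ : ℝ → F} {a b : ℝ} (hab : a ≤ b)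
    (h : ∀ t ∈ Set.Icc a b, DifferentiableAt ℝ ψ t) :
    ‖ψ b - ψ a‖ₑ ≤ ∫⁻ t in Set.Ioc a b, ‖deriv ψ t‖ₑ := by
  by_cases hfin : ∫⁻ t in Set.Ioc a b, ‖deriv ψ t‖ₑ = ⊤
  · rw [hfin]; exact le_top
  have hi : IntegrableOn (deriv ψ) (Set.Ioc a b) :=
    ⟨(stronglyMeasurable_deriv ψ).aestronglyMeasurable, lt_top_iff_ne_top.2 hfin⟩
  have h1 := intervalIntegral.integral_eq_sub_of_hasDerivAt (f := ψ) (f' := deriv ψ) (a := a) (b := b)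
    (fun t ht => (h t (by rwa [Set.uIcc_of_le hab] at ht)).hasDerivAt)
    ((intervalIntegrable_iff_integrableOn_Ioc_of_le hab).2 hi)
  rw [← h1, intervalIntegral.integral_of_le hab]
  exact enorm_integral_le_lintegral_enorm _

lemma sq_lintegral_le_lintegral_sq {α : Type*} [MeasurableSpace α] {μ : Measure α}
    [IsProbabilityMeasure μ] {f : α → ℝ≥0∞} (hf : AEMeasurable f μ) :
    (∫⁻ z, f z ∂μ) ^ 2 ≤ ∫⁻ z, f z ^ 2 ∂μ := by
  have h := ENNReal.lintegral_mul_le_Lp_mul_Lq μ Real.HolderConjugate.two_two hf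
    (aemeasurable_const (b := (1 : ℝ≥0∞)))
  simp only [Pi.mul_apply, mul_one, lintegral_const, measure_univ, ENNReal.rpow_two, one_pow,
    ENNReal.one_rpow] at h
  calc (∫⁻ z, f z ∂μ) ^ 2 ≤ ((∫⁻ z, f z ^ 2 ∂μ) ^ (1 / 2 : ℝ)) ^ 2 := by gcongr
    _ = _ := by
      rw [← ENNReal.rpow_two, ← ENNReal.rpow_mul]; norm_num

variable {α : Type*} [MeasurableSpace α] [MeasurableSpace F] [BorelSpace F]

lemma measurable_uncurry_projIcc {ψ : ℝ → α → F}
    (hm : ∀ t ∈ Set.Icc (0 : ℝ) 1, Measurable (ψ t))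
    (hd : ∀ t ∈ Set.Icc (0 : ℝ) 1, ∀ z, DifferentiableAt ℝ (fun t => ψ t z) t) :
    Measurable fun p : ℝ × α => ψ (Set.projIcc (0 : ℝ) 1 zero_le_one p.1) p.2 := by
  refine measurable_uncurry_of_continuous_of_measurable
    (u := fun t z => ψ (Set.projIcc (0 : ℝ) 1 zero_le_one t) z) (fun z => ?_)
    fun t => hm _ (Set.projIcc (0 : ℝ) 1 zero_le_one t).2
  have h1 : ContinuousOn (fun t => ψ t z) (Set.Icc 0 1) := fun t ht =>
    (hd t ht z).continuousAt.continuousWithinAt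
  have h2 : Continuous fun t : ℝ => ((Set.projIcc (0 : ℝ) 1 zero_le_one t : Set.Icc (0 : ℝ) 1) : ℝ) :=
    continuous_subtype_val.comp continuous_projIcc
  exact h1.comp_continuous h2 fun t => (Set.projIcc (0 : ℝ) 1 zero_le_one t).2

variable [SecondCountableTopology F] {φ : ℝ → α → F}

lemma measurable_deriv_of_forall_mem_Icc {ψ : ℝ → α → F}
    (hm : ∀ t ∈ Set.Icc (0 : ℝ) 1, Measurable (ψ t))
    (hd : ∀ t ∈ Set.Icc (0 : ℝ) 1, ∀ z, DifferentiableAt ℝ (fun t => ψ t z) t) :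
    ∀ t ∈ Set.Icc (0 : ℝ) 1, Measurable fun z => deriv (fun t => ψ t z) t := by
  intro t ht
  obtain ⟨c, hc, hct⟩ : ∃ c ∈ Set.Icc (0 : ℝ) 1, c ≠ t := by
    rcases eq_or_ne t 0 with h | h
    · exact ⟨1, by simp, by simp [h]⟩
    · exact ⟨0, by simp, h.symm⟩
  set s : ℕ → ℝ := fun n => t + 1 / ((n : ℝ) + 1) * (c - t) with hs
  have hsm : ∀ n, s n ∈ Set.Icc (0 : ℝ) 1 := by
    intro n
    have h1 : 0 ≤ 1 / ((n : ℝ) + 1) := by positivity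
    have h2 : 1 / ((n : ℝ) + 1) ≤ 1 := by
      rw [div_le_one (by positivity)]; simp
    have : s n = (1 - 1 / ((n : ℝ) + 1)) • t + (1 / ((n : ℝ) + 1)) • c := by
      simp only [hs, smul_eq_mul]; ring
    rw [this]
    exact convex_Icc (0 : ℝ) 1 ht hc (sub_nonneg.2 h2) h1 (by ring)
  have hlim : Tendsto s atTop (𝓝[≠] t) := by
    refine tendsto_nhdsWithin_iff.2 ⟨?_, Eventually.of_forall fun n => ?_⟩
    · have := (tendsto_one_div_add_atTop_nhds_zero_nat (𝕜 := ℝ)).mul_const (c - t)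
      simpa [hs] using this.const_add t
    · have : 1 / ((n : ℝ) + 1) * (c - t) ≠ 0 :=
        mul_ne_zero (by positivity) (sub_ne_zero.2 hct)
      simp only [hs, Set.mem_compl_iff, Set.mem_singleton_iff]
      intro h
      exact this (by linarith)
  refine measurable_of_tendsto_metrizable
    (f := fun n z => (s n - t)⁻¹ • (ψ (s n) z - ψ t z))
    (fun n => ((hm _ (hsm n)).sub (hm t ht)).const_smul _) (tendsto_pi_nhds.2 fun z => ?_)
  have h1 := (hasDerivAt_iff_tendsto_slope.1 (hd t ht z).hasDerivAt).comp hlim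
  refine h1.congr fun n => ?_
  simp [slope_def_module]

/-- The derivative in the first argument is jointly measurable. -/
lemma measurable_uncurry_deriv {ψ : ℝ → α → F}
    (hm : ∀ t ∈ Set.Icc (0 : ℝ) 1, Measurable (ψ t))
    (hd : ∀ t ∈ Set.Icc (0 : ℝ) 1, ∀ z, DifferentiableAt ℝ (fun t => ψ t z) t) :
    Measurable ((Set.Ico (0 : ℝ) 1 ×ˢ (Set.univ : Set α)).indicator
      fun p => deriv (fun t => ψ t p.2) p.1) := by
  have hJ := measurable_uncurry_projIcc hm hd
  have hS : MeasurableSet (Set.Ico (0 : ℝ) 1 ×ˢ (Set.univ : Set α)) :=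
    measurableSet_Ico.prod MeasurableSet.univ
  set t : ℕ → ℝ := fun n => 1 / ((n : ℝ) + 1) with ht
  have hlim : Tendsto t atTop (𝓝[>] 0) :=
    tendsto_nhdsWithin_iff.2 ⟨tendsto_one_div_add_atTop_nhds_zero_nat (𝕜 := ℝ),
      Eventually.of_forall fun n => by simp only [ht, Set.mem_Ioi]; positivity⟩
  refine measurable_of_tendsto_metrizable
    (f := fun n => (Set.Ico (0 : ℝ) 1 ×ˢ (Set.univ : Set α)).indicator fun p => (t n)⁻¹ •
      (ψ (Set.projIcc (0 : ℝ) 1 zero_le_one (p.1 + t n)) p.2 -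
        ψ (Set.projIcc (0 : ℝ) 1 zero_le_one p.1) p.2))
    (fun n => ((((hJ.comp ((measurable_fst.add_const _).prodMk measurable_snd))).sub hJ).const_smul
      _).indicator hS) (tendsto_pi_nhds.2 fun p => ?_)
  by_cases hp : p ∈ Set.Ico (0 : ℝ) 1 ×ˢ (Set.univ : Set α)
  · simp only [Set.indicator_of_mem hp]
    have hp1 : p.1 ∈ Set.Ico (0 : ℝ) 1 := hp.1
    have h1 := ((hd p.1 (Set.Ico_subset_Icc_self hp1) p.2).hasDerivAt.tendsto_slope_zero_right).comp
      hlim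
    refine h1.congr' ?_
    have h2 : ∀ᶠ n in atTop, t n < 1 - p.1 := by
      have := tendsto_nhdsWithin_iff.1 hlim
      exact this.1.eventually (gt_mem_nhds (sub_pos.2 hp1.2))
    filter_upwards [h2] with n hn
    have h3 : 0 < t n := by simp only [ht]; positivity
    simp only [Function.comp]
    rw [Set.projIcc_of_mem zero_le_one (Set.Ico_subset_Icc_self hp1),
      Set.projIcc_of_mem zero_le_one (x := p.1 + t n)
        ⟨by linarith [hp1.1], by linarith⟩]
  · simp only [Set.indicator_of_notMem hp]
    exact tendsto_const_nhds

lemma lintegral_lintegral_deriv_le {P : Measure α} [SFinite P] {ψ : ℝ → α → F}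
    (hm : ∀ t ∈ Set.Icc (0 : ℝ) 1, Measurable (ψ t))
    (hd : ∀ t ∈ Set.Icc (0 : ℝ) 1, ∀ z, DifferentiableAt ℝ (fun t => ψ t z) t) {q : ℕ}
    {A : ℝ≥0∞} (hA : ∀ t ∈ Set.Icc (0 : ℝ) 1, ∫⁻ z, ‖deriv (fun t => ψ t z) t‖ₑ ^ q ∂P ≤ A)
    {b : ℝ} (hb : b ≤ 1) :
    ∫⁻ z, ∫⁻ t in Set.Ioo 0 b, ‖deriv (fun t => ψ t z) t‖ₑ ^ q ∂volume ∂P ≤ A * ENNReal.ofReal b := by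
  have hJ := measurable_uncurry_deriv hm hd
  have hsub : Set.Ioo 0 b ⊆ Set.Ico 0 1 := fun t ht => ⟨ht.1.le, ht.2.trans_le hb⟩
  have h1 : ∫⁻ z, ∫⁻ t in Set.Ioo 0 b, ‖deriv (fun t => ψ t z) t‖ₑ ^ q ∂volume ∂P =
      ∫⁻ z, ∫⁻ t in Set.Ioo 0 b, ‖(Set.Ico (0 : ℝ) 1 ×ˢ (Set.univ : Set α)).indicator
        (fun p => deriv (fun t => ψ t p.2) p.1) (t, z)‖ₑ ^ q ∂volume ∂P := by
    refine lintegral_congr fun z => setLIntegral_congr_fun measurableSet_Ioo fun t ht => ?_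
    rw [Set.indicator_of_mem (show (t, z) ∈ Set.Ico (0 : ℝ) 1 ×ˢ (Set.univ : Set α) from
      ⟨hsub ht, trivial⟩)]
  rw [h1, lintegral_lintegral_swap ((hJ.comp measurable_swap).enorm.pow_const q).aemeasurable]
  calc _ ≤ ∫⁻ t in Set.Ioo 0 b, A := by
        refine setLIntegral_mono measurable_const fun t ht => ?_
        refine le_trans (le_of_eq (lintegral_congr fun z => ?_)) (hA t
          (Set.Ico_subset_Icc_self (hsub ht)))
        rw [Set.indicator_of_mem (show (t, z) ∈ Set.Ico (0 : ℝ) 1 ×ˢ (Set.univ : Set α) from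
          ⟨hsub ht, trivial⟩)]
    _ = A * ENNReal.ofReal b := by simp

/-- Mean square increment of a random curve. -/
lemma lintegral_sq_increment_le [CompleteSpace F] {P : Measure α} [SFinite P]
    (hm : ∀ t ∈ Set.Icc (0 : ℝ) 1, Measurable (φ t))
    (hd : ∀ t ∈ Set.Icc (0 : ℝ) 1, ∀ z, DifferentiableAt ℝ (fun t => φ t z) t)
    {A : ℝ≥0∞} (hA : ∀ t ∈ Set.Icc (0 : ℝ) 1, ∫⁻ z, ‖deriv (fun t => φ t z) t‖ₑ ^ 2 ∂P ≤ A)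
    {t : ℝ} (ht : t ∈ Set.Icc (0 : ℝ) 1) :
    ∫⁻ z, ‖φ t z - φ 0 z‖ₑ ^ 2 ∂P ≤ A := by
  have hprob : IsProbabilityMeasure ((volume : Measure ℝ).restrict (Set.Ioo 0 1)) :=
    ⟨by simp⟩
  refine le_trans (lintegral_mono fun z => ?_)
    ((lintegral_lintegral_deriv_le hm hd hA (le_refl 1)).trans (by simp))
  calc ‖φ t z - φ 0 z‖ₑ ^ 2 ≤ (∫⁻ s in Set.Ioc 0 t, ‖deriv (fun t => φ t z) s‖ₑ) ^ 2 := by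
        gcongr
        exact enorm_sub_le_lintegral_deriv (ψ := fun t => φ t z) ht.1
          fun s hs => hd s ⟨hs.1, hs.2.trans ht.2⟩ z
    _ ≤ (∫⁻ s in Set.Ioo 0 1, ‖deriv (fun t => φ t z) s‖ₑ) ^ 2 := by
        gcongr ?_ ^ 2
        rw [restrict_Ioo_eq_restrict_Ioc]
        exact lintegral_mono_set (Set.Ioc_subset_Ioc_right ht.2)
    _ ≤ _ := sq_lintegral_le_lintegral_sq (stronglyMeasurable_deriv _).enorm.aemeasurable

/-- Mean error of the first-order expansion of a random curve. -/
lemma lintegral_expansion_le [CompleteSpace F] {P : Measure α} [SFinite P]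
    (hm : ∀ t ∈ Set.Icc (0 : ℝ) 1, Measurable (φ t))
    (hd : ∀ t ∈ Set.Icc (0 : ℝ) 1, ∀ z, DifferentiableAt ℝ (fun t => φ t z) t)
    (hd' : ∀ t ∈ Set.Icc (0 : ℝ) 1, ∀ z, DifferentiableAt ℝ (deriv fun t => φ t z) t)
    {A : ℝ≥0∞}
    (hA : ∀ t ∈ Set.Icc (0 : ℝ) 1, ∫⁻ z, ‖deriv (deriv fun t => φ t z) t‖ₑ ∂P ≤ A)
    {t : ℝ} (ht : t ∈ Set.Icc (0 : ℝ) 1) :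
    ∫⁻ z, ‖φ t z - φ 0 z - t • deriv (fun t => φ t z) 0‖ₑ ∂P ≤ A * ENNReal.ofReal t ^ 2 := by
  have key : ∀ z, ‖φ t z - φ 0 z - t • deriv (fun t => φ t z) 0‖ₑ ≤
      ENNReal.ofReal t * ∫⁻ s in Set.Ioo 0 t, ‖deriv (deriv fun t => φ t z) s‖ₑ ^ 1 := by
    intro z
    set D := deriv (fun t => φ t z) with hD
    have h1 := enorm_sub_le_lintegral_deriv (ψ := fun s => φ s z - s • D 0) ht.1
      fun s hs => (hd s ⟨hs.1, hs.2.trans ht.2⟩ z).sub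
        ((differentiableAt_id).smul_const _)
    have h2 : φ t z - φ 0 z - t • D 0 = (φ t z - t • D 0) - (φ 0 z - (0 : ℝ) • D 0) := by
      simp only [zero_smul, sub_zero]; abel
    rw [h2]
    refine h1.trans ?_
    calc _ ≤ ∫⁻ s in Set.Ioc 0 t, ∫⁻ s in Set.Ioo 0 t, ‖deriv D s‖ₑ ^ 1 := by
          refine setLIntegral_mono measurable_const fun s hs => ?_
          have hs' : s ∈ Set.Icc (0 : ℝ) 1 := ⟨hs.1.le, hs.2.trans ht.2⟩
          have h3 : deriv (fun s => φ s z - s • D 0) s = D s - D 0 := by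
            have := ((hd s hs' z).hasDerivAt.sub ((hasDerivAt_id s).smul_const (D 0))).deriv
            rw [one_smul] at this
            exact this
          rw [h3, restrict_Ioo_eq_restrict_Ioc]
          simp only [pow_one]
          exact (enorm_sub_le_lintegral_deriv (ψ := D) hs.1.le
            fun r hr => hd' r ⟨hr.1, hr.2.trans hs'.2⟩ z).trans
            (lintegral_mono_set (Set.Ioc_subset_Ioc_right hs.2))
      _ = _ := by simp [mul_comm]
  refine (lintegral_mono key).trans ?_
  rw [lintegral_const_mul' _ _ ENNReal.ofReal_ne_top, pow_two, ← mul_assoc, mul_comm]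
  gcongr
  exact lintegral_lintegral_deriv_le (ψ := fun t z => deriv (fun t => φ t z) t)
    (measurable_deriv_of_forall_mem_Icc hm hd) hd' (by simpa using hA) ht.2

end Curves

namespace Experiment

variable {d : ℕ} {X : Experiment.{u, v, w} d} {M δ ρ κ σ₁ σ₂ σ₃ σ₅ r₁ r₂ : ℝ}

lemma add_smul_sub_mem_segment {j : Fin X.m} (η : X.H j) {t : ℝ} (ht : t ∈ Set.Icc (0 : ℝ) 1) :
    X.ηstar j + t • (η - X.ηstar j) ∈ segment ℝ (X.ηstar j) η := by
  rw [segment_eq_image']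
  exact ⟨t, ht, rfl⟩

lemma measurable_score_of_differentiable (hS : X.Setting M δ) (hM : 0 < M) (j : Fin X.m)
    {η : X.H j} (h : ∀ z, DifferentiableAt ℝ (fun θ => X.loss j θ η z) (X.θstar j)) :
    Measurable (X.score j η) :=
  measurable_gradient (F := fun ϑ z => X.loss j ϑ η z) hM
    (fun _ hy => hS.measurable_loss_apply j
      (hS.closedBall_subset j (Metric.ball_subset_closedBall hy)) _) h

variable {j : Fin X.m} {η : X.H j}

lemma measurable_score_segment (hS : X.Setting M δ)
    (hL : X.LossRegularity M ρ κ σ₁ σ₂ σ₃ σ₅ r₁ r₂) (hM : 0 < M) (hη : η ∈ X.T j) {t : ℝ}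
    (ht : t ∈ Set.Icc (0 : ℝ) 1) :
    Measurable (X.score j (X.ηstar j + t • (η - X.ηstar j))) :=
  measurable_score_of_differentiable hS hM j fun z =>
    (hL.smooth_nuisance j η hη _ (add_smul_sub_mem_segment η ht) z).1

lemma score_shift (η : X.H j) (t : ℝ) (z : X.Obs j) :
    (fun s : ℝ => X.score j (X.ηstar j + t • (η - X.ηstar j) + s • (η - X.ηstar j)) z) =
    fun s => X.score j (X.ηstar j + (t + s) • (η - X.ηstar j)) z := by
  funext s
  rw [add_smul, add_assoc]

lemma differentiableAt_score_curve (hL : X.LossRegularity M ρ κ σ₁ σ₂ σ₃ σ₅ r₁ r₂)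
    (hη : η ∈ X.T j) {t : ℝ} (ht : t ∈ Set.Icc (0 : ℝ) 1) (z : X.Obs j) :
    DifferentiableAt ℝ (fun t : ℝ => X.score j (X.ηstar j + t • (η - X.ηstar j)) z) t ∧
    DifferentiableAt ℝ
      (deriv fun t : ℝ => X.score j (X.ηstar j + t • (η - X.ηstar j)) z) t := by
  have h := (hL.smooth_nuisance j η hη _ (add_smul_sub_mem_segment η ht) z).2
  rw [score_shift] at h
  set φ := fun t : ℝ => X.score j (X.ηstar j + t • (η - X.ηstar j)) z
  have h1 : DifferentiableAt ℝ (fun s => φ (t + s)) 0 := h.1.self_of_nhds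
  have h2 : DifferentiableAt ℝ (deriv fun s => φ (t + s)) 0 := by
    have : (deriv fun s => φ (t + s)) = fun s => fderiv ℝ (fun s => φ (t + s)) s 1 := by
      funext s; exact (fderiv_apply_one_eq_deriv).symm
    rw [this]
    exact h.2.clm_apply (differentiableAt_const _)
  have h3 : (deriv fun s => φ (t + s)) = fun s => deriv φ (t + s) := by
    funext s; exact deriv_comp_const_add φ t s
  rw [h3] at h2
  constructor
  · simpa using (differentiableAt_comp_add_left (f := φ) (x := 0) t).1 h1
  · simpa using (differentiableAt_comp_add_left (f := deriv φ) (x := 0) t).1 h2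

lemma gateaux_score (η : X.H j) (t : ℝ) (z : X.Obs j) :
    gateaux (fun ζ => X.score j ζ z) (X.ηstar j + t • (η - X.ηstar j)) (η - X.ηstar j) =
      deriv (fun t : ℝ => X.score j (X.ηstar j + t • (η - X.ηstar j)) z) t := by
  rw [gateaux, score_shift, deriv_comp_const_add
    (fun t : ℝ => X.score j (X.ηstar j + t • (η - X.ηstar j)) z) t 0, add_zero]

lemma gateauxTwo_score (η : X.H j) (t : ℝ) (z : X.Obs j) :
    gateauxTwo (fun ζ => X.score j ζ z) (X.ηstar j + t • (η - X.ηstar j)) (η - X.ηstar j) =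
      deriv (deriv fun t : ℝ => X.score j (X.ηstar j + t • (η - X.ηstar j)) z) t := by
  rw [gateauxTwo, score_shift, iteratedDeriv_succ, iteratedDeriv_one]
  set φ := fun t : ℝ => X.score j (X.ηstar j + t • (η - X.ηstar j)) z
  have h3 : (deriv fun s => φ (t + s)) = fun s => deriv φ (t + s) := by
    funext s; exact deriv_comp_const_add φ t s
  rw [h3, deriv_comp_const_add (deriv φ) t 0, add_zero]

/-- Mean square effect of the nuisance on the score. -/
lemma lintegral_score_increment_sq_le (hS : X.Setting M δ)
    (hL : X.LossRegularity M ρ κ σ₁ σ₂ σ₃ σ₅ r₁ r₂) (hM : 0 < M) (hη : η ∈ X.T j) {t : ℝ}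
    (ht : t ∈ Set.Icc (0 : ℝ) 1) :
    ∫⁻ z, ‖X.score j (X.ηstar j + t • (η - X.ηstar j)) z - X.score j (X.ηstar j) z‖ₑ ^ 2 ∂X.P j ≤
      ENNReal.ofReal (σ₅ * ‖η - X.ηstar j‖ ^ 2) := by
  have := lintegral_sq_increment_le (P := X.P j)
    (φ := fun t z => X.score j (X.ηstar j + t • (η - X.ηstar j)) z)
    (fun t ht => measurable_score_segment hS hL hM hη ht)
    (fun t ht z => (differentiableAt_score_curve hL hη ht z).1)
    (A := ENNReal.ofReal (σ₅ * ‖η - X.ηstar j‖ ^ 2)) (fun t ht => by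
      have := (hL.gateaux_moment j η hη _ (add_smul_sub_mem_segment η ht)).1
      simpa only [gateaux_score] using this) ht
  simpa using this

/-- By orthogonality, the nuisance affects the mean score to second order only. -/
lemma norm_integral_score_increment_le (hS : X.Setting M δ)
    (hL : X.LossRegularity M ρ κ σ₁ σ₂ σ₃ σ₅ r₁ r₂) (hM : 0 < M) (hr₁ : 2 < r₁) (hr₂ : 2 < r₂)
    (hη : η ∈ X.T j) :
    ‖∫ z, (X.score j η z - X.score j (X.ηstar j) z) ∂X.P j‖ ≤ |σ₅| * ‖η - X.ηstar j‖ ^ 2 := by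
  set φ : ℝ → X.Obs j → Euc d := fun t z => X.score j (X.ηstar j + t • (η - X.ηstar j)) z with hφ
  set A : ℝ := |σ₅| * ‖η - X.ηstar j‖ ^ 2 with hA
  have hA0 : 0 ≤ A := by positivity
  have hσA : σ₅ * ‖η - X.ηstar j‖ ^ 2 ≤ A :=
    mul_le_mul_of_nonneg_right (le_abs_self _) (by positivity)
  have hm : ∀ t ∈ Set.Icc (0 : ℝ) 1, Measurable (φ t) :=
    fun t ht => measurable_score_segment hS hL hM hη ht
  have hφ0 : φ 0 = X.score j (X.ηstar j) := by simp [hφ]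
  have hφ1 : φ 1 = X.score j η := by simp [hφ]
  have hd := fun t (ht : t ∈ Set.Icc (0 : ℝ) 1) z => (differentiableAt_score_curve hL hη ht z).1
  have hd' := fun t (ht : t ∈ Set.Icc (0 : ℝ) 1) z => (differentiableAt_score_curve hL hη ht z).2
  have hi0 : Integrable (φ 0) (X.P j) := by
    rw [hφ0]; exact (memLp_score hS hL hM hr₁ j).integrable one_le_two
  have hi : ∀ t ∈ Set.Icc (0 : ℝ) 1, Integrable (φ t) (X.P j) := by
    intro t ht
    have h1 := memLp_two_of_lintegral_sq_le
      ((hm t ht).sub (hm 0 (by simp))).aestronglyMeasurable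
      (by simpa [hφ] using lintegral_score_increment_sq_le hS hL hM hη ht)
    have := (h1.integrable one_le_two).add hi0
    refine this.congr (Eventually.of_forall fun z => by simp)
  set D : X.Obs j → Euc d := fun z => deriv (fun t => φ t z) 0 with hD
  have hDi : Integrable D (X.P j) := by
    refine (memLp_two_of_lintegral_sq_le (C := σ₅ * ‖η - X.ηstar j‖ ^ 2)
      (measurable_deriv_of_forall_mem_Icc hm hd 0 (by simp)).aestronglyMeasurable ?_).integrable
      one_le_two
    have := (hL.gateaux_moment j η hη _ (add_smul_sub_mem_segment η (t := 0) (by simp))).1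
    simpa only [gateaux_score] using this
  have hexp : ∀ t ∈ Set.Icc (0 : ℝ) 1,
      ‖∫ z, φ t z ∂X.P j - ∫ z, φ 0 z ∂X.P j - t • ∫ z, D z ∂X.P j‖ ≤ A * t ^ 2 := by
    intro t ht
    have h1 := lintegral_expansion_le (P := X.P j) hm hd hd'
      (A := ENNReal.ofReal (σ₅ * ‖η - X.ηstar j‖ ^ 2)) (fun t ht => by
        have := (hL.gateaux_moment j η hη _ (add_smul_sub_mem_segment η ht)).2
        simpa only [gateauxTwo_score] using this) ht
    have h2 : ∫ z, φ t z ∂X.P j - ∫ z, φ 0 z ∂X.P j - t • ∫ z, D z ∂X.P j =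
        ∫ z, (φ t z - φ 0 z - t • D z) ∂X.P j := by
      rw [← integral_smul, ← integral_sub (hi t ht) hi0]
      exact (integral_sub ((hi t ht).sub hi0) (hDi.smul t)).symm
    rw [h2]
    have h3 := (enorm_integral_le_lintegral_enorm (μ := X.P j)
      (fun z => φ t z - φ 0 z - t • D z)).trans h1
    rw [← ofReal_norm, ← ENNReal.ofReal_pow ht.1, ← ENNReal.ofReal_mul' (by positivity)] at h3
    have h4 : ENNReal.ofReal ‖∫ z, (φ t z - φ 0 z - t • D z) ∂X.P j‖ ≤ ENNReal.ofReal (A * t ^ 2) :=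
      h3.trans (ENNReal.ofReal_le_ofReal (by gcongr))
    exact (ENNReal.ofReal_le_ofReal_iff (by positivity)).1 h4
  have hD0 : ∫ z, D z ∂X.P j = 0 := by
    obtain ⟨hfin, hder⟩ := hL.orthogonality j η hη
    have hsl := hder.tendsto_slope_zero_right
    have hev : ∀ᶠ t : ℝ in 𝓝[>] 0, t⁻¹ •
        (gradient (fun θ => X.risk j θ (X.ηstar j + (0 + t) • (η - X.ηstar j))) (X.θstar j) -
        gradient (fun θ => X.risk j θ (X.ηstar j + (0 : ℝ) • (η - X.ηstar j))) (X.θstar j)) =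
        t⁻¹ • (∫ z, φ t z ∂X.P j - ∫ z, φ 0 z ∂X.P j) := by
      have hball : ∀ᶠ t : ℝ in 𝓝 0, t * ‖η - X.ηstar j‖ < M := by
        have : Continuous fun t : ℝ => t * ‖η - X.ηstar j‖ := by fun_prop
        exact this.continuousAt.eventually (gt_mem_nhds (by simpa using hM))
      filter_upwards [hfin.filter_mono nhdsWithin_le_nhds, hball.filter_mono nhdsWithin_le_nhds,
        Ioo_mem_nhdsGT (one_pos : (0 : ℝ) < 1)] with t h1 h2 h3
      have ht : t ∈ Set.Icc (0 : ℝ) 1 := ⟨h3.1.le, h3.2.le⟩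
      have e1 : gradient (fun θ => X.risk j θ (X.ηstar j + t • (η - X.ηstar j))) (X.θstar j) =
          ∫ z, φ t z ∂X.P j :=
        (hasGradientAt_risk hS hL hM hr₂ j (η := X.ηstar j + t • (η - X.ηstar j))
          (by
            rw [Metric.mem_closedBall, dist_eq_norm, add_sub_cancel_left, norm_smul,
              Real.norm_of_nonneg ht.1]
            exact h2.le) h1 (hi t ht) (Metric.mem_ball_self hM)).2.gradient
      have e0 : gradient (fun θ => X.risk j θ (X.ηstar j + (0 : ℝ) • (η - X.ηstar j)))
          (X.θstar j) = ∫ z, φ 0 z ∂X.P j := by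
        rw [zero_smul, add_zero, hφ0]
        exact (hasGradientAt_risk_ηstar hS hL hM hr₁ hr₂ j (Metric.mem_ball_self hM)).2.gradient
      rw [zero_add, e1, e0]
    have hlim1 := hsl.congr' hev
    have hlim2 : Tendsto (fun t : ℝ => t⁻¹ • (∫ z, φ t z ∂X.P j - ∫ z, φ 0 z ∂X.P j)) (𝓝[>] 0)
        (𝓝 (∫ z, D z ∂X.P j)) := by
      rw [tendsto_iff_norm_sub_tendsto_zero]
      refine squeeze_zero_norm' (a := fun t : ℝ => A * t) ?_ ?_
      · filter_upwards [Ioo_mem_nhdsGT (one_pos : (0 : ℝ) < 1)] with t ht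
        have h1 := hexp t ⟨ht.1.le, ht.2.le⟩
        rw [norm_norm]
        have h2 : t⁻¹ • (∫ z, φ t z ∂X.P j - ∫ z, φ 0 z ∂X.P j) - ∫ z, D z ∂X.P j =
            t⁻¹ • (∫ z, φ t z ∂X.P j - ∫ z, φ 0 z ∂X.P j - t • ∫ z, D z ∂X.P j) := by
          rw [smul_sub _ (_ - _), smul_smul, inv_mul_cancel₀ ht.1.ne', one_smul]
        rw [h2, norm_smul, norm_inv, Real.norm_of_nonneg ht.1.le, inv_mul_le_iff₀ ht.1]
        linarith
      · have : Continuous fun t : ℝ => A * t := by fun_prop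
        simpa using (this.tendsto 0).mono_left nhdsWithin_le_nhds
    exact tendsto_nhds_unique hlim2 hlim1
  have := hexp 1 (by simp)
  rw [hD0, smul_zero, sub_zero, one_pow, mul_one, hφ1, hφ0] at this
  rwa [integral_sub (hφ1 ▸ hi 1 (by simp)) (hφ0 ▸ hi0)]

end Experiment
end

noncomputable section

section CharFun

lemma norm_prod_sub_prod_le {ι : Type*} (s : Finset ι) {a b : ι → ℂ} (ha : ∀ i ∈ s, ‖a i‖ ≤ 1)
    (hb : ∀ i ∈ s, ‖b i‖ ≤ 1) : ‖∏ i ∈ s, a i - ∏ i ∈ s, b i‖ ≤ ∑ i ∈ s, ‖a i - b i‖ := by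
  classical
  induction s using Finset.induction with
  | empty => simp
  | insert i s hi ih =>
    rw [Finset.prod_insert hi, Finset.prod_insert hi, Finset.sum_insert hi]
    have h1 : a i * ∏ i ∈ s, a i - b i * ∏ i ∈ s, b i =
        (a i - b i) * ∏ i ∈ s, a i + b i * (∏ i ∈ s, a i - ∏ i ∈ s, b i) := by ring
    rw [h1]
    refine (norm_add_le _ _).trans (add_le_add ?_ ?_)
    · rw [norm_mul, norm_prod]
      exact mul_le_of_le_one_right (norm_nonneg _) (Finset.prod_le_one (fun _ _ => norm_nonneg _)
        fun i hi => ha i (Finset.mem_insert_of_mem hi))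
    · rw [norm_mul]
      refine (mul_le_of_le_one_left (norm_nonneg _) (hb i (Finset.mem_insert_self _ _))).trans ?_
      exact ih (fun i hi => ha i (Finset.mem_insert_of_mem hi))
        fun i hi => hb i (Finset.mem_insert_of_mem hi)

lemma norm_cexp_mul_I_sub_le {x p : ℝ} (hp : 2 ≤ p) (hp' : p ≤ 3) :
    ‖Complex.exp (x * Complex.I) - (1 + x * Complex.I - x ^ 2 / 2)‖ ≤ 4 * |x| ^ p := by
  have hn : ‖(x : ℂ) * Complex.I‖ = |x| := by simp
  rcases le_or_gt |x| 1 with h | h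
  · have h1 := Complex.exp_bound (x := x * Complex.I) (by rwa [hn]) (n := 3) (by norm_num)
    have h2 : ∑ m ∈ Finset.range 3, ((x : ℂ) * Complex.I) ^ m / (m.factorial : ℂ) =
        1 + x * Complex.I - x ^ 2 / 2 := by
      simp [Finset.sum_range_succ, mul_pow]
      ring
    rw [h2, hn] at h1
    refine h1.trans ?_
    have h3 : |x| ^ 3 ≤ |x| ^ p := by
      rcases (abs_nonneg x).eq_or_lt with h0 | h0
      · rw [← h0, Real.zero_rpow (by linarith)]; norm_num
      · rw [← Real.rpow_natCast]
        exact Real.rpow_le_rpow_of_exponent_ge h0 h (by exact_mod_cast hp')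
    norm_num [Nat.factorial]
    nlinarith [Real.rpow_nonneg (abs_nonneg x) p, pow_nonneg (abs_nonneg x) 3]
  · have h1 : |x| ^ 2 ≤ |x| ^ p := by
      rw [← Real.rpow_natCast]
      exact Real.rpow_le_rpow_of_exponent_le h.le (by exact_mod_cast hp)
    calc _ ≤ ‖Complex.exp (x * Complex.I)‖ + ‖(1 + x * Complex.I - x ^ 2 / 2 : ℂ)‖ :=
          norm_sub_le _ _
      _ ≤ 1 + (1 + |x| + |x| ^ 2 / 2) := by
          rw [Complex.norm_exp_ofReal_mul_I]
          gcongr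
          refine (norm_sub_le _ _).trans (add_le_add ((norm_add_le _ _).trans ?_) ?_)
          · rw [hn]; simp
          · simp
      _ ≤ 4 * |x| ^ p := by nlinarith

lemma abs_exp_neg_sub_le {y : ℝ} (hy : 0 ≤ y) : |Real.exp (-y) - (1 - y)| ≤ y ^ 2 := by
  rcases le_or_gt y 1 with h | h
  · have := Real.abs_exp_sub_one_sub_id_le (x := -y) (by rwa [abs_neg, abs_of_nonneg hy])
    rw [neg_sq] at this
    convert this using 2
    ring
  · have h1 := Real.exp_pos (-y)
    have h2 : Real.exp (-y) ≤ 1 := Real.exp_le_one_iff.2 (by linarith)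
    rw [abs_le]
    constructor <;> nlinarith

variable {Ω : Type*} [MeasurableSpace Ω] {P : Measure Ω} [IsProbabilityMeasure P]

lemma integral_cexp_expansion_le {ξ : Ω → ℝ} {p c : ℝ} (hp : 2 ≤ p) (hp' : p ≤ 3)
    (hξ : MemLp ξ 2 P) (h0 : ∫ ω, ξ ω ∂P = 0) (hi : Integrable (fun ω => |ξ ω| ^ p) P)
    (hc : ∫ ω, |ξ ω| ^ p ∂P ≤ c) :
    ‖∫ ω, Complex.exp (ξ ω * Complex.I) ∂P - Real.exp (-(∫ ω, ξ ω ^ 2 ∂P) / 2)‖ ≤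
      4 * c + (∫ ω, ξ ω ^ 2 ∂P) ^ 2 := by
  set v := ∫ ω, ξ ω ^ 2 ∂P with hv
  have hv0 : 0 ≤ v := integral_nonneg fun ω => sq_nonneg _
  have hm : AEStronglyMeasurable (fun ω => (ξ ω : ℂ)) P :=
    Complex.continuous_ofReal.comp_aestronglyMeasurable hξ.aestronglyMeasurable
  have hξ1 := hξ.integrable one_le_two
  have hξ2 := hξ.integrable_sq
  have i1 : Integrable (fun ω => (ξ ω : ℂ) * Complex.I) P := hξ1.ofReal.mul_const _
  have i2 : Integrable (fun ω => (ξ ω : ℂ) ^ 2 / 2) P := by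
    have := (hξ2.ofReal (𝕜 := ℂ)).div_const 2
    refine this.congr (Eventually.of_forall fun ω => by simp)
  have ie : Integrable (fun ω => Complex.exp (ξ ω * Complex.I)) P := by
    refine (integrable_const (1 : ℝ)).mono'
      (Complex.continuous_exp.comp_aestronglyMeasurable (hm.mul_const _))
      (Eventually.of_forall fun ω => by rw [Complex.norm_exp_ofReal_mul_I])
  have h1 : ∫ ω, (1 + (ξ ω : ℂ) * Complex.I - (ξ ω : ℂ) ^ 2 / 2) ∂P = ((1 - v / 2 : ℝ) : ℂ) := by
    have e2 : ∫ ω, (ξ ω : ℂ) ^ 2 / 2 ∂P = ((v / 2 : ℝ) : ℂ) := by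
      rw [integral_div]
      push_cast
      rw [hv, ← integral_complex_ofReal]
      simp
    have e1 : ∫ ω, (ξ ω : ℂ) * Complex.I ∂P = 0 := by
      rw [integral_mul_const, integral_complex_ofReal, h0]; simp
    have := integral_sub ((integrable_const (1 : ℂ)).add i1) i2
    refine this.trans ?_
    have h3 := integral_add (integrable_const (1 : ℂ)) i1
    rw [e2]
    refine (congrArg (· - _) h3).trans ?_
    rw [e1]
    simp
  have h2 : ‖∫ ω, Complex.exp (ξ ω * Complex.I) ∂P - ((1 - v / 2 : ℝ) : ℂ)‖ ≤ 4 * c := by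
    have i3 : Integrable (fun ω => 1 + (ξ ω : ℂ) * Complex.I - (ξ ω : ℂ) ^ 2 / 2) P :=
      ((integrable_const _).add i1).sub i2
    rw [← h1, ← integral_sub ie i3]
    refine (norm_integral_le_of_norm_le (hi.const_mul 4)
      (Eventually.of_forall fun ω => norm_cexp_mul_I_sub_le hp hp')).trans ?_
    rw [integral_const_mul]
    linarith
  have h3 : ‖((1 - v / 2 : ℝ) : ℂ) - Real.exp (-v / 2)‖ ≤ v ^ 2 := by
    rw [← Complex.ofReal_sub, Complex.norm_real, Real.norm_eq_abs, abs_sub_comm]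
    have := abs_exp_neg_sub_le (y := v / 2) (by positivity)
    rw [neg_div]
    refine this.trans ?_
    nlinarith [sq_nonneg v]
  calc _ ≤ _ := norm_sub_le_norm_sub_add_norm_sub _ ((1 - v / 2 : ℝ) : ℂ) _
    _ ≤ _ := add_le_add h2 h3

/-- Lyapunov's bound for the characteristic function of a sum of independent variables. -/
lemma norm_integral_cexp_sum_sub_le {ι : Type*} {ξ : ι → Ω → ℝ} (hind : iIndepFun ξ P)
    (hm : ∀ i, Measurable (ξ i)) (s : Finset ι) {p : ℝ} {c : ι → ℝ} (hp : 2 ≤ p) (hp' : p ≤ 3)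
    (hξ : ∀ i ∈ s, MemLp (ξ i) 2 P) (h0 : ∀ i ∈ s, ∫ ω, ξ i ω ∂P = 0)
    (hi : ∀ i ∈ s, Integrable (fun ω => |ξ i ω| ^ p) P)
    (hc : ∀ i ∈ s, ∫ ω, |ξ i ω| ^ p ∂P ≤ c i) :
    ‖∫ ω, Complex.exp ((∑ i ∈ s, ξ i ω : ℝ) * Complex.I) ∂P -
      Real.exp (-(∑ i ∈ s, ∫ ω, ξ i ω ^ 2 ∂P) / 2)‖ ≤
      ∑ i ∈ s, (4 * c i + (∫ ω, ξ i ω ^ 2 ∂P) ^ 2) := by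
  have hchar : ∀ f : Ω → ℝ, Measurable f →
      charFun (P.map f) 1 = ∫ ω, Complex.exp (f ω * Complex.I) ∂P := by
    intro f hf
    rw [charFun_apply_real, integral_map hf.aemeasurable (by fun_prop)]
    simp
  have h1 := (hind.restrict s).charFun_map_fun_finsetSum_eq_prod (fun i _ => (hm i).aemeasurable)
  have h2 := congrFun h1 1
  rw [Finset.prod_apply, hchar _ (by fun_prop)] at h2
  simp only [fun i => hchar (ξ i) (hm i)] at h2
  have h3 : ((Real.exp (-(∑ i ∈ s, ∫ ω, ξ i ω ^ 2 ∂P) / 2) : ℝ) : ℂ) =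
      ∏ i ∈ s, ((Real.exp (-(∫ ω, ξ i ω ^ 2 ∂P) / 2) : ℝ) : ℂ) := by
    rw [← Complex.ofReal_prod, ← Real.exp_sum]
    congr 2
    rw [← Finset.sum_div, Finset.sum_neg_distrib]
  rw [h2, h3]
  refine (norm_prod_sub_prod_le s (fun i _ => ?_) fun i _ => ?_).trans
    (Finset.sum_le_sum fun i hi' => integral_cexp_expansion_le hp hp' (hξ i hi') (h0 i hi')
      (hi i hi') (hc i hi'))
  · refine (norm_integral_le_of_norm_le (integrable_const (1 : ℝ))
      (Eventually.of_forall fun ω => ?_)).trans (by simp)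
    rw [Complex.norm_exp_ofReal_mul_I]
  · rw [Complex.norm_real, Real.norm_of_nonneg (Real.exp_pos _).le]
    refine Real.exp_le_one_iff.2 ?_
    have : 0 ≤ ∫ ω, ξ i ω ^ 2 ∂P := integral_nonneg fun ω => sq_nonneg _
    linarith

end CharFun

section Levy

variable {d : ℕ}

lemma dotProduct_mulVec_single (V : Matrix (Fin d) (Fin d) ℝ) (a c : Fin d) :
    (Pi.single a 1 : Fin d → ℝ) ⬝ᵥ V.mulVec (Pi.single c 1) = V a c := by
  simp

lemma abs_entry_le_of_posSemidef {V : Matrix (Fin d) (Fin d) ℝ} (hV : V.PosSemidef) {C : ℝ}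
    (hC : ∀ x : Euc d, x.ofLp ⬝ᵥ V.mulVec x.ofLp ≤ C * ‖x‖ ^ 2) (a c : Fin d) : |V a c| ≤ C := by
  obtain ⟨hH, h0⟩ := Matrix.posSemidef_iff_dotProduct_mulVec.1 hV
  have hs : V c a = V a c := by simpa using hH.apply a c
  have hC1 : ∀ a, V a a ≤ C := by
    intro a
    have := hC (EuclideanSpace.single a 1)
    simpa using this
  have hp := h0 (Pi.single a 1 + Pi.single c 1)
  have hm := h0 (Pi.single a 1 - Pi.single c 1)
  simp only [star_trivial, Matrix.mulVec_add, Matrix.mulVec_sub, add_dotProduct, sub_dotProduct,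
    dotProduct_add, dotProduct_sub, dotProduct_mulVec_single, hs] at hp hm
  rw [abs_le]
  constructor <;> linarith [hC1 a, hC1 c]

/-- Laws whose characteristic functions approach those of Gaussian laws with bounded covariance
approach these Gaussian laws weakly. -/
lemma tendsto_integral_sub_gaussian {μ : ℕ → Measure (Euc d)} [∀ n, IsProbabilityMeasure (μ n)]
    {V : ℕ → Matrix (Fin d) (Fin d) ℝ} (hV : ∀ n, (V n).PosSemidef) {C : ℝ}
    (hC : ∀ n, ∀ x : Euc d, x.ofLp ⬝ᵥ (V n).mulVec x.ofLp ≤ C * ‖x‖ ^ 2)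
    (h : ∀ t : Euc d, Tendsto
      (fun n => charFun (μ n) t - charFun (multivariateGaussian 0 (V n)) t) atTop (𝓝 0))
    (g : Euc d →ᵇ ℝ) :
    Tendsto (fun n => ∫ x, g x ∂μ n - ∫ x, g x ∂multivariateGaussian 0 (V n)) atTop (𝓝 0) := by
  refine tendsto_of_subseq_tendsto fun ns hns => ?_
  set v : ℕ → Fin d → Fin d → ℝ := fun n a c => V (ns n) a c with hv
  have hbdd : Bornology.IsBounded
      (Set.pi Set.univ fun _ : Fin d => Set.pi Set.univ fun _ : Fin d => Set.Icc (-C) C) :=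
    Bornology.IsBounded.pi fun _ => Bornology.IsBounded.pi fun _ => Metric.isBounded_Icc _ _
  obtain ⟨V₀, -, ms, hms, hlim⟩ := tendsto_subseq_of_bounded hbdd (x := v)
    fun n a _ c _ => abs_le.1 (abs_entry_le_of_posSemidef (hV _) (hC _) a c)
  refine ⟨ms, ?_⟩
  have hent : ∀ a c, Tendsto (fun n => V (ns (ms n)) a c) atTop (𝓝 (V₀ a c)) := fun a c =>
    tendsto_pi_nhds.1 (tendsto_pi_nhds.1 hlim a) c
  set W : Matrix (Fin d) (Fin d) ℝ := Matrix.of V₀ with hW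
  have hquad : ∀ x : Fin d → ℝ, Tendsto (fun n => x ⬝ᵥ (V (ns (ms n))).mulVec x) atTop
      (𝓝 (x ⬝ᵥ W.mulVec x)) := by
    intro x
    simp only [dotProduct, Matrix.mulVec]
    exact tendsto_finsetSum _ fun a _ => Tendsto.const_mul _
      (tendsto_finsetSum _ fun c _ => (hent a c).mul_const _)
  have hWp : W.PosSemidef := by
    refine Matrix.posSemidef_iff_dotProduct_mulVec.2 ⟨?_, fun x => ?_⟩
    · ext a c
      refine tendsto_nhds_unique (a := W c a) (hent c a) ((hent a c).congr fun n => ?_)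
      simpa using ((hV (ns (ms n))).1.apply c a)
    · exact ge_of_tendsto' (hquad x) fun n => by
        simpa using (Matrix.posSemidef_iff_dotProduct_mulVec.1 (hV (ns (ms n)))).2 x
  have hsub : Tendsto (fun n => ns (ms n)) atTop atTop := hns.comp hms.tendsto_atTop
  have hG : ∀ t, Tendsto (fun n => charFun (multivariateGaussian 0 (V (ns (ms n)))) t) atTop
      (𝓝 (charFun (multivariateGaussian 0 W) t)) := by
    intro t
    simp only [charFun_multivariateGaussian (hV _), charFun_multivariateGaussian hWp]
    have h1 := (Complex.continuous_ofReal.tendsto _).comp (hquad t.ofLp)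
    exact (Complex.continuous_exp.tendsto _).comp ((h1.div_const 2).const_sub _)
  have hM : ∀ t, Tendsto (fun n => charFun (μ (ns (ms n))) t) atTop
      (𝓝 (charFun (multivariateGaussian 0 W) t)) := by
    intro t
    have := ((h t).comp hsub).add (hG t)
    simpa [Function.comp_def] using this
  have k1 := (ProbabilityMeasure.tendsto_iff_forall_integral_tendsto.1
    (ProbabilityMeasure.tendsto_of_tendsto_charFun
      (μ := fun n => ⟨multivariateGaussian 0 (V (ns (ms n))), inferInstance⟩)
      (μ₀ := ⟨multivariateGaussian 0 W, inferInstance⟩) hG)) g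
  have k2 := (ProbabilityMeasure.tendsto_iff_forall_integral_tendsto.1
    (ProbabilityMeasure.tendsto_of_tendsto_charFun
      (μ := fun n => ⟨μ (ns (ms n)), inferInstance⟩)
      (μ₀ := ⟨multivariateGaussian 0 W, inferInstance⟩) hM)) g
  simpa using k2.sub k1

end Levy

section IndependentSums

variable {d : ℕ} {Ω : Type*} [MeasurableSpace Ω] {P : Measure Ω}

lemma integral_inner_eq_zero_of_indep {ξ ζ : Ω → Euc d} (h : IndepFun ξ ζ P)
    (hξ : Integrable ξ P) (hζ : Integrable ζ P) (h0 : ∫ ω, ξ ω ∂P = 0) :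
    ∫ ω, inner ℝ (ξ ω) (ζ ω) ∂P = 0 := by
  have := h.integral_bilin hξ hζ (innerSL ℝ)
  exact this.trans (by simp [h0])

/-- The mean square of a sum of centred independent vectors. -/
lemma lintegral_enorm_sum_sq_le {ι : Type*} (s : Finset ι) {ξ : ι → Ω → Euc d}
    [IsProbabilityMeasure P]
    (hind : ∀ i ∈ s, ∀ i' ∈ s, i ≠ i' → IndepFun (ξ i) (ξ i') P)
    (hξ : ∀ i ∈ s, MemLp (ξ i) 2 P) (h0 : ∀ i ∈ s, ∫ ω, ξ i ω ∂P = 0) :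
    ∫⁻ ω, ‖∑ i ∈ s, ξ i ω‖ₑ ^ 2 ∂P ≤ ∑ i ∈ s, ∫⁻ ω, ‖ξ i ω‖ₑ ^ 2 ∂P := by
  have hsum : MemLp (fun ω => ∑ i ∈ s, ξ i ω) 2 P := memLp_finsetSum _ hξ
  rw [lintegral_enorm_sq_eq hsum]
  have h1 : ∑ i ∈ s, ∫⁻ ω, ‖ξ i ω‖ₑ ^ 2 ∂P =
      ENNReal.ofReal (∑ i ∈ s, ∫ ω, ‖ξ i ω‖ ^ 2 ∂P) := by
    rw [ENNReal.ofReal_sum_of_nonneg fun i _ => integral_nonneg fun ω => sq_nonneg _]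
    exact Finset.sum_congr rfl fun i hi => lintegral_enorm_sq_eq (hξ i hi)
  rw [h1]
  refine ENNReal.ofReal_le_ofReal (le_of_eq ?_)
  have hii : ∀ i ∈ s, ∀ i' ∈ s, Integrable (fun ω => inner ℝ (ξ i ω) (ξ i' ω)) P :=
    fun i hi i' hi' => ((hξ i hi).norm.integrable_mul (hξ i' hi').norm).mono'
      ((hξ i hi).aestronglyMeasurable.inner (hξ i' hi').aestronglyMeasurable)
      (Eventually.of_forall fun ω => norm_inner_le_norm _ _)
  calc ∫ ω, ‖∑ i ∈ s, ξ i ω‖ ^ 2 ∂P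
      = ∫ ω, ∑ i ∈ s, ∑ i' ∈ s, inner ℝ (ξ i ω) (ξ i' ω) ∂P := by
        refine integral_congr_ae (Eventually.of_forall fun ω => ?_)
        simp only [← real_inner_self_eq_norm_sq, sum_inner, inner_sum]
        exact Finset.sum_comm
    _ = ∑ i ∈ s, ∑ i' ∈ s, ∫ ω, inner ℝ (ξ i ω) (ξ i' ω) ∂P := by
        rw [integral_finsetSum _ fun i hi => integrable_finsetSum _ fun i' hi' => hii i hi i' hi']
        exact Finset.sum_congr rfl fun i hi => integral_finsetSum _ fun i' hi' => hii i hi i' hi'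
    _ = ∑ i ∈ s, ∫ ω, ‖ξ i ω‖ ^ 2 ∂P := by
        refine Finset.sum_congr rfl fun i hi => ?_
        rw [Finset.sum_eq_single i]
        · simp only [real_inner_self_eq_norm_sq]
        · intro i' hi' hne
          exact integral_inner_eq_zero_of_indep (hind i hi i' hi' hne.symm)
            ((hξ i hi).integrable one_le_two) ((hξ i' hi').integrable one_le_two) (h0 i hi)
        · exact fun h => absurd hi h

end IndependentSums
end

noncomputable section

namespace Experiment

variable {d : ℕ} {X : Experiment.{u, v, w} d} {M δ ρ κ σ₁ σ₂ σ₃ σ₅ r₁ r₂ : ℝ}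

section Samples

variable {F : Type*} [NormedAddCommGroup F]

lemma Setting.lintegral_sample (hS : X.Setting M δ) (j : Fin X.m) (i : Fin (X.n j))
    {f : X.Obs j → ℝ≥0∞} (hf : Measurable f) :
    ∫⁻ ω, f (X.Z j i ω) ∂X.μ = ∫⁻ z, f z ∂X.P j := by
  rw [← hS.law_Z j i, lintegral_map hf (hS.measurable_Z j i)]

lemma Setting.integral_sample [NormedSpace ℝ F] (hS : X.Setting M δ) (j : Fin X.m)
    (i : Fin (X.n j)) {f : X.Obs j → F} (hf : AEStronglyMeasurable f (X.P j)) :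
    ∫ ω, f (X.Z j i ω) ∂X.μ = ∫ z, f z ∂X.P j := by
  rw [← hS.law_Z j i, integral_map (hS.measurable_Z j i).aemeasurable
    (by rwa [hS.law_Z j i])]

lemma Setting.measurePreserving_sample (hS : X.Setting M δ) (j : Fin X.m) (i : Fin (X.n j)) :
    MeasurePreserving (X.Z j i) X.μ (X.P j) := ⟨hS.measurable_Z j i, hS.law_Z j i⟩

lemma Setting.indep_sample (hS : X.Setting M δ) {f : ∀ j, X.Obs j → Euc d}
    (hf : ∀ j, Measurable (f j)) :
    iIndepFun (fun (p : (j : Fin X.m) × Fin (X.n j)) ω => f p.1 (X.Z p.1 p.2 ω)) X.μ :=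
  hS.indep_Z.comp (fun p => f p.1) fun p => hf p.1

/-- Mean square of the sum of a centred function over a part of the pooled sample. -/
lemma Setting.lintegral_sum_sq_le (hS : X.Setting M δ) {f : ∀ j, X.Obs j → Euc d}
    (hf : ∀ j, Measurable (f j)) {C : ℝ} (hC : ∀ j, ∫⁻ z, ‖f j z‖ₑ ^ 2 ∂X.P j ≤ ENNReal.ofReal C)
    (h0 : ∀ j, ∫ z, f j z ∂X.P j = 0) (s : Finset ((j : Fin X.m) × Fin (X.n j))) :
    ∫⁻ ω, ‖∑ p ∈ s, f p.1 (X.Z p.1 p.2 ω)‖ₑ ^ 2 ∂X.μ ≤ ENNReal.ofReal (s.card * C) := by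
  have hL : ∀ j, MemLp (f j) 2 (X.P j) := fun j =>
    memLp_two_of_lintegral_sq_le (hf j).aestronglyMeasurable (hC j)
  refine (lintegral_enorm_sum_sq_le s (ξ := fun p ω => f p.1 (X.Z p.1 p.2 ω))
    (fun p _ p' _ hpp => (hS.indep_sample hf).indepFun hpp)
    (fun p _ => (hL p.1).comp_measurePreserving (hS.measurePreserving_sample p.1 p.2))
    (fun p _ => ?_)).trans ?_
  · rw [hS.integral_sample p.1 p.2 (hf p.1).aestronglyMeasurable, h0]
  · calc _ ≤ ∑ p ∈ s, ENNReal.ofReal C := by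
          refine Finset.sum_le_sum fun p _ => ?_
          rw [hS.lintegral_sample p.1 p.2 ((hf p.1).enorm.pow_const 2)]
          exact hC p.1
      _ = _ := by
          rw [Finset.sum_const, nsmul_eq_mul, ENNReal.ofReal_mul (by positivity)]
          simp

end Samples

/-- The observations of a cluster. -/
def clusterIndex (X : Experiment.{u, v, w} d) (k : Fin X.K) :
    Finset ((j : Fin X.m) × Fin (X.n j)) :=
  (Finset.univ.filter fun j => X.cluster j = k).sigma fun _ => Finset.univ

lemma card_clusterIndex (k : Fin X.K) : (X.clusterIndex k).card = X.N k := by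
  simp [clusterIndex, Finset.card_sigma, N]

lemma sum_clusterIndex {F : Type*} [AddCommMonoid F] (k : Fin X.K)
    (f : ∀ j, Fin (X.n j) → F) :
    ∑ p ∈ X.clusterIndex k, f p.1 p.2 = ∑ j with X.cluster j = k, ∑ i, f j i :=
  Finset.sum_sigma _ _ _

/-- Sum of the scores of a task at the true parameters. -/
def taskScore (X : Experiment.{u, v, w} d) (j : Fin X.m) (ω : X.Ω) : Euc d :=
  ∑ i, X.score j (X.ηstar j) (X.Z j i ω)

/-- Sum of the scores of a cluster at the true parameters. -/
def scoreSum (X : Experiment.{u, v, w} d) (k : Fin X.K) (ω : X.Ω) : Euc d :=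
  ∑ j with X.cluster j = k, X.taskScore j ω

lemma scoreSum_eq (k : Fin X.K) (ω : X.Ω) :
    X.scoreSum k ω = ∑ p ∈ X.clusterIndex k, X.score p.1 (X.ηstar p.1) (X.Z p.1 p.2 ω) :=
  (X.sum_clusterIndex k fun j i => X.score j (X.ηstar j) (X.Z j i ω)).symm

lemma measurable_scoreSum (hS : X.Setting M δ) (hL : X.LossRegularity M ρ κ σ₁ σ₂ σ₃ σ₅ r₁ r₂)
    (hM : 0 < M) (k : Fin X.K) : Measurable (X.scoreSum k) := by
  unfold scoreSum taskScore
  exact Finset.measurable_fun_sum _ fun j _ => Finset.measurable_fun_sum _ fun i _ =>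
    (measurable_score hS hL hM j).comp (hS.measurable_Z j i)

lemma lintegral_scoreSum_sq_le (hS : X.Setting M δ)
    (hL : X.LossRegularity M ρ κ σ₁ σ₂ σ₃ σ₅ r₁ r₂)
    (hM : 0 < M) (hr₁ : 2 < r₁) (hr₂ : 2 < r₂) (k : Fin X.K) :
    ∫⁻ ω, ‖X.scoreSum k ω‖ₑ ^ 2 ∂X.μ ≤ ENNReal.ofReal (X.N k * (1 + |σ₁|)) := by
  simp only [scoreSum_eq]
  rw [← card_clusterIndex]
  exact hS.lintegral_sum_sq_le (fun j => measurable_score hS hL hM j)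
    (fun j => lintegral_enorm_sq_le_of_moment hr₁ (hL.score_moment j))
    (fun j => integral_score hS hL hM hr₁ hr₂ j) _

lemma memLp_scoreSum (hS : X.Setting M δ) (hL : X.LossRegularity M ρ κ σ₁ σ₂ σ₃ σ₅ r₁ r₂)
    (hM : 0 < M) (hr₁ : 2 < r₁) (hr₂ : 2 < r₂) (k : Fin X.K) : MemLp (X.scoreSum k) 2 X.μ :=
  memLp_two_of_lintegral_sq_le (measurable_scoreSum hS hL hM k).aestronglyMeasurable
    (lintegral_scoreSum_sq_le hS hL hM hr₁ hr₂ k)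

/-- Sum over the observations of one task. -/
lemma Setting.lintegral_task_sum_sq_le (hS : X.Setting M δ) {f : ∀ j, X.Obs j → Euc d}
    (hf : ∀ j, Measurable (f j)) {C : ℝ} (hC : ∀ j, ∫⁻ z, ‖f j z‖ₑ ^ 2 ∂X.P j ≤ ENNReal.ofReal C)
    (h0 : ∀ j, ∫ z, f j z ∂X.P j = 0) (j : Fin X.m) :
    ∫⁻ ω, ‖∑ i, f j (X.Z j i ω)‖ₑ ^ 2 ∂X.μ ≤ ENNReal.ofReal (X.n j * C) := by
  have h := hS.lintegral_sum_sq_le hf hC h0 (({j} : Finset (Fin X.m)).sigma fun _ => Finset.univ)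
  have hc : (({j} : Finset (Fin X.m)).sigma fun j => (Finset.univ : Finset (Fin (X.n j)))).card =
      X.n j := by simp [Finset.card_sigma]
  rw [hc] at h
  refine le_trans (le_of_eq (lintegral_congr fun ω => ?_)) h
  rw [Finset.sum_sigma, Finset.sum_singleton]

lemma lintegral_taskScore_sq_le (hS : X.Setting M δ)
    (hL : X.LossRegularity M ρ κ σ₁ σ₂ σ₃ σ₅ r₁ r₂)
    (hM : 0 < M) (hr₁ : 2 < r₁) (hr₂ : 2 < r₂) (j : Fin X.m) :
    ∫⁻ ω, ‖X.taskScore j ω‖ₑ ^ 2 ∂X.μ ≤ ENNReal.ofReal (X.n j * (1 + |σ₁|)) :=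
  hS.lintegral_task_sum_sq_le (fun j => measurable_score hS hL hM j)
    (fun j => lintegral_enorm_sq_le_of_moment hr₁ (hL.score_moment j))
    (fun j => integral_score hS hL hM hr₁ hr₂ j) j

lemma lintegral_hessianDeviation_sum_sq_le (hS : X.Setting M δ)
    (hL : X.LossRegularity M ρ κ σ₁ σ₂ σ₃ σ₅ r₁ r₂)
    (hM : 0 < M) (hr₁ : 2 < r₁) (hr₂ : 2 < r₂) (j : Fin X.m) (c : Fin d) :
    ∫⁻ ω, ‖∑ i, X.hessianDeviation j (X.Z j i ω) (EuclideanSpace.basisFun (Fin d) ℝ c)‖ₑ ^ 2 ∂X.μ ≤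
      ENNReal.ofReal (X.n j * (d * (18 * (1 + |σ₂|)))) :=
  hS.lintegral_task_sum_sq_le
    (f := fun j z => X.hessianDeviation j z (EuclideanSpace.basisFun (Fin d) ℝ c))
    (fun j => measurable_hessianDeviation hS hL hM j _)
    (fun j => hessianDeviation_sq_moment hS hL hM hr₁ hr₂ j c)
    (fun j => by
      have hi := integrable_lossHessian hS hL hM hr₂ j
      simp only [hessianDeviation, sub_apply]
      rw [integral_sub (hi.apply_continuousLinearMap _) (integrable_const _), integral_const,
        ← popHessian_apply hS hL hM hr₁ hr₂ j]
      simp) j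

/-! ### The matrices of the limit law -/

lemma N_pos (hS : X.Setting M δ) (k : Fin X.K) : 0 < X.N k := by
  obtain ⟨j, hj⟩ := hS.cluster_surjective k
  exact Finset.sum_pos (fun j _ => hS.n_pos j) ⟨j, by simp [hj]⟩

lemma clusterLoss_eq (k : Fin X.K) (ω : X.Ω) (η : ∀ j, X.H j) :
    (fun θ => X.clusterLoss k θ η ω) =
      fun θ => ∑ p ∈ X.clusterIndex k, X.loss p.1 θ (η p.1) (X.Z p.1 p.2 ω) := by
  funext θ
  exact (X.sum_clusterIndex k fun j i => X.loss j θ (η j) (X.Z j i ω)).symm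

lemma θstar_eq_of_mem {k : Fin X.K} {p : (j : Fin X.m) × Fin (X.n j)}
    (hp : p ∈ X.clusterIndex k) : X.θstar p.1 = X.β k := by
  have : X.cluster p.1 = k := by simpa [clusterIndex] using hp
  rw [θstar, this]

lemma twiceDifferentiableAt_loss (hL : X.LossRegularity M ρ κ σ₁ σ₂ σ₃ σ₅ r₁ r₂) (hM : 0 < M)
    {k : Fin X.K} (ω : X.Ω) {p : (j : Fin X.m) × Fin (X.n j)} (hp : p ∈ X.clusterIndex k) :
    TwiceDifferentiableAt (fun θ => X.loss p.1 θ (X.ηstar p.1) (X.Z p.1 p.2 ω)) (X.β k) :=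
  hL.smooth p.1 _ (Metric.mem_closedBall_self hM.le) _ _ (by
    rw [θstar_eq_of_mem hp]; exact Metric.mem_closedBall_self hM.le)

lemma gradient_clusterLoss (hL : X.LossRegularity M ρ κ σ₁ σ₂ σ₃ σ₅ r₁ r₂) (hM : 0 < M)
    (k : Fin X.K) (ω : X.Ω) :
    gradient (fun θ => X.clusterLoss k θ X.ηstar ω) (X.β k) = X.scoreSum k ω := by
  rw [clusterLoss_eq, gradient_fun_sum fun p hp =>
    (twiceDifferentiableAt_loss hL hM ω hp).differentiableAt, scoreSum_eq]
  exact Finset.sum_congr rfl fun p hp => by rw [score, θstar_eq_of_mem hp]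

lemma hessian_clusterLoss (hL : X.LossRegularity M ρ κ σ₁ σ₂ σ₃ σ₅ r₁ r₂) (hM : 0 < M)
    (k : Fin X.K) (ω : X.Ω) :
    hessian (fun θ => X.clusterLoss k θ X.ηstar ω) (X.β k) =
      ∑ p ∈ X.clusterIndex k, X.lossHessian p.1 (X.Z p.1 p.2 ω) := by
  rw [clusterLoss_eq, hessian_fun_sum fun p hp => twiceDifferentiableAt_loss hL hM ω hp]
  exact Finset.sum_congr rfl fun p hp => by rw [lossHessian, θstar_eq_of_mem hp]

/-- The operator given by the matrix `Ψ_k`. -/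
def psiOp (X : Experiment.{u, v, w} d) (k : Fin X.K) : Euc d →L[ℝ] Euc d :=
  (X.N k : ℝ)⁻¹ • ∑ j with X.cluster j = k, (X.n j : ℝ) • X.popHessian j (X.θstar j)

lemma integrable_lossHessian_sample (hS : X.Setting M δ)
    (hL : X.LossRegularity M ρ κ σ₁ σ₂ σ₃ σ₅ r₁ r₂) (hM : 0 < M) (hr₂ : 2 < r₂)
    (j : Fin X.m) (i : Fin (X.n j)) :
    Integrable (fun ω => X.lossHessian j (X.Z j i ω)) X.μ :=
  (hS.measurePreserving_sample j i).integrable_comp_of_integrable (g := X.lossHessian j)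
    (integrable_lossHessian hS hL hM hr₂ j)

lemma integrable_pooledHessian (hS : X.Setting M δ)
    (hL : X.LossRegularity M ρ κ σ₁ σ₂ σ₃ σ₅ r₁ r₂) (hM : 0 < M) (hr₂ : 2 < r₂)
    (k : Fin X.K) : Integrable (fun ω => ∑ p ∈ X.clusterIndex k, X.lossHessian p.1 (X.Z p.1 p.2 ω))
      X.μ :=
  integrable_finsetSum (X.clusterIndex k) (f := fun p ω => X.lossHessian p.1 (X.Z p.1 p.2 ω))
    fun p _ => integrable_lossHessian_sample hS hL hM hr₂ p.1 p.2

lemma integrable_pooledHessian_entry (hS : X.Setting M δ)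
    (hL : X.LossRegularity M ρ κ σ₁ σ₂ σ₃ σ₅ r₁ r₂) (hM : 0 < M) (hr₂ : 2 < r₂)
    (k : Fin X.K) (a c : Fin d) : Integrable (fun ω => X.pooledHessian k ω a c) X.μ := by
  simp only [pooledHessian, Matrix.of_apply, hessian_clusterLoss hL hM]
  refine Integrable.const_mul ?_ _
  exact (((integrable_pooledHessian hS hL hM hr₂ k).apply_continuousLinearMap
    (EuclideanSpace.single c 1)).eval_piLp a)

lemma Psi_apply (hS : X.Setting M δ)
    (hL : X.LossRegularity M ρ κ σ₁ σ₂ σ₃ σ₅ r₁ r₂) (hM : 0 < M) (hr₁ : 2 < r₁) (hr₂ : 2 < r₂)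
    (k : Fin X.K) (a c : Fin d) :
    X.Psi k a c = X.psiOp k (EuclideanSpace.single c 1) a := by
  have hi := integrable_pooledHessian hS hL hM hr₂ k
  have h1 : ∫ ω, ∑ p ∈ X.clusterIndex k, X.lossHessian p.1 (X.Z p.1 p.2 ω) ∂X.μ =
      ∑ j with X.cluster j = k, (X.n j : ℝ) • X.popHessian j (X.θstar j) := by
    rw [integral_finsetSum _ fun p _ => integrable_lossHessian_sample hS hL hM hr₂ p.1 p.2]
    have : ∀ p ∈ X.clusterIndex k, ∫ ω, X.lossHessian p.1 (X.Z p.1 p.2 ω) ∂X.μ =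
        X.popHessian p.1 (X.θstar p.1) := fun p _ => by
      rw [hS.integral_sample p.1 p.2 (integrable_lossHessian hS hL hM hr₂ p.1).aestronglyMeasurable,
        popHessian_eq_integral hS hL hM hr₁ hr₂]
    rw [Finset.sum_congr rfl this, X.sum_clusterIndex k fun j _ => X.popHessian j (X.θstar j)]
    refine Finset.sum_congr rfl fun j _ => ?_
    rw [Finset.sum_const, Finset.card_univ, Fintype.card_fin]
    exact (Nat.cast_smul_eq_nsmul ℝ _ _).symm
  simp only [Psi, pooledHessian, Matrix.of_apply, hessian_clusterLoss hL hM]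
  rw [integral_const_mul, psiOp, ← h1]
  simp only [smul_apply, PiLp.smul_apply, smul_eq_mul]
  congr 1
  rw [ContinuousLinearMap.integral_apply hi]
  exact (eval_integral_piLp fun b =>
    (hi.apply_continuousLinearMap (EuclideanSpace.single c 1)).eval_piLp b) a |>.symm

lemma toLp_Psi_mulVec (hS : X.Setting M δ)
    (hL : X.LossRegularity M ρ κ σ₁ σ₂ σ₃ σ₅ r₁ r₂) (hM : 0 < M) (hr₁ : 2 < r₁) (hr₂ : 2 < r₂)
    (k : Fin X.K) (x : Euc d) : (X.Psi k).mulVec x.ofLp = (X.psiOp k x).ofLp := by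
  funext a
  have hx : x = ∑ c, x c • EuclideanSpace.single c (1 : ℝ) := by
    ext b
    simp [Finset.sum_apply, Pi.single_apply]
  conv_rhs => rw [hx, map_sum]
  simp only [Matrix.mulVec, dotProduct, Psi_apply hS hL hM hr₁ hr₂, map_smul, WithLp.ofLp_sum,
    Finset.sum_apply, WithLp.ofLp_smul, Pi.smul_apply, smul_eq_mul]
  exact Finset.sum_congr rfl fun c _ => mul_comm _ _

lemma psiOp_symm (hS : X.Setting M δ)
    (hL : X.LossRegularity M ρ κ σ₁ σ₂ σ₃ σ₅ r₁ r₂) (hM : 0 < M) (hr₁ : 2 < r₁) (hr₂ : 2 < r₂)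
    (k : Fin X.K) (v w : Euc d) : inner ℝ v (X.psiOp k w) = inner ℝ w (X.psiOp k v) := by
  simp only [psiOp, smul_apply, sum_apply, inner_smul_right, inner_sum,
    popHessian_symm hS hL hM hr₁ hr₂ _ v w]

lemma le_inner_psiOp (hS : X.Setting M δ)
    (hL : X.LossRegularity M ρ κ σ₁ σ₂ σ₃ σ₅ r₁ r₂) (hM : 0 < M) (k : Fin X.K) (v : Euc d) :
    ρ * ‖v‖ ^ 2 ≤ inner ℝ v (X.psiOp k v) := by
  simp only [psiOp, smul_apply, sum_apply, inner_smul_right, inner_sum]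
  have hN : (0 : ℝ) < X.N k := by exact_mod_cast N_pos hS k
  rw [inv_mul_eq_div, le_div_iff₀ hN]
  have : (X.N k : ℝ) = ∑ j with X.cluster j = k, (X.n j : ℝ) := by simp [N]
  rw [this, Finset.mul_sum]
  refine Finset.sum_le_sum fun j _ => ?_
  have := (hL.curvature j _ (Metric.mem_closedBall_self hM.le) v).1
  have hn : (0 : ℝ) ≤ X.n j := by positivity
  nlinarith

lemma posDef_Psi (hS : X.Setting M δ)
    (hL : X.LossRegularity M ρ κ σ₁ σ₂ σ₃ σ₅ r₁ r₂) (hρ : 0 < ρ) (hM : 0 < M) (hr₁ : 2 < r₁)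
    (hr₂ : 2 < r₂) (k : Fin X.K) : (X.Psi k).PosDef := by
  refine Matrix.posDef_iff_dotProduct_mulVec.2 ⟨?_, fun x hx => ?_⟩
  · ext a c
    have h := psiOp_symm hS hL hM hr₁ hr₂ k (EuclideanSpace.single a 1) (EuclideanSpace.single c 1)
    simp only [EuclideanSpace.inner_single_left, map_one, one_mul] at h
    simp [Psi_apply hS hL hM hr₁ hr₂, h]
  · set v : Euc d := WithLp.toLp 2 x with hv
    have h1 := le_inner_psiOp hS hL hM k v
    have h2 : star x ⬝ᵥ (X.Psi k).mulVec x = inner ℝ v (X.psiOp k v) := by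
      have := toLp_Psi_mulVec hS hL hM hr₁ hr₂ k v
      simp only [hv] at this
      rw [this, EuclideanSpace.inner_eq_star_dotProduct, dotProduct_comm]
    have h3 : 0 < ‖v‖ := norm_pos_iff.2 fun h => hx (by simpa [hv] using h)
    rw [h2]
    exact lt_of_lt_of_le (by positivity) h1

lemma integrable_pooledScoreOuter (hS : X.Setting M δ)
    (hL : X.LossRegularity M ρ κ σ₁ σ₂ σ₃ σ₅ r₁ r₂) (hM : 0 < M) (hr₁ : 2 < r₁) (hr₂ : 2 < r₂)
    (k : Fin X.K) (a c : Fin d) : Integrable (fun ω => X.pooledScoreOuter k ω a c) X.μ := by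
  simp only [pooledScoreOuter, Matrix.of_apply, gradient_clusterLoss hL hM]
  have h := memLp_scoreSum hS hL hM hr₁ hr₂ k
  exact ((h.eval_piLp a).integrable_mul (h.eval_piLp c)).const_mul _

/-- The quadratic form of `Ω_k`. -/
lemma dotProduct_Omega_mulVec (hS : X.Setting M δ)
    (hL : X.LossRegularity M ρ κ σ₁ σ₂ σ₃ σ₅ r₁ r₂) (hM : 0 < M) (hr₁ : 2 < r₁) (hr₂ : 2 < r₂)
    (k : Fin X.K) (x : Euc d) :
    x.ofLp ⬝ᵥ (X.Omega k).mulVec x.ofLp =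
      (X.N k : ℝ)⁻¹ * ∫ ω, inner ℝ x (X.scoreSum k ω) ^ 2 ∂X.μ := by
  have hi := fun a c => integrable_pooledScoreOuter hS hL hM hr₁ hr₂ k a c
  simp only [dotProduct, Matrix.mulVec, Omega, Matrix.of_apply, Finset.mul_sum]
  have h1 : ∀ a c, x a * ((∫ ω, X.pooledScoreOuter k ω a c ∂X.μ) * x c) =
      ∫ ω, x a * (X.pooledScoreOuter k ω a c * x c) ∂X.μ := fun a c => by
    rw [integral_const_mul, integral_mul_const]
  simp only [h1]
  have hi2 : ∀ a c, Integrable (fun ω => x a * (X.pooledScoreOuter k ω a c * x c)) X.μ :=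
    fun a c => ((hi a c).mul_const _).const_mul _
  rw [← integral_const_mul]
  rw [Finset.sum_congr rfl fun a _ => (integral_finsetSum _ fun c _ => hi2 a c).symm,
    ← integral_finsetSum _ fun a _ => integrable_finsetSum _ fun c _ => hi2 a c]
  refine integral_congr_ae (Eventually.of_forall fun ω => ?_)
  simp only [pooledScoreOuter, Matrix.of_apply, gradient_clusterLoss hL hM]
  have h2 : inner ℝ x (X.scoreSum k ω) = ∑ a, x a * X.scoreSum k ω a := by
    simp [PiLp.inner_apply, mul_comm]
  rw [h2, sq, Finset.sum_mul_sum, Finset.mul_sum]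
  refine Finset.sum_congr rfl fun a _ => ?_
  rw [Finset.mul_sum]
  exact Finset.sum_congr rfl fun c _ => by ring

lemma posSemidef_Omega (hS : X.Setting M δ)
    (hL : X.LossRegularity M ρ κ σ₁ σ₂ σ₃ σ₅ r₁ r₂) (hM : 0 < M) (hr₁ : 2 < r₁) (hr₂ : 2 < r₂)
    (k : Fin X.K) : (X.Omega k).PosSemidef := by
  refine Matrix.posSemidef_iff_dotProduct_mulVec.2 ⟨?_, fun x => ?_⟩
  · ext a c
    simp only [Matrix.conjTranspose_apply, Omega, pooledScoreOuter, Matrix.of_apply, star_trivial]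
    congr 1
    funext ω
    ring
  · have := dotProduct_Omega_mulVec hS hL hM hr₁ hr₂ k (WithLp.toLp 2 x)
    simp only at this
    rw [star_trivial, this]
    exact mul_nonneg (by positivity) (integral_nonneg fun ω => sq_nonneg _)

lemma Omega_quadratic_le (hS : X.Setting M δ)
    (hL : X.LossRegularity M ρ κ σ₁ σ₂ σ₃ σ₅ r₁ r₂) (hM : 0 < M) (hr₁ : 2 < r₁) (hr₂ : 2 < r₂)
    (k : Fin X.K) (x : Euc d) :
    x.ofLp ⬝ᵥ (X.Omega k).mulVec x.ofLp ≤ (1 + |σ₁|) * ‖x‖ ^ 2 := by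
  rw [dotProduct_Omega_mulVec hS hL hM hr₁ hr₂]
  have hN : (0 : ℝ) < X.N k := by exact_mod_cast N_pos hS k
  have h := memLp_scoreSum hS hL hM hr₁ hr₂ k
  have h1 : ∫ ω, inner ℝ x (X.scoreSum k ω) ^ 2 ∂X.μ ≤
      ∫ ω, ‖x‖ ^ 2 * ‖X.scoreSum k ω‖ ^ 2 ∂X.μ := by
    refine integral_mono_of_nonneg (Eventually.of_forall fun ω => sq_nonneg _)
      (h.norm.integrable_sq.const_mul _) (Eventually.of_forall fun ω => ?_)
    simp only
    rw [← mul_pow, ← sq_abs]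
    gcongr
    exact abs_real_inner_le_norm _ _
  rw [integral_const_mul] at h1
  have h2 := integral_norm_sq_le_of_lintegral (by positivity)
    (lintegral_scoreSum_sq_le hS hL hM hr₁ hr₂ k)
  rw [inv_mul_le_iff₀ hN]
  calc _ ≤ _ := h1
    _ ≤ ‖x‖ ^ 2 * (X.N k * (1 + |σ₁|)) := by gcongr
    _ = _ := by ring

end Experiment
end

noncomputable section

lemma integrable_rpow_of_lintegral {α F : Type*} [MeasurableSpace α] {μ : Measure α}
    [NormedAddCommGroup F] {f : α → F} (hf : AEStronglyMeasurable f μ) {p C : ℝ} (hp : 0 ≤ p)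
    (hC : 0 ≤ C) (h : ∫⁻ z, ‖f z‖ₑ ^ p ∂μ ≤ ENNReal.ofReal C) :
    Integrable (fun z => ‖f z‖ ^ p) μ ∧ ∫ z, ‖f z‖ ^ p ∂μ ≤ C := by
  have hm : AEStronglyMeasurable (fun z => ‖f z‖ ^ p) μ :=
    (Real.continuous_rpow_const hp).comp_aestronglyMeasurable hf.norm
  have he : ∀ z, ENNReal.ofReal (‖f z‖ ^ p) = ‖f z‖ₑ ^ p := fun z => by
    rw [← ENNReal.ofReal_rpow_of_nonneg (norm_nonneg _) hp, ofReal_norm]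
  have h0 : ∀ z, 0 ≤ ‖f z‖ ^ p := fun z => Real.rpow_nonneg (norm_nonneg _) _
  constructor
  · refine ⟨hm, ?_⟩
    rw [hasFiniteIntegral_iff_ofReal (Eventually.of_forall h0)]
    simp only [he]
    exact h.trans_lt ENNReal.ofReal_lt_top
  · rw [integral_eq_lintegral_of_nonneg_ae (Eventually.of_forall h0) hm]
    simp only [he]
    exact ENNReal.toReal_le_of_le_ofReal hC h

lemma lintegral_enorm_sum_le_of_moments {α Ω' : Type*} {m : ℕ} [MeasurableSpace α]
    [MeasurableSpace Ω'] {Q : Measure α} [IsProbabilityMeasure Q] {P : Measure Ω'}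
    [IsProbabilityMeasure P] {d : ℕ} {Z : Fin m → Ω' → α} (hZ : ∀ i, MeasurePreserving (Z i) P Q)
    (hind : ∀ i i', i ≠ i' → IndepFun (Z i) (Z i') P) {f : α → Euc d} (hf : Measurable f)
    {v b : ℝ} (hv : 0 ≤ v) (hf2 : ∫⁻ z, ‖f z‖ₑ ^ 2 ∂Q ≤ ENNReal.ofReal v)
    (hb : ‖∫ z, f z ∂Q‖ ≤ b) :
    ∫⁻ ω, ‖∑ i, f (Z i ω)‖ₑ ∂P ≤ ENNReal.ofReal (m * b + 2 * Real.sqrt (m * v)) := by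
  set e : Euc d := ∫ z, f z ∂Q with he
  have hb0 : 0 ≤ b := (norm_nonneg _).trans hb
  have hfL : MemLp f 2 Q := memLp_two_of_lintegral_sq_le hf.aestronglyMeasurable hf2
  have hfi := hfL.integrable one_le_two
  have hm : Measurable fun z => f z - e := hf.sub_const _
  have hce : MemLp (fun z => f z - e) 2 Q := hfL.sub (memLp_const e)
  have hcent : ∫⁻ z, ‖f z - e‖ₑ ^ 2 ∂Q ≤ ENNReal.ofReal (4 * v) := by
    rw [lintegral_enorm_sq_eq hce]
    refine ENNReal.ofReal_le_ofReal ?_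
    have h1 := integral_norm_sq_le_of_lintegral hv hf2
    have h2 : ∫ z, ‖f z - e‖ ^ 2 ∂Q = ∫ z, ‖f z‖ ^ 2 ∂Q - ‖e‖ ^ 2 := by
      have h3 : ∀ z, ‖f z - e‖ ^ 2 = ‖f z‖ ^ 2 - 2 * inner ℝ e (f z) + ‖e‖ ^ 2 := fun z => by
        rw [norm_sub_sq_real, real_inner_comm]
      simp only [h3]
      have i1 := hfL.norm.integrable_sq
      have i2 : Integrable (fun z => 2 * inner ℝ e (f z)) Q := (hfi.const_inner e).const_mul 2
      rw [integral_add (f := fun z => ‖f z‖ ^ 2 - 2 * inner ℝ e (f z)) (i1.sub i2)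
        (integrable_const _), integral_sub i1 i2, integral_const_mul,
        integral_inner hfi, ← he, real_inner_self_eq_norm_sq]
      simp
      ring
    rw [h2]
    nlinarith [sq_nonneg ‖e‖]
  have hsumc : ∫⁻ ω, ‖∑ i, (f (Z i ω) - e)‖ₑ ^ 2 ∂P ≤ ENNReal.ofReal (m * (4 * v)) := by
    refine (lintegral_enorm_sum_sq_le (P := P) Finset.univ
      (ξ := fun i ω => f (Z i ω) - e) (fun i _ i' _ hii => (hind i i' hii).comp hm hm)
      (fun i _ => hce.comp_measurePreserving (hZ i)) (fun i _ => ?_)).trans ?_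
    · have h1 := integral_map (μ := P) (f := fun z => f z - e) (hZ i).measurable.aemeasurable
        hm.aestronglyMeasurable
      rw [(hZ i).map_eq] at h1
      refine h1.symm.trans ?_
      rw [integral_sub hfi (integrable_const _)]
      simp [he]
    · calc _ ≤ ∑ i : Fin m, ENNReal.ofReal (4 * v) := by
            refine Finset.sum_le_sum fun i _ => ?_
            rw [(hZ i).lintegral_comp (f := fun z => ‖f z - e‖ₑ ^ 2) (hm.enorm.pow_const 2)]
            exact hcent
        _ = _ := by
            rw [Finset.sum_const, nsmul_eq_mul, ENNReal.ofReal_mul (by positivity)]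
            simp
  have hmS : Measurable fun ω => ∑ i, (f (Z i ω) - e) :=
    Finset.measurable_fun_sum _ fun i _ => (hf.comp (hZ i).measurable).sub_const _
  have hsum1 : ∫⁻ ω, ‖∑ i, (f (Z i ω) - e)‖ₑ ∂P ≤ ENNReal.ofReal (2 * Real.sqrt (m * v)) := by
    have h1 := (sq_lintegral_le_lintegral_sq (μ := P) hmS.enorm.aemeasurable).trans hsumc
    have h2 : (m : ℝ) * (4 * v) = (2 * Real.sqrt (m * v)) ^ 2 := by
      rw [mul_pow, Real.sq_sqrt (by positivity)]; ring
    rw [h2, ENNReal.ofReal_pow (by positivity)] at h1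
    exact (ENNReal.pow_le_pow_left_iff two_ne_zero).1 h1
  calc ∫⁻ ω, ‖∑ i, f (Z i ω)‖ₑ ∂P
      ≤ ∫⁻ ω, (ENNReal.ofReal (m * b) + ‖∑ i, (f (Z i ω) - e)‖ₑ) ∂P := by
        refine lintegral_mono fun ω => ?_
        have h1 : ∑ i, f (Z i ω) = (m : ℝ) • e + ∑ i, (f (Z i ω) - e) := by
          rw [Finset.sum_sub_distrib]
          simp [Nat.cast_smul_eq_nsmul]
        rw [h1]
        refine (enorm_add_le _ _).trans (add_le_add ?_ le_rfl)
        rw [← ofReal_norm, norm_smul, Real.norm_of_nonneg (Nat.cast_nonneg _)]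
        exact ENNReal.ofReal_le_ofReal (by gcongr)
    _ = ENNReal.ofReal (m * b) + ∫⁻ ω, ‖∑ i, (f (Z i ω) - e)‖ₑ ∂P := by
        rw [lintegral_add_left measurable_const]; simp
    _ ≤ ENNReal.ofReal (m * b) + ENNReal.ofReal (2 * Real.sqrt (m * v)) := by
        gcongr
    _ = _ := (ENNReal.ofReal_add (by positivity) (by positivity)).symm

lemma lintegral_comp_of_indepFun {Ω' α β : Type*} [MeasurableSpace Ω'] [MeasurableSpace α]
    [MeasurableSpace β] {P : Measure Ω'} [IsProbabilityMeasure P] {Y : Ω' → α} {W : Ω' → β}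
    (hY : Measurable Y) (hW : Measurable W) (h : IndepFun Y W P) {G : α × β → ℝ≥0∞}
    (hG : Measurable G) :
    ∫⁻ ω, G (Y ω, W ω) ∂P = ∫⁻ ω', ∫⁻ ω, G (Y ω', W ω) ∂P ∂P := by
  have := Measure.isProbabilityMeasure_map (μ := P) hY.aemeasurable
  have := Measure.isProbabilityMeasure_map (μ := P) hW.aemeasurable
  have h1 : ∀ y, ∫⁻ w, G (y, w) ∂(P.map W) = ∫⁻ ω, G (y, W ω) ∂P := fun y =>
    lintegral_map (hG.comp measurable_prodMk_left) hW
  rw [← lintegral_map hG (hY.prodMk hW),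
    (indepFun_iff_map_prod_eq_prod_map_map hY.aemeasurable hW.aemeasurable).1 h,
    lintegral_prod _ hG.aemeasurable, lintegral_map hG.lintegral_prod_right' hY]
  simp only [h1]

namespace Experiment

variable {d : ℕ} {X : Experiment.{u, v, w} d} {M δ ρ κ σ₁ σ₂ σ₃ σ₅ r₁ r₂ : ℝ}

/-- The normalized score of a cluster. -/
def normScore (X : Experiment.{u, v, w} d) (k : Fin X.K) (ω : X.Ω) : Euc d :=
  (Real.sqrt (X.N k))⁻¹ • X.scoreSum k ω

/-- The characteristic function of the normalized score is nearly Gaussian. -/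
lemma norm_charFun_normScore_sub_le (hS : X.Setting M δ)
    (hL : X.LossRegularity M ρ κ σ₁ σ₂ σ₃ σ₅ r₁ r₂)
    (hM : 0 < M) (hr₁ : 2 < r₁) (hr₂ : 2 < r₂) (k : Fin X.K) (x : Euc d) {p : ℝ} (hp : 2 ≤ p)
    (hp' : p ≤ 3) (hpr : p ≤ r₁) :
    ‖∫ ω, Complex.exp ((inner ℝ x (X.normScore k ω) : ℝ) * Complex.I) ∂X.μ -
      Real.exp (-(x.ofLp ⬝ᵥ (X.Omega k).mulVec x.ofLp) / 2)‖ ≤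
      4 * (‖x‖ ^ p * (1 + |σ₁|)) * (X.N k : ℝ) ^ (1 - p / 2) +
        (‖x‖ ^ 2 * (1 + |σ₁|)) ^ 2 * (X.N k : ℝ) ^ (-1 : ℝ) := by
  set C := 1 + |σ₁| with hC
  have hC0 : 0 ≤ C := by positivity
  have hN : (0 : ℝ) < X.N k := by exact_mod_cast N_pos hS k
  set q := (Real.sqrt (X.N k))⁻¹ with hq
  have hq0 : 0 ≤ q := by positivity
  have hq2 : q ^ 2 = (X.N k : ℝ)⁻¹ := by rw [hq, inv_pow, Real.sq_sqrt hN.le]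
  have hqp : q ^ p = (X.N k : ℝ) ^ (-(p / 2)) := by
    rw [hq, Real.sqrt_eq_rpow, ← Real.rpow_neg hN.le, ← Real.rpow_mul hN.le]
    congr 1; ring
  set ξ : ((j : Fin X.m) × Fin (X.n j)) → X.Ω → ℝ := fun p ω =>
    q * inner ℝ x (X.score p.1 (X.ηstar p.1) (X.Z p.1 p.2 ω)) with hξ
  have hms := measurable_score hS hL hM
  have hmf : ∀ j, Measurable fun z => q * inner ℝ x (X.score j (X.ηstar j) z) := fun j =>
    (measurable_const.inner (hms j)).const_mul q
  have hind : iIndepFun ξ X.μ :=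
    hS.indep_Z.comp (fun p z => q * inner ℝ x (X.score p.1 (X.ηstar p.1) z)) fun p => hmf p.1
  have hξm : ∀ p, Measurable (ξ p) := fun p => (hmf p.1).comp (hS.measurable_Z p.1 p.2)
  have hL2 : ∀ i : (j : Fin X.m) × Fin (X.n j),
      MemLp (fun ω => X.score i.1 (X.ηstar i.1) (X.Z i.1 i.2 ω)) 2 X.μ := fun i =>
    (memLp_score hS hL hM hr₁ i.1).comp_measurePreserving (hS.measurePreserving_sample i.1 i.2)
  have hξL2 : ∀ i, MemLp (ξ i) 2 X.μ := fun i => ((hL2 i).const_inner x).const_mul q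
  have hξ0 : ∀ i, ∫ ω, ξ i ω ∂X.μ = 0 := fun i => by
    simp only [hξ]
    rw [integral_const_mul, integral_inner ((hL2 i).integrable one_le_two),
      hS.integral_sample i.1 i.2 (hms i.1).aestronglyMeasurable,
      integral_score hS hL hM hr₁ hr₂, inner_zero_right, mul_zero]
  -- moments
  have hle : ∀ i ω, |ξ i ω| ≤ q * ‖x‖ * ‖X.score i.1 (X.ηstar i.1) (X.Z i.1 i.2 ω)‖ := fun i ω => by
    simp only [hξ]
    rw [abs_mul, abs_of_nonneg hq0, mul_assoc]
    gcongr
    exact abs_real_inner_le_norm _ _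
  have hsm : ∀ i : (j : Fin X.m) × Fin (X.n j),
      Integrable (fun ω => ‖X.score i.1 (X.ηstar i.1) (X.Z i.1 i.2 ω)‖ ^ p) X.μ ∧
      ∫ ω, ‖X.score i.1 (X.ηstar i.1) (X.Z i.1 i.2 ω)‖ ^ p ∂X.μ ≤ C := fun i => by
    refine integrable_rpow_of_lintegral (hL2 i).aestronglyMeasurable (by linarith) hC0 ?_
    rw [hS.lintegral_sample i.1 i.2 (f := fun z => ‖X.score i.1 (X.ηstar i.1) z‖ₑ ^ p)
      ((hms i.1).enorm.pow_const p)]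
    exact lintegral_enorm_rpow_le (by linarith) hpr (hL.score_moment i.1)
  have hlep : ∀ i ω, |ξ i ω| ^ p ≤
      (q ^ p * ‖x‖ ^ p) * ‖X.score i.1 (X.ηstar i.1) (X.Z i.1 i.2 ω)‖ ^ p := fun i ω => by
    rw [← Real.mul_rpow hq0 (norm_nonneg _), ← Real.mul_rpow (by positivity) (norm_nonneg _)]
    exact Real.rpow_le_rpow (abs_nonneg _) (hle i ω) (by linarith)
  have hip : ∀ i, Integrable (fun ω => |ξ i ω| ^ p) X.μ := fun i =>
    ((hsm i).1.const_mul (q ^ p * ‖x‖ ^ p)).mono'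
      ((Real.continuous_rpow_const (by linarith)).comp_aestronglyMeasurable
        (continuous_abs.comp_aestronglyMeasurable (hξm i).aestronglyMeasurable))
      (Eventually.of_forall fun ω => by
        rw [Real.norm_of_nonneg (Real.rpow_nonneg (abs_nonneg _) _)]; exact hlep i ω)
  have hcp : ∀ i, ∫ ω, |ξ i ω| ^ p ∂X.μ ≤ q ^ p * ‖x‖ ^ p * C := fun i => by
    refine (integral_mono (hip i) ((hsm i).1.const_mul _) (hlep i)).trans ?_
    rw [integral_const_mul]
    have : 0 ≤ q ^ p * ‖x‖ ^ p := mul_nonneg (Real.rpow_nonneg hq0 _)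
      (Real.rpow_nonneg (norm_nonneg _) _)
    exact mul_le_mul_of_nonneg_left (hsm i).2 this
  have hvar : ∀ i, ∫ ω, ξ i ω ^ 2 ∂X.μ ≤ q ^ 2 * ‖x‖ ^ 2 * C := fun i => by
    have h1 : ∫ ω, ‖X.score i.1 (X.ηstar i.1) (X.Z i.1 i.2 ω)‖ ^ 2 ∂X.μ ≤ C := by
      refine integral_norm_sq_le_of_lintegral hC0 ?_
      rw [hS.lintegral_sample i.1 i.2 (f := fun z => ‖X.score i.1 (X.ηstar i.1) z‖ₑ ^ 2)
        ((hms i.1).enorm.pow_const 2)]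
      exact lintegral_enorm_sq_le_of_moment hr₁ (hL.score_moment i.1)
    refine (integral_mono (hξL2 i).integrable_sq ((hL2 i).norm.integrable_sq.const_mul
      (q ^ 2 * ‖x‖ ^ 2)) fun ω => ?_).trans ?_
    · simp only
      rw [← sq_abs (ξ i ω), ← mul_pow, ← mul_pow]
      gcongr
      exact hle i ω
    · rw [integral_const_mul]
      gcongr
  have hvar0 : ∀ i, 0 ≤ ∫ ω, ξ i ω ^ 2 ∂X.μ := fun i => integral_nonneg fun ω => sq_nonneg _
  have hsum : ∀ ω, inner ℝ x (X.normScore k ω) = ∑ i ∈ X.clusterIndex k, ξ i ω := fun ω => by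
    rw [normScore, scoreSum_eq, inner_smul_right, inner_sum, Finset.mul_sum]
  have hOm : x.ofLp ⬝ᵥ (X.Omega k).mulVec x.ofLp =
      ∑ i ∈ X.clusterIndex k, ∫ ω, ξ i ω ^ 2 ∂X.μ := by
    have h1 := IndepFun.variance_sum (μ := X.μ) (X := ξ) (s := X.clusterIndex k)
      (fun i _ => hξL2 i) (fun i _ i' _ hii => hind.indepFun hii)
    have h2 : ∀ i, Var[ξ i; X.μ] = ∫ ω, ξ i ω ^ 2 ∂X.μ := fun i =>
      variance_of_integral_eq_zero (hξm i).aemeasurable (hξ0 i)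
    have h3 : (∑ i ∈ X.clusterIndex k, ξ i) = fun ω => ∑ i ∈ X.clusterIndex k, ξ i ω := by
      funext ω; simp
    have h4 : ∫ ω, ∑ i ∈ X.clusterIndex k, ξ i ω ∂X.μ = 0 := by
      rw [integral_finsetSum _ fun i _ => (hξL2 i).integrable one_le_two]
      exact Finset.sum_eq_zero fun i _ => hξ0 i
    rw [h3, variance_of_integral_eq_zero
      (Finset.measurable_fun_sum _ fun i _ => hξm i).aemeasurable h4] at h1
    simp only [h2] at h1
    rw [← h1, dotProduct_Omega_mulVec hS hL hM hr₁ hr₂, ← integral_const_mul]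
    refine integral_congr_ae (Eventually.of_forall fun ω => ?_)
    simp only
    rw [← hsum, normScore, inner_smul_right, mul_pow, hq2]
  have key := norm_integral_cexp_sum_sub_le hind hξm (X.clusterIndex k) hp hp'
    (fun i _ => hξL2 i) (fun i _ => hξ0 i) (fun i _ => hip i)
    (c := fun _ => q ^ p * ‖x‖ ^ p * C) (fun i _ => hcp i)
  simp only [hsum, hOm]
  refine key.trans ?_
  calc _ ≤ ∑ i ∈ X.clusterIndex k, (4 * (q ^ p * ‖x‖ ^ p * C) + (q ^ 2 * ‖x‖ ^ 2 * C) ^ 2) := by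
        refine Finset.sum_le_sum fun i _ => ?_
        gcongr
        exact hvar i
    _ = 4 * (‖x‖ ^ p * C) * (X.N k * q ^ p) + (‖x‖ ^ 2 * C) ^ 2 * (X.N k * (q ^ 2) ^ 2) := by
        rw [Finset.sum_const, card_clusterIndex, nsmul_eq_mul]
        ring
    _ = _ := by
        rw [hqp, hq2, sub_eq_add_neg, Real.rpow_add hN, Real.rpow_one, Real.rpow_neg_one]
        congr 2
        field_simp

/-! ### The effect of the nuisance estimators -/

/-- Change of the score of task `j` caused by the nuisance, on the realization set. -/
def scoreIncrement (X : Experiment.{u, v, w} d) (j : Fin X.m) (η : X.H j) (z : X.Obs j) : Euc d :=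
  (X.T j).indicator (fun η => X.score j η z) η - (X.T j).indicator
    (fun _ => X.score j (X.ηstar j) z) η

lemma scoreIncrement_of_mem {j : Fin X.m} {η : X.H j} (hη : η ∈ X.T j) (z : X.Obs j) :
    X.scoreIncrement j η z = X.score j η z - X.score j (X.ηstar j) z := by
  simp [scoreIncrement, hη]

lemma scoreIncrement_of_notMem {j : Fin X.m} {η : X.H j} (hη : η ∉ X.T j) (z : X.Obs j) :
    X.scoreIncrement j η z = 0 := by
  simp [scoreIncrement, hη]

lemma measurable_scoreIncrement (hS : X.Setting M δ)
    (hL : X.LossRegularity M ρ κ σ₁ σ₂ σ₃ σ₅ r₁ r₂) (hM : 0 < M) (j : Fin X.m) :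
    Measurable fun p : X.H j × X.Obs j => X.scoreIncrement j p.1 p.2 := by
  have hT : MeasurableSet (X.T j ×ˢ (Set.univ : Set (X.Obs j))) :=
    (hS.measurableSet_T j).prod MeasurableSet.univ
  have h1 := measurable_indicator_gradient (F := fun θ (p : X.H j × X.Obs j) => X.loss j θ p.1 p.2)
    hM hT (fun y hy => hS.measurable_loss j y
      (hS.closedBall_subset j (Metric.ball_subset_closedBall hy)))
    (fun p hp => by
      have := (hL.smooth_nuisance j p.1 hp.1 p.1 (right_mem_segment ℝ _ _) p.2).1
      exact this)
  have h2 : Measurable ((X.T j ×ˢ (Set.univ : Set (X.Obs j))).indicator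
      fun p => X.score j (X.ηstar j) p.2) :=
    ((measurable_score hS hL hM j).comp measurable_snd).indicator hT
  convert h1.sub h2 using 1
  funext p
  by_cases hp : p.1 ∈ X.T j
  · simp [scoreIncrement, hp, score]
  · simp [scoreIncrement, hp]

attribute [irreducible] scoreIncrement

lemma measurable_scoreIncrement_comp (hS : X.Setting M δ)
    (hL : X.LossRegularity M ρ κ σ₁ σ₂ σ₃ σ₅ r₁ r₂) (hM : 0 < M) (j : Fin X.m) {α : Type*}
    [MeasurableSpace α] {y : α → X.H j} {z : α → X.Obs j} (hy : Measurable y) (hz : Measurable z) :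
    Measurable fun a => X.scoreIncrement j (y a) (z a) :=
  (measurable_scoreIncrement hS hL hM j).comp (hy.prodMk hz)

/-- Mean of the summed score increments at a fixed nuisance. -/
lemma lintegral_sum_scoreIncrement_le (hS : X.Setting M δ)
    (hL : X.LossRegularity M ρ κ σ₁ σ₂ σ₃ σ₅ r₁ r₂) (hM : 0 < M) (hr₁ : 2 < r₁) (hr₂ : 2 < r₂)
    (j : Fin X.m) (η : X.H j) :
    ∫⁻ ω, ‖∑ i, X.scoreIncrement j η (X.Z j i ω)‖ₑ ∂X.μ ≤
      ENNReal.ofReal (X.n j * |σ₅|) * ‖η - X.ηstar j‖ₑ ^ 2 +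
        ENNReal.ofReal (2 * Real.sqrt (X.n j * |σ₅|)) * ‖η - X.ηstar j‖ₑ := by
  by_cases hη : η ∈ X.T j
  swap
  · simp [scoreIncrement_of_notMem hη]
  have hfm := measurable_scoreIncrement_comp hS hL hM j (measurable_const (a := η)) measurable_id
  have hf2 : ∫⁻ z, ‖X.scoreIncrement j η z‖ₑ ^ 2 ∂X.P j ≤
      ENNReal.ofReal (|σ₅| * ‖η - X.ηstar j‖ ^ 2) := by
    have h1 := lintegral_score_increment_sq_le hS hL hM hη (t := 1) (by simp)
    simp only [scoreIncrement_of_mem hη]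
    rw [one_smul, add_sub_cancel] at h1
    exact h1.trans (ENNReal.ofReal_le_ofReal
      (mul_le_mul_of_nonneg_right (le_abs_self _) (by positivity)))
  have he1 : ‖∫ z, X.scoreIncrement j η z ∂X.P j‖ ≤ |σ₅| * ‖η - X.ηstar j‖ ^ 2 := by
    have := norm_integral_score_increment_le hS hL hM hr₁ hr₂ hη
    simpa only [scoreIncrement_of_mem hη] using this
  have key := lintegral_enorm_sum_le_of_moments (hS.measurePreserving_sample j)
    (fun i i' hii => by
      have h1 := hS.indep_Z.indepFun (i := ⟨j, i⟩) (j := ⟨j, i'⟩) (by simpa using hii)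
      exact h1) hfm (by positivity) hf2 he1
  refine key.trans (le_of_eq ?_)
  rw [← ofReal_norm, ← ENNReal.ofReal_pow (by positivity),
    ← ENNReal.ofReal_mul (by positivity), ← ENNReal.ofReal_mul (by positivity),
    ← ENNReal.ofReal_add (by positivity) (by positivity), ← mul_assoc (X.n j : ℝ),
    Real.sqrt_mul (by positivity), Real.sqrt_sq (norm_nonneg _)]
  congr 1
  ring

lemma lintegral_enorm_le_sqrt {α F : Type*} [MeasurableSpace α] {μ : Measure α}
    [IsProbabilityMeasure μ] [SeminormedAddCommGroup F] {f : α → F}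
    (hf : AEMeasurable (fun z => ‖f z‖ₑ) μ) {v : ℝ} (hv : 0 ≤ v)
    (h : ∫⁻ z, ‖f z‖ₑ ^ 2 ∂μ ≤ ENNReal.ofReal v) :
    ∫⁻ z, ‖f z‖ₑ ∂μ ≤ ENNReal.ofReal (Real.sqrt v) := by
  have h1 := (sq_lintegral_le_lintegral_sq hf).trans h
  rw [← Real.sq_sqrt hv, ENNReal.ofReal_pow (by positivity)] at h1
  exact (ENNReal.pow_le_pow_left_iff two_ne_zero).1 h1

lemma Setting.measurable_enorm_nuisance (hS : X.Setting M δ) (j : Fin X.m) :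
    Measurable fun η : X.H j => ‖η - X.ηstar j‖ₑ := by
  have := (hS.measurable_norm j).ennreal_ofReal
  simpa only [ofReal_norm] using this

/-- Mean of the summed score increments at the estimated nuisance. -/
lemma lintegral_sum_scoreIncrement_hat_le (hS : X.Setting M δ)
    (hL : X.LossRegularity M ρ κ σ₁ σ₂ σ₃ σ₅ r₁ r₂) (hM : 0 < M) (hr₁ : 2 < r₁) (hr₂ : 2 < r₂)
    (j : Fin X.m) {V : ℝ} (hV : 0 ≤ V)
    (hmse : ∫⁻ ω, ‖X.ηhat j ω - X.ηstar j‖ₑ ^ 2 ∂X.μ ≤ ENNReal.ofReal V) :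
    ∫⁻ ω, ‖∑ i, X.scoreIncrement j (X.ηhat j ω) (X.Z j i ω)‖ₑ ∂X.μ ≤
      ENNReal.ofReal (X.n j * |σ₅| * V + 2 * Real.sqrt (X.n j * |σ₅|) * Real.sqrt V) := by
  have hen := hS.measurable_enorm_nuisance j
  have hZ : Measurable fun ω => fun i => X.Z j i ω := measurable_pi_iff.2 (hS.measurable_Z j)
  have hη := hS.measurable_ηhat j
  have hG : Measurable fun p : X.H j × (Fin (X.n j) → X.Obs j) =>
      ‖∑ i, X.scoreIncrement j p.1 (p.2 i)‖ₑ := by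
    refine Measurable.enorm (Finset.measurable_fun_sum _ fun i _ => ?_)
    exact measurable_scoreIncrement_comp hS hL hM j measurable_fst
      ((measurable_pi_apply i).comp measurable_snd)
  have h1 := lintegral_comp_of_indepFun hη hZ (hS.indep_ηhat j) hG
  refine (le_of_eq h1).trans ?_
  refine (lintegral_mono (g := fun ω' => ENNReal.ofReal (X.n j * |σ₅|) *
    ‖X.ηhat j ω' - X.ηstar j‖ₑ ^ 2 + ENNReal.ofReal (2 * Real.sqrt (X.n j * |σ₅|)) *
    ‖X.ηhat j ω' - X.ηstar j‖ₑ) fun ω' =>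
      lintegral_sum_scoreIncrement_le hS hL hM hr₁ hr₂ j (X.ηhat j ω')).trans ?_
  have he : Measurable fun ω => ‖X.ηhat j ω - X.ηstar j‖ₑ := hen.comp hη
  calc _ = ENNReal.ofReal (X.n j * |σ₅|) * ∫⁻ ω, ‖X.ηhat j ω - X.ηstar j‖ₑ ^ 2 ∂X.μ +
        ENNReal.ofReal (2 * Real.sqrt (X.n j * |σ₅|)) * ∫⁻ ω, ‖X.ηhat j ω - X.ηstar j‖ₑ ∂X.μ := by
        rw [lintegral_add_left ((he.pow_const 2).const_mul _), lintegral_const_mul _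
          (he.pow_const 2), lintegral_const_mul _ he]
    _ ≤ ENNReal.ofReal (X.n j * |σ₅|) * ENNReal.ofReal V +
        ENNReal.ofReal (2 * Real.sqrt (X.n j * |σ₅|)) * ENNReal.ofReal (Real.sqrt V) := by
        gcongr
        exact lintegral_enorm_le_sqrt (hen.comp hη).aemeasurable hV hmse
    _ = _ := by
        rw [← ENNReal.ofReal_mul (by positivity), ← ENNReal.ofReal_mul (by positivity),
          ← ENNReal.ofReal_add (by positivity) (by positivity)]

/-- Mean of the Lipschitz variables of a task times the nuisance error. -/
lemma lintegral_lipschitz_mul_nuisance_le (hS : X.Setting M δ) (j : Fin X.m)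
    {L : X.Obs j → ℝ} (hLm : Measurable L)
    (hLσ : ∫⁻ z, ENNReal.ofReal (L z) ∂X.P j ≤ ENNReal.ofReal σ₃) {V : ℝ} (hV : 0 ≤ V)
    (hmse : ∫⁻ ω, ‖X.ηhat j ω - X.ηstar j‖ₑ ^ 2 ∂X.μ ≤ ENNReal.ofReal V) :
    ∫⁻ ω, (∑ i, ENNReal.ofReal (L (X.Z j i ω))) ∂X.μ ≤ ENNReal.ofReal (X.n j * |σ₃|) ∧
    ∫⁻ ω, (∑ i, ENNReal.ofReal (L (X.Z j i ω))) * ‖X.ηhat j ω - X.ηstar j‖ₑ ∂X.μ ≤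
      ENNReal.ofReal (X.n j * |σ₃| * Real.sqrt V) := by
  have hen := hS.measurable_enorm_nuisance j
  have hZ : Measurable fun ω => fun i => X.Z j i ω := measurable_pi_iff.2 (hS.measurable_Z j)
  have hη := hS.measurable_ηhat j
  have hLs : Measurable fun z : Fin (X.n j) → X.Obs j => ∑ i, ENNReal.ofReal (L (z i)) :=
    Finset.measurable_fun_sum _ fun i _ => (hLm.comp (measurable_pi_apply i)).ennreal_ofReal
  have h1 : ∫⁻ ω, (∑ i, ENNReal.ofReal (L (X.Z j i ω))) ∂X.μ ≤ ENNReal.ofReal (X.n j * |σ₃|) := by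
    rw [lintegral_finsetSum (f := fun i ω => ENNReal.ofReal (L (X.Z j i ω))) _
      fun i _ => (hLm.comp (hS.measurable_Z j i)).ennreal_ofReal]
    calc _ ≤ ∑ i : Fin (X.n j), ENNReal.ofReal |σ₃| := by
          refine Finset.sum_le_sum fun i _ => ?_
          rw [hS.lintegral_sample j i hLm.ennreal_ofReal]
          exact hLσ.trans (ENNReal.ofReal_le_ofReal (le_abs_self _))
      _ = _ := by
          rw [Finset.sum_const, nsmul_eq_mul, ENNReal.ofReal_mul (by positivity)]
          simp
  refine ⟨h1, ?_⟩
  have hind : IndepFun (fun ω => ∑ i, ENNReal.ofReal (L (X.Z j i ω)))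
      (fun ω => ‖X.ηhat j ω - X.ηstar j‖ₑ) X.μ :=
    ((hS.indep_ηhat j).comp hen hLs).symm
  have h2 := lintegral_mul_eq_lintegral_mul_lintegral_of_indepFun (hLs.comp hZ) (hen.comp hη) hind
  refine (le_of_eq h2).trans ?_
  rw [ENNReal.ofReal_mul (by positivity)]
  exact mul_le_mul' h1 (lintegral_enorm_le_sqrt (hen.comp hη).aemeasurable hV hmse)

end Experiment
end

noncomputable section

namespace Experiment

variable {d : ℕ} {X : Experiment.{u, v, w} d} {M δ ρ κ σ₁ σ₂ σ₃ σ₅ r₁ r₂ : ℝ}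

/-- The gradient of the empirical loss of a task at the estimated nuisance. -/
def taskGradient (X : Experiment.{u, v, w} d) (ω : X.Ω) (j : Fin X.m) (θ : Euc d) : Euc d :=
  gradient (fun ϑ => X.empLoss j ϑ (X.ηhat j ω) ω) θ

/-- The effect of the estimated nuisance on the score sum of a task. -/
def nuisanceEffect (X : Experiment.{u, v, w} d) (j : Fin X.m) (ω : X.Ω) : Euc d :=
  ∑ i, X.scoreIncrement j (X.ηhat j ω) (X.Z j i ω)

/-- Realizations for which the nuisance estimators are close to the truth, and on the balls of
radius `r` the gradients of the empirical losses are linear up to a small multiple `ν`. -/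
structure Linearizable (X : Experiment.{u, v, w} d) (M ν r : ℝ) (ω : X.Ω) : Prop where
  nuisance : ∀ j, X.ηhat j ω ∈ Metric.closedBall (X.ηstar j) M
  mem_T : ∀ j, X.ηhat j ω ∈ X.T j
  linear : ∀ j, ∀ θ ∈ Metric.closedBall (X.θstar j) r, ∀ θ' ∈ Metric.closedBall (X.θstar j) r,
    ‖X.taskGradient ω j θ - X.taskGradient ω j θ' -
      (X.n j : ℝ) • X.popHessian j (X.θstar j) (θ - θ')‖ ≤ ν * X.n j * ‖θ - θ'‖

section Smooth

variable (hL : X.LossRegularity M ρ κ σ₁ σ₂ σ₃ σ₅ r₁ r₂) {ω : X.Ω} {j : Fin X.m}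
  (hη : X.ηhat j ω ∈ Metric.closedBall (X.ηstar j) M)

include hL hη

lemma taskGradient_eq {θ : Euc d} (hθ : θ ∈ Metric.closedBall (X.θstar j) M) :
    X.taskGradient ω j θ = ∑ i, gradient (fun ϑ => X.loss j ϑ (X.ηhat j ω) (X.Z j i ω)) θ :=
  gradient_fun_sum fun _ _ => (hL.smooth j _ hη _ θ hθ).differentiableAt

lemma hasGradientAt_empLoss {θ : Euc d} (hθ : θ ∈ Metric.closedBall (X.θstar j) M) :
    HasGradientAt (fun ϑ => X.empLoss j ϑ (X.ηhat j ω) ω) (X.taskGradient ω j θ) θ :=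
  (TwiceDifferentiableAt.fun_sum fun _ _ => hL.smooth j _ hη _ θ hθ).hasGradientAt

lemma hasFDerivAt_taskGradient {θ : Euc d} (hθ : θ ∈ Metric.closedBall (X.θstar j) M) :
    HasFDerivAt (X.taskGradient ω j)
      (∑ i, hessian (fun ϑ => X.loss j ϑ (X.ηhat j ω) (X.Z j i ω)) θ) θ := by
  have h := (TwiceDifferentiableAt.fun_sum (s := Finset.univ) fun i _ =>
    hL.smooth j _ hη (X.Z j i ω) θ hθ).hasFDerivAt_gradient
  rwa [hessian_fun_sum fun i _ => hL.smooth j _ hη (X.Z j i ω) θ hθ] at h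

lemma convexOn_empLoss (hS : X.Setting M δ) :
    ConvexOn ℝ X.Θ fun θ => X.empLoss j θ (X.ηhat j ω) ω := by
  unfold empLoss
  have : ∀ s : Finset (Fin (X.n j)),
      ConvexOn ℝ X.Θ fun θ => ∑ i ∈ s, X.loss j θ (X.ηhat j ω) (X.Z j i ω) := fun s => by
    classical
    induction s using Finset.induction_on with
    | empty => simpa using convexOn_const 0 hS.convex_Θ
    | insert i s hi ih =>
      simp only [Finset.sum_insert hi]
      exact (hL.convex j _ hη _).add ih
  exact this _

lemma taskGradient_θstar (hM : 0 < M) (hT : X.ηhat j ω ∈ X.T j) :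
    X.taskGradient ω j (X.θstar j) = X.taskScore j ω + X.nuisanceEffect j ω := by
  rw [taskGradient_eq hL hη (Metric.mem_closedBall_self hM.le), taskScore, nuisanceEffect,
    ← Finset.sum_add_distrib]
  refine Finset.sum_congr rfl fun i _ => ?_
  rw [scoreIncrement_of_mem hT, add_sub_cancel]
  rfl

lemma taskGradient_linear (hM : 0 < M) {r ν : ℝ} (hrM : r ≤ M) {L : Fin (X.n j) → ℝ}
    (hL0 : ∀ i, 0 ≤ L i) (hLip : ∀ i, X.HessianLipschitzAt M j (L i) (X.Z j i ω))
    (hdev : ‖∑ i, X.hessianDeviation j (X.Z j i ω)‖ ≤ ν / 3 * X.n j)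
    (hnui : (∑ i, L i) * ‖X.ηhat j ω - X.ηstar j‖ ≤ ν / 3 * X.n j)
    (hrad : (∑ i, L i) * r ≤ ν / 3 * X.n j) {θ θ' : Euc d}
    (hθ : θ ∈ Metric.closedBall (X.θstar j) r) (hθ' : θ' ∈ Metric.closedBall (X.θstar j) r) :
    ‖X.taskGradient ω j θ - X.taskGradient ω j θ' -
      (X.n j : ℝ) • X.popHessian j (X.θstar j) (θ - θ')‖ ≤ ν * X.n j * ‖θ - θ'‖ := by
  have hsub := Metric.closedBall_subset_closedBall (x := X.θstar j) hrM
  refine (convex_closedBall (X.θstar j) r).norm_image_sub_le_of_norm_hasFDerivWithin_le'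
    (φ := (X.n j : ℝ) • X.popHessian j (X.θstar j))
    (fun θ hθ => (hasFDerivAt_taskGradient hL hη (hsub hθ)).hasFDerivWithinAt)
    (fun θ hθ => ?_) hθ' hθ
  have h1 : ∑ i, hessian (fun ϑ => X.loss j ϑ (X.ηhat j ω) (X.Z j i ω)) θ -
      (X.n j : ℝ) • X.popHessian j (X.θstar j) =
      ∑ i, (hessian (fun ϑ => X.loss j ϑ (X.ηhat j ω) (X.Z j i ω)) θ -
        X.lossHessian j (X.Z j i ω)) + ∑ i, X.hessianDeviation j (X.Z j i ω) := by
    simp only [hessianDeviation, Finset.sum_sub_distrib, Finset.sum_const, Finset.card_univ,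
      Fintype.card_fin]
    have e : (X.n j : ℝ) • X.popHessian j (X.θstar j) = X.n j • X.popHessian j (X.θstar j) := by
      ext1 v
      simp only [smul_apply]
      exact Nat.cast_smul_eq_nsmul ℝ _ _
    rw [e]
    abel
  rw [h1]
  have hr : ‖θ - X.θstar j‖ ≤ r := by simpa [dist_eq_norm] using hθ
  have h2 : ‖∑ i, (hessian (fun ϑ => X.loss j ϑ (X.ηhat j ω) (X.Z j i ω)) θ -
        X.lossHessian j (X.Z j i ω))‖ ≤ (∑ i, L i) * r + (∑ i, L i) * ‖X.ηhat j ω - X.ηstar j‖ := by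
    refine (norm_sum_le _ _).trans ?_
    rw [← mul_add, Finset.sum_mul]
    refine Finset.sum_le_sum fun i _ => ?_
    refine (hLip i θ (hsub hθ) _ (Metric.mem_closedBall_self hM.le) _ hη _
      (Metric.mem_closedBall_self hM.le)).trans ?_
    exact mul_le_mul_of_nonneg_left (by linarith) (hL0 i)
  refine (norm_add_le _ _).trans ?_
  linarith

end Smooth

lemma sum_taskGradient_β {ω : X.Ω} (k : Fin X.K)
    (hL : X.LossRegularity M ρ κ σ₁ σ₂ σ₃ σ₅ r₁ r₂) {ν r : ℝ} (hM : 0 < M)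
    (h : X.Linearizable M ν r ω) :
    ∑ j with X.cluster j = k, X.taskGradient ω j (X.β k) =
      X.scoreSum k ω + ∑ j with X.cluster j = k, X.nuisanceEffect j ω := by
  rw [scoreSum, ← Finset.sum_add_distrib]
  refine Finset.sum_congr rfl fun j hj => ?_
  have hj' : X.β k = X.θstar j := by rw [θstar, (Finset.mem_filter.1 hj).2]
  rw [hj', taskGradient_θstar hL (h.nuisance j) hM (h.mem_T j)]

section Deterministic

variable (hS : X.Setting M δ) (hL : X.LossRegularity M ρ κ σ₁ σ₂ σ₃ σ₅ r₁ r₂) {ω : X.Ω} {ν r : ℝ}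
  (h : X.Linearizable M ν r ω)

include hL h

lemma Linearizable.mono_gradient (hM : 0 < M) (hν : ν ≤ ρ / 2) (j : Fin X.m) {z z' : Euc d}
    (hz : z ∈ Metric.closedBall (X.θstar j) r) (hz' : z' ∈ Metric.closedBall (X.θstar j) r) :
    ρ / 2 * X.n j * ‖z - z'‖ ^ 2 ≤
      inner ℝ (X.taskGradient ω j z - X.taskGradient ω j z') (z - z') := by
  have h1 := h.linear j z hz z' hz'
  set e := X.taskGradient ω j z - X.taskGradient ω j z' -
      (X.n j : ℝ) • X.popHessian j (X.θstar j) (z - z') with he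
  have h2 : X.taskGradient ω j z - X.taskGradient ω j z' =
      (X.n j : ℝ) • X.popHessian j (X.θstar j) (z - z') + e := by rw [he]; abel
  have hn : (0 : ℝ) ≤ X.n j := by positivity
  have h3 := (hL.curvature j _ (Metric.mem_closedBall_self hM.le) (z - z')).1
  have h4 : -(ν * X.n j * ‖z - z'‖ ^ 2) ≤ inner ℝ e (z - z') := by
    have := abs_le.1 (abs_real_inner_le_norm e (z - z'))
    have h5 := mul_le_mul_of_nonneg_right h1 (norm_nonneg (z - z'))
    nlinarith
  rw [h2, inner_add_left, real_inner_smul_left, real_inner_comm]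
  have h6 := mul_le_mul_of_nonneg_left h3 hn
  have h7 : ν * (X.n j * ‖z - z'‖ ^ 2) ≤ ρ / 2 * (X.n j * ‖z - z'‖ ^ 2) :=
    mul_le_mul_of_nonneg_right hν (by positivity)
  nlinarith

include hS

lemma Linearizable.norm_gradient_le (hM : 0 < M) (hρ : 0 < ρ) (hr₁ : 2 < r₁) (hr₂ : 2 < r₂)
    (hν0 : 0 ≤ ν) (hr0 : 0 ≤ r) (j : Fin X.m) {z : Euc d}
    (hz : z ∈ Metric.closedBall (X.θstar j) r) :
    ‖X.taskGradient ω j z‖ ≤ ‖X.taskScore j ω‖ + ‖X.nuisanceEffect j ω‖ +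
      (|κ| + ν) * r * X.n j := by
  have h1 := h.linear j z hz _ (Metric.mem_closedBall_self hr0)
  rw [taskGradient_θstar hL (h.nuisance j) hM (h.mem_T j)] at h1
  have hzr : ‖z - X.θstar j‖ ≤ r := by simpa [dist_eq_norm] using hz
  have h2 : ‖(X.n j : ℝ) • X.popHessian j (X.θstar j) (z - X.θstar j)‖ ≤ X.n j * (|κ| * r) := by
    rw [norm_smul, Real.norm_of_nonneg (Nat.cast_nonneg _)]
    refine mul_le_mul_of_nonneg_left ?_ (by positivity)
    exact ((X.popHessian j (X.θstar j)).le_opNorm _).trans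
      (mul_le_mul (norm_popHessian_le hS hL hρ hM hr₁ hr₂ j) hzr (norm_nonneg _) (abs_nonneg _))
  have h3 : ν * X.n j * ‖z - X.θstar j‖ ≤ ν * X.n j * r := by gcongr
  set A := X.taskGradient ω j z
  set B := X.taskScore j ω
  set C := X.nuisanceEffect j ω
  set D := (X.n j : ℝ) • X.popHessian j (X.θstar j) (z - X.θstar j)
  have h4 : A = (A - (B + C) - D) + B + C + D := by abel
  have h5 : ‖A‖ ≤ ‖A - (B + C) - D‖ + ‖B‖ + ‖C‖ + ‖D‖ := by
    conv_lhs => rw [h4]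
    exact norm_add₄_le
  nlinarith

/-- A near-stationary point of the pooled loss of a cluster is approximately linear in the
normalized score. -/
lemma Linearizable.remainder_le (hM : 0 < M) (hρ : 0 < ρ) (hν0 : 0 ≤ ν) (hν : ν ≤ ρ / 2)
    (hr0 : 0 ≤ r) (k : Fin X.K) {b : Euc d} (hb : b ∈ Metric.closedBall (X.β k) r) {q D : ℝ}
    (hq : ‖∑ j with X.cluster j = k, X.taskGradient ω j b‖ ≤ q)
    (hD : ∑ j with X.cluster j = k, ‖X.nuisanceEffect j ω‖ ≤ D) :
    ‖X.normScore k ω + X.psiOp k (Real.sqrt (X.N k) • (b - X.β k))‖ ≤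
      ν * (2 / ρ * (‖X.normScore k ω‖ + (q + D) / Real.sqrt (X.N k))) +
        (q + D) / Real.sqrt (X.N k) := by
  have hN : (0 : ℝ) < X.N k := by exact_mod_cast N_pos hS k
  set s := Real.sqrt (X.N k) with hs
  have hs0 : 0 < s := Real.sqrt_pos.2 hN
  have hss : s * s = X.N k := Real.mul_self_sqrt hN.le
  set G := X.scoreSum k ω
  set y := b - X.β k with hy
  have hsum := sum_taskGradient_β k hL hM h
  -- pooled linearization
  have h1 : ‖∑ j with X.cluster j = k, X.taskGradient ω j b -
      ∑ j with X.cluster j = k, X.taskGradient ω j (X.β k) - (X.N k : ℝ) • X.psiOp k y‖ ≤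
      ν * X.N k * ‖y‖ := by
    have e1 : (X.N k : ℝ) • X.psiOp k y =
        ∑ j with X.cluster j = k, (X.n j : ℝ) • X.popHessian j (X.θstar j) y := by
      simp only [psiOp, smul_apply, sum_apply]
      rw [smul_smul, mul_inv_cancel₀ hN.ne', one_smul]
    have e2 : (X.N k : ℝ) = ∑ j with X.cluster j = k, (X.n j : ℝ) := by simp [N]
    rw [e1, ← Finset.sum_sub_distrib, ← Finset.sum_sub_distrib, e2, Finset.mul_sum, Finset.sum_mul]
    refine (norm_sum_le _ _).trans (Finset.sum_le_sum fun j hj => ?_)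
    have hj' : X.β k = X.θstar j := by rw [θstar, (Finset.mem_filter.1 hj).2]
    rw [hy, hj']
    exact h.linear j b (hj' ▸ hb) _ (Metric.mem_closedBall_self hr0)
  have hR : ‖G + (X.N k : ℝ) • X.psiOp k y‖ ≤ ν * X.N k * ‖y‖ + (q + D) := by
    have hDs : ‖∑ j with X.cluster j = k, X.nuisanceEffect j ω‖ ≤ D := (norm_sum_le _ _).trans hD
    rw [hsum] at h1
    set A := ∑ j with X.cluster j = k, X.taskGradient ω j b
    set C := ∑ j with X.cluster j = k, X.nuisanceEffect j ω
    have e : G + (X.N k : ℝ) • X.psiOp k y =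
      -(A - (G + C) - (X.N k : ℝ) • X.psiOp k y) + (A - C) := by abel
    rw [e]
    refine (norm_add_le _ _).trans ?_
    rw [norm_neg]
    have := norm_sub_le A C
    linarith
  have hRs : X.normScore k ω + X.psiOp k (s • y) = s⁻¹ • (G + (X.N k : ℝ) • X.psiOp k y) := by
    rw [smul_add, smul_smul, ← hss, ← mul_assoc, inv_mul_cancel₀ hs0.ne', one_mul, map_smul]
    rfl
  have hR' : ‖X.normScore k ω + X.psiOp k (s • y)‖ ≤ ν * ‖s • y‖ + (q + D) / s := by
    rw [hRs, norm_smul, norm_smul, norm_inv, Real.norm_of_nonneg hs0.le]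
    calc s⁻¹ * ‖G + (X.N k : ℝ) • X.psiOp k y‖ ≤ s⁻¹ * (ν * (s * s) * ‖y‖ + (q + D)) := by
          rw [hss]; gcongr
      _ = _ := by field_simp
  have hlow := le_inner_psiOp hS hL hM k (s • y)
  have hyb : ‖s • y‖ ≤ 2 / ρ * (‖X.normScore k ω‖ + (q + D) / s) := by
    have a1 : inner ℝ (s • y) (X.psiOp k (s • y)) ≤ ‖s • y‖ * ‖X.psiOp k (s • y)‖ :=
      real_inner_le_norm _ _
    have a2 : ‖X.psiOp k (s • y)‖ ≤
        ‖X.normScore k ω + X.psiOp k (s • y)‖ + ‖X.normScore k ω‖ := by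
      have := norm_sub_le (X.normScore k ω + X.psiOp k (s • y)) (X.normScore k ω)
      rwa [add_sub_cancel_left] at this
    rcases (norm_nonneg (s • y)).eq_or_lt with h0 | h0
    · rw [← h0]
      have : 0 ≤ q := (norm_nonneg _).trans hq
      have : 0 ≤ D := (Finset.sum_nonneg fun _ _ => norm_nonneg _).trans hD
      positivity
    · have a3 : ρ * ‖s • y‖ ≤ ‖X.psiOp k (s • y)‖ := by
        have := hlow.trans a1
        rw [pow_two, ← mul_assoc, mul_comm _ ‖X.psiOp k (s • y)‖] at this
        exact le_of_mul_le_mul_right this h0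
      have a4 : ν * ‖s • y‖ ≤ ρ / 2 * ‖s • y‖ := by gcongr
      rw [div_mul_eq_mul_div, le_div_iff₀ hρ]
      linarith
  exact hR'.trans (by gcongr)

end Deterministic

end Experiment
end

noncomputable section

namespace Experiment

variable {d : ℕ} {X : Experiment.{u, v, w} d} {M δ ρ κ σ₁ σ₂ σ₃ σ₅ r₁ r₂ : ℝ}

lemma coe_add_coe_ofReal {a b : ℝ} (hb : 0 ≤ b) :
    ((a : ℝ) : EReal) + ((ENNReal.ofReal b : ℝ≥0∞) : EReal) = ((a + b : ℝ) : EReal) := by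
  rw [EReal.coe_ennreal_ofReal, max_eq_left hb, EReal.coe_add]

/-- The real objective with fixed penalties. -/
def fixedObjective (X : Experiment.{u, v, w} d) (Λ ε : ℝ) (ω : X.Ω) (ϑ : Fin X.m → Euc d) : ℝ :=
  fusionObjective (fun j θ => X.empLoss j θ (X.ηhat j ω) ω)
    (fun j j' => if X.cluster j = X.cluster j' then Λ else ε) ϑ

section Penalty

variable {cw γ τ ε Λ : ℝ} {ω : X.Ω} (hε : 0 ≤ ε) (hΛ : 0 ≤ Λ)
  (hsame : ∀ j j', X.cluster j = X.cluster j' → ENNReal.ofReal Λ ≤ X.penalty cw γ τ ε j j' ω)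
  (hdiff : ∀ j j', X.cluster j ≠ X.cluster j' → X.penalty cw γ τ ε j j' ω = ENNReal.ofReal ε)

include hε hΛ

lemma ofReal_sum_penalty (ϑ : Fin X.m → Euc d) :
    ENNReal.ofReal (∑ j, ∑ j' with j' < j,
      (if X.cluster j = X.cluster j' then Λ else ε) * ‖ϑ j - ϑ j'‖) =
    ∑ j, ∑ j' with j' < j,
      ENNReal.ofReal (if X.cluster j = X.cluster j' then Λ else ε) * ‖ϑ j - ϑ j'‖ₑ := by
  have h0 : ∀ j j' : Fin X.m, 0 ≤ if X.cluster j = X.cluster j' then Λ else ε := fun j j' => by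
    split_ifs <;> assumption
  rw [ENNReal.ofReal_sum_of_nonneg fun j _ => Finset.sum_nonneg fun j' _ =>
    mul_nonneg (h0 j j') (norm_nonneg _)]
  refine Finset.sum_congr rfl fun j _ => ?_
  rw [ENNReal.ofReal_sum_of_nonneg fun j' _ => mul_nonneg (h0 j j') (norm_nonneg _)]
  refine Finset.sum_congr rfl fun j' _ => ?_
  rw [ENNReal.ofReal_mul (h0 j j'), ofReal_norm]

lemma sum_penalty_nonneg (ϑ : Fin X.m → Euc d) :
    0 ≤ ∑ j, ∑ j' with j' < j,
      (if X.cluster j = X.cluster j' then Λ else ε) * ‖ϑ j - ϑ j'‖ :=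
  Finset.sum_nonneg fun j _ => Finset.sum_nonneg fun j' _ =>
    mul_nonneg (by split_ifs <;> assumption) (norm_nonneg _)

include hdiff

lemma objective_fused (b : Fin X.K → Euc d) :
    X.objective cw γ τ ε ω (fun j => b (X.cluster j)) =
      ((X.fixedObjective Λ ε ω fun j => b (X.cluster j) : ℝ) : EReal) := by
  rw [fixedObjective, fusionObjective, objective,
    ← coe_add_coe_ofReal (sum_penalty_nonneg hε hΛ _), ofReal_sum_penalty hε hΛ]
  congr 2
  refine Finset.sum_congr rfl fun j _ => Finset.sum_congr rfl fun j' _ => ?_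
  split_ifs with hc
  · simp [hc]
  · rw [hdiff j j' hc]

include hsame

lemma fixedObjective_le_objective (ϑ : Fin X.m → Euc d) :
    ((X.fixedObjective Λ ε ω ϑ : ℝ) : EReal) ≤ X.objective cw γ τ ε ω ϑ := by
  rw [fixedObjective, fusionObjective, objective,
    ← coe_add_coe_ofReal (sum_penalty_nonneg hε hΛ ϑ), ofReal_sum_penalty hε hΛ]
  refine add_le_add le_rfl (EReal.coe_ennreal_le_coe_ennreal_iff.2 ?_)
  refine Finset.sum_le_sum fun j _ => Finset.sum_le_sum fun j' _ => ?_
  gcongr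
  split_ifs with hc
  · exact hsame j j' hc
  · exact (hdiff j j' hc).ge

end Penalty

section Fusion

variable (hS : X.Setting M δ) (hL : X.LossRegularity M ρ κ σ₁ σ₂ σ₃ σ₅ r₁ r₂) {ω : X.Ω} {ν r : ℝ}
  (h : X.Linearizable M ν r ω) (hM : 0 < M) (hρ : 0 < ρ) (hν0 : 0 ≤ ν) (hν : ν ≤ ρ / 2)
  (hr0 : 0 < r) (hrM : r ≤ M)

include hS hL h hM hρ hν0 hν hr0 hrM

/-- On well-behaved realizations the fusion estimator recovers the clusters, and it is a
near-stationary point of the pooled loss of each of them. -/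
lemma Linearizable.fusion_estimator (hr₁ : 2 < r₁) (hr₂ : 2 < r₂) (hrδ : 2 * r < δ)
    {cw γ τ ε Λ : ℝ} (hε : 0 ≤ ε) (hΛ : 0 ≤ Λ)
    (hsame : ∀ j j', X.cluster j = X.cluster j' → ENNReal.ofReal Λ ≤ X.penalty cw γ τ ε j j' ω)
    (hdiff : ∀ j j', X.cluster j ≠ X.cluster j' → X.penalty cw γ τ ε j j' ω = ENNReal.ofReal ε)
    (hsmall : ∀ k, ‖X.scoreSum k ω‖ + ∑ j with X.cluster j = k, ‖X.nuisanceEffect j ω‖ +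
      ε * X.m * X.clusterSize k < r * (ρ / 2) * X.N k)
    (hbig : ∀ j, ‖X.taskScore j ω‖ + ‖X.nuisanceEffect j ω‖ + (|κ| + ν) * r * X.n j + ε * X.m ≤ Λ)
    {ϑ : Fin X.m → Euc d}
    (hmin : (argminOn (X.objective cw γ τ ε ω) {ϑ | ∀ j, ϑ j ∈ X.Θ}).Nonempty →
      ϑ ∈ argminOn (X.objective cw γ τ ε ω) {ϑ | ∀ j, ϑ j ∈ X.Θ}) (j : Fin X.m) :
    ϑ j ∈ Metric.closedBall (X.θstar j) r ∧
      ‖∑ i with X.cluster i = X.cluster j, X.taskGradient ω i (ϑ j)‖ ≤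
        ε * X.m * X.clusterSize (X.cluster j) := by
  have hsep : ∀ k k', k ≠ k' → 2 * r < ‖X.β k - X.β k'‖ := fun k k' hk =>
    hrδ.trans_le (hS.separation k k' hk)
  have hsub : ∀ j, Metric.closedBall (X.θstar j) r ⊆ Metric.closedBall (X.θstar j) M := fun j =>
    Metric.closedBall_subset_closedBall hrM
  have hg : ∀ j, ∀ z ∈ Metric.closedBall (X.β (X.cluster j)) r,
      HasGradientAt (fun ϑ => X.empLoss j ϑ (X.ηhat j ω) ω) (X.taskGradient ω j z) z :=
    fun j z hz => hasGradientAt_empLoss hL (h.nuisance j) (hsub j hz)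
  have hmono : ∀ j, ∀ z ∈ Metric.closedBall (X.β (X.cluster j)) r,
      ∀ z' ∈ Metric.closedBall (X.β (X.cluster j)) r, ρ / 2 * X.n j * ‖z - z'‖ ^ 2 ≤
      inner ℝ (X.taskGradient ω j z - X.taskGradient ω j z') (z - z') :=
    fun j z hz z' hz' => h.mono_gradient hL hM hν j hz hz'
  have hsm : ∀ k, ‖∑ j with X.cluster j = k, X.taskGradient ω j (X.β k)‖ +
      ε * X.m * (Finset.univ.filter fun j => X.cluster j = k).card <
      r * ∑ j with X.cluster j = k, ρ / 2 * (X.n j : ℝ) := fun k => by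
    have e2 : (X.N k : ℝ) = ∑ j with X.cluster j = k, (X.n j : ℝ) := by simp [N]
    rw [← Finset.mul_sum, ← e2, sum_taskGradient_β k hL hM h, ← mul_assoc]
    have := norm_add_le (X.scoreSum k ω) (∑ j with X.cluster j = k, X.nuisanceEffect j ω)
    have := norm_sum_le (Finset.univ.filter fun j => X.cluster j = k)
      fun j => X.nuisanceEffect j ω
    have h3 := hsmall k
    rw [clusterSize] at h3
    linarith
  obtain ⟨b, hb, hstat⟩ := exists_fused_minimizer X.cluster X.β (Λ := Λ) hr0 hε hsep hg hmono hsm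
  have hbΘ : ∀ j, b (X.cluster j) ∈ X.Θ := fun j =>
    hS.closedBall_subset j (hsub j (Metric.ball_subset_closedBall (hb _)))
  have huniq : ∀ ϑ : Fin X.m → Euc d, (∀ j, ϑ j ∈ X.Θ) → (ϑ ≠ fun j => b (X.cluster j)) →
      X.fixedObjective Λ ε ω (fun j => b (X.cluster j)) < X.fixedObjective Λ ε ω ϑ :=
    fun ϑ hϑ hne => fused_unique_minimizer X.cluster X.β hε hsep
      (fun j => (hsub j).trans (hS.closedBall_subset j))
      (fun j => convexOn_empLoss hL (h.nuisance j) hS) hg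
      (fun j => mul_pos (half_pos hρ) (by exact_mod_cast hS.n_pos j)) hmono
      (fun j z hz => (by
        have := h.norm_gradient_le hS hL hM hρ hr₁ hr₂ hν0 hr0.le j hz
        linarith [hbig j])) hb hstat hϑ hne
  have hmem : (fun j => b (X.cluster j)) ∈
      argminOn (X.objective cw γ τ ε ω) {ϑ | ∀ j, ϑ j ∈ X.Θ} := by
    refine ⟨hbΘ, fun ϑ hϑ => ?_⟩
    rw [objective_fused hε hΛ hdiff]
    refine le_trans (EReal.coe_le_coe_iff.2 ?_) (fixedObjective_le_objective hε hΛ hsame hdiff ϑ)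
    by_cases hne : ϑ = fun j => b (X.cluster j)
    · rw [hne]
    · exact (huniq ϑ hϑ hne).le
  have hϑ := hmin ⟨_, hmem⟩
  have hϑb : ϑ = fun j => b (X.cluster j) := by
    by_contra hne
    have h1 := hϑ.2 _ hbΘ
    rw [objective_fused hε hΛ hdiff] at h1
    have h2 := (fixedObjective_le_objective hε hΛ hsame hdiff ϑ).trans h1
    exact absurd (EReal.coe_le_coe_iff.1 h2) (not_le.2 (huniq ϑ hϑ.1 hne))
  subst hϑb
  refine ⟨Metric.ball_subset_closedBall (hb _), ?_⟩
  have h1 := hstat (X.cluster j)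
  simp only [fusionGradient] at h1
  rw [Finset.sum_add_distrib] at h1
  have h2 : ∑ i with X.cluster i = X.cluster j, X.taskGradient ω i (b (X.cluster j)) =
      ∑ i with X.cluster i = X.cluster j, X.taskGradient ω i (b (X.cluster i)) :=
    Finset.sum_congr rfl fun i hi => by rw [(Finset.mem_filter.1 hi).2]
  rw [h2, eq_neg_of_add_eq_zero_left h1, norm_neg, clusterSize]
  refine (norm_sum_le _ _).trans ?_
  refine (Finset.sum_le_card_nsmul _ _ (ε * X.m) fun i _ => ?_).trans ?_
  · rw [norm_smul, Real.norm_of_nonneg hε]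
    exact mul_le_mul_of_nonneg_left (norm_sum_fusionDirection_le _ _ _) hε
  · rw [nsmul_eq_mul, mul_comm]

/-- On well-behaved realizations the oracle estimator is a stationary point. -/
lemma Linearizable.oracle_estimator (hr₁ : 2 < r₁) (hr₂ : 2 < r₂) (k : Fin X.K)
    (hsmall : ‖X.scoreSum k ω‖ + ∑ j with X.cluster j = k, ‖X.nuisanceEffect j ω‖ <
      r * (ρ / 2) * X.N k) {ϑ : Euc d}
    (hmin : (argminOn (fun θ => X.clusterLoss k θ (fun j => X.ηhat j ω) ω) X.Θ).Nonempty →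
      ϑ ∈ argminOn (fun θ => X.clusterLoss k θ (fun j => X.ηhat j ω) ω) X.Θ) :
    ϑ ∈ Metric.closedBall (X.β k) r ∧
      ‖∑ j with X.cluster j = k, X.taskGradient ω j ϑ‖ ≤ 0 := by
  have hk : ∀ {j}, j ∈ Finset.univ.filter (fun j => X.cluster j = k) → X.θstar j = X.β k :=
    fun {j} hj => by rw [θstar, (Finset.mem_filter.1 hj).2]
  have e2 : (X.N k : ℝ) = ∑ j with X.cluster j = k, (X.n j : ℝ) := by simp [N]
  have hsub : ∀ j, Metric.closedBall (X.θstar j) r ⊆ Metric.closedBall (X.θstar j) M := fun j =>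
    Metric.closedBall_subset_closedBall hrM
  have hN : (0 : ℝ) < X.N k := by exact_mod_cast N_pos hS k
  set f : Fin 1 → Euc d → ℝ := fun _ θ => X.clusterLoss k θ (fun j => X.ηhat j ω) ω with hf
  set g : Fin 1 → Euc d → Euc d := fun _ θ => ∑ j with X.cluster j = k, X.taskGradient ω j θ with hgd
  have hg : ∀ j, ∀ z ∈ Metric.closedBall (X.β k) r, HasGradientAt (f j) (g j z) z :=
    fun _ z hz => HasGradientAt.fun_sum fun j hj =>
      hasGradientAt_empLoss hL (h.nuisance j) (hsub j (by rwa [hk hj]))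
  have hmono : ∀ j, ∀ z ∈ Metric.closedBall (X.β k) r, ∀ z' ∈ Metric.closedBall (X.β k) r,
      ρ / 2 * X.N k * ‖z - z'‖ ^ 2 ≤ inner ℝ (g j z - g j z') (z - z') := fun _ z hz z' hz' => by
    simp only [hgd]
    rw [← Finset.sum_sub_distrib, sum_inner, e2, Finset.mul_sum, Finset.sum_mul]
    exact Finset.sum_le_sum fun j hj =>
      h.mono_gradient hL hM hν j (by rwa [hk hj]) (by rwa [hk hj])
  have hsep : ∀ a a' : Fin 1, a ≠ a' → 2 * r < ‖X.β k - X.β k‖ := fun a a' haa =>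
    absurd (Subsingleton.elim a a') haa
  obtain ⟨j₀, hj₀⟩ := hS.cluster_surjective k
  have hΘ : Metric.closedBall (X.β k) r ⊆ X.Θ := by
    have := (hsub j₀).trans (hS.closedBall_subset j₀)
    rwa [θstar, hj₀] at this
  have hsm : ∀ a : Fin 1, ‖∑ j : Fin 1 with (fun _ => (0 : Fin 1)) j = a, g j (X.β k)‖ +
      0 * ((1 : ℕ) : ℝ) * (Finset.univ.filter fun j : Fin 1 => (fun _ => (0 : Fin 1)) j = a).card <
      r * ∑ j : Fin 1 with (fun _ => (0 : Fin 1)) j = a, ρ / 2 * (X.N k : ℝ) := fun a => by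
    have ha : (Finset.univ.filter fun j : Fin 1 => (fun _ => (0 : Fin 1)) j = a) = Finset.univ := by
      ext j; simp [Subsingleton.elim a 0]
    rw [ha]
    simp only [Finset.univ_unique, Finset.sum_singleton, hgd]
    rw [sum_taskGradient_β k hL hM h]
    have := norm_add_le (X.scoreSum k ω) (∑ j with X.cluster j = k, X.nuisanceEffect j ω)
    have := norm_sum_le (Finset.univ.filter fun j => X.cluster j = k)
      fun j => X.nuisanceEffect j ω
    linarith
  obtain ⟨b, hb, hstat⟩ := exists_fused_minimizer (fun _ : Fin 1 => (0 : Fin 1))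
    (fun _ => X.β k) (Λ := 0) hr0 le_rfl hsep hg (a := fun _ => ρ / 2 * (X.N k : ℝ)) hmono hsm
  set Λ := ∑ j with X.cluster j = k, (‖X.taskScore j ω‖ + ‖X.nuisanceEffect j ω‖ +
      (|κ| + ν) * r * X.n j) with hΛ
  have hb0 : b 0 ∈ Metric.closedBall (X.β k) r := Metric.ball_subset_closedBall (hb 0)
  have huniq : ∀ θ ∈ X.Θ, θ ≠ b 0 → f 0 (b 0) < f 0 θ := fun θ hθ hne => by
    have := fused_unique_minimizer (fun _ : Fin 1 => (0 : Fin 1)) (fun _ => X.β k) (Λ := Λ) le_rfl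
      hsep (fun _ => hΘ) (f := f) (g := g) (fun _ => by
        have : ∀ s : Finset (Fin X.m),
            ConvexOn ℝ X.Θ fun θ => ∑ j ∈ s, X.empLoss j θ (X.ηhat j ω) ω := fun s => by
          classical
          induction s using Finset.induction_on with
          | empty => simpa using convexOn_const 0 hS.convex_Θ
          | insert i s hi ih =>
            simp only [Finset.sum_insert hi]
            exact (convexOn_empLoss hL (h.nuisance i) hS).add ih
        exact this _) hg (a := fun _ => ρ / 2 * (X.N k : ℝ)) (fun _ => by positivity) hmono
      (fun _ z hz => by
        rw [zero_mul, add_zero]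
        exact (norm_sum_le _ _).trans (Finset.sum_le_sum fun j hj =>
          h.norm_gradient_le hS hL hM hρ hr₁ hr₂ hν0 hr0.le j (by rwa [hk hj]))) hb hstat
      (ϑ := fun _ => θ) (fun _ => hθ) (fun hc => hne (congrFun hc 0))
    simpa [fusionObjective] using this
  have hmem : b 0 ∈ argminOn (fun θ => X.clusterLoss k θ (fun j => X.ηhat j ω) ω) X.Θ := by
    refine ⟨hΘ hb0, fun θ hθ => ?_⟩
    by_cases hne : θ = b 0
    · rw [hne]
    · exact (huniq θ hθ hne).le
  have hϑ := hmin ⟨_, hmem⟩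
  have hϑb : ϑ = b 0 := by
    by_contra hne
    exact absurd (hϑ.2 _ (hΘ hb0)) (not_le.2 (huniq ϑ hϑ.1 hne))
  subst hϑb
  refine ⟨hb0, ?_⟩
  have h1 := hstat 0
  simp only [fusionGradient, hgd] at h1
  simp at h1
  simp [h1]

end Fusion

end Experiment
end

noncomputable section

section Markov

variable {α F : Type*} [MeasurableSpace α] {μ : Measure α} [SeminormedAddCommGroup F]

lemma measure_norm_gt_le {f : α → F} (hf : AEMeasurable (fun z => ‖f z‖ₑ) μ) {B a : ℝ}
    (ha : 0 < a) (h : ∫⁻ z, ‖f z‖ₑ ∂μ ≤ ENNReal.ofReal B) :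
    μ {z | a < ‖f z‖} ≤ ENNReal.ofReal (B / a) := by
  rw [ENNReal.ofReal_div_of_pos ha]
  refine le_trans ?_ ((meas_ge_le_lintegral_div hf (ε := ENNReal.ofReal a)
    (by simpa using ha) ENNReal.ofReal_ne_top).trans (ENNReal.div_le_div_right h _))
  refine measure_mono fun z hz => ?_
  simp only [Set.mem_ofPred_eq] at hz ⊢
  rw [← ofReal_norm]
  exact ENNReal.ofReal_le_ofReal hz.le

lemma measure_norm_gt_le_of_sq {f : α → F} (hf : AEMeasurable (fun z => ‖f z‖ₑ) μ) {B a : ℝ}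
    (ha : 0 < a) (h : ∫⁻ z, ‖f z‖ₑ ^ 2 ∂μ ≤ ENNReal.ofReal B) :
    μ {z | a < ‖f z‖} ≤ ENNReal.ofReal (B / a ^ 2) := by
  rw [ENNReal.ofReal_div_of_pos (by positivity)]
  refine le_trans ?_ ((meas_ge_le_lintegral_div (hf.pow_const 2) (ε := ENNReal.ofReal (a ^ 2))
    (by simp [ha.ne']) ENNReal.ofReal_ne_top).trans (ENNReal.div_le_div_right h _))
  refine measure_mono fun z hz => ?_
  simp only [Set.mem_ofPred_eq] at hz ⊢
  rw [← ofReal_norm, ← ENNReal.ofReal_pow (norm_nonneg _)]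
  exact ENNReal.ofReal_le_ofReal (by gcongr)

lemma measure_exists_le {ι : Type*} [Fintype ι] {p : ι → α → Prop} {q : ι → ℝ}
    (hq : ∀ i, 0 ≤ q i) (h : ∀ i, μ {z | p i z} ≤ ENNReal.ofReal (q i)) :
    μ {z | ∃ i, p i z} ≤ ENNReal.ofReal (∑ i, q i) := by
  rw [Set.ofPred_exists, ENNReal.ofReal_sum_of_nonneg fun i _ => hq i]
  exact (measure_iUnion_fintype_le _ _).trans (Finset.sum_le_sum fun i _ => h i)

lemma measure_exists_le_const {m : ℕ} {p : Fin m → α → Prop} {q : ℝ} (hq : 0 ≤ q)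
    (h : ∀ i, μ {z | p i z} ≤ ENNReal.ofReal (q / m)) :
    μ {z | ∃ i, p i z} ≤ ENNReal.ofReal q := by
  rcases Nat.eq_zero_or_pos m with hm | hm
  · subst hm
    simp
  · refine (measure_exists_le (fun _ => by positivity) h).trans (le_of_eq ?_)
    have : (m : ℝ) ≠ 0 := by exact_mod_cast hm.ne'
    rw [Finset.sum_const, Finset.card_univ, Fintype.card_fin, nsmul_eq_mul, mul_div_cancel₀ _ this]

end Markov

namespace Experiment

variable {d : ℕ} {X : Experiment.{u, v, w} d} {M δ ρ κ σ₁ σ₂ σ₃ σ₅ r₁ r₂ : ℝ}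

section Task

variable (hS : X.Setting M δ) (hL : X.LossRegularity M ρ κ σ₁ σ₂ σ₃ σ₅ r₁ r₂) (hM : 0 < M)
  (hr₁ : 2 < r₁) (hr₂ : 2 < r₂)

include hS

lemma measure_nuisance_gt_le (j : Fin X.m) {V : ℝ} (hM : 0 < M)
    (hmse : ∫⁻ ω, ‖X.ηhat j ω - X.ηstar j‖ₑ ^ 2 ∂X.μ ≤ ENNReal.ofReal V) :
    X.μ {ω | M < ‖X.ηhat j ω - X.ηstar j‖} ≤ ENNReal.ofReal (V / M ^ 2) :=
  measure_norm_gt_le_of_sq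
    ((hS.measurable_enorm_nuisance j).comp (hS.measurable_ηhat j)).aemeasurable hM hmse

include hL hM

lemma measurable_nuisanceEffect (j : Fin X.m) : Measurable (X.nuisanceEffect j) :=
  Finset.measurable_fun_sum _ fun i _ =>
    measurable_scoreIncrement_comp hS hL hM j (hS.measurable_ηhat j) (hS.measurable_Z j i)

lemma measurable_taskScore (j : Fin X.m) : Measurable (X.taskScore j) :=
  Finset.measurable_fun_sum _ fun i _ =>
    (measurable_score hS hL hM j).comp (hS.measurable_Z j i)

include hr₁ hr₂

lemma measure_hessianDeviation_gt_le (j : Fin X.m) {ν : ℝ} (hν : 0 < ν) :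
    X.μ {ω | ν / 3 * X.n j < ‖∑ i, X.hessianDeviation j (X.Z j i ω)‖} ≤
      ENNReal.ofReal (d * (d * (18 * (1 + |σ₂|))) * (3 * (d + 1) / ν) ^ 2 / X.n j) := by
  have hn : (0 : ℝ) < X.n j := by exact_mod_cast hS.n_pos j
  set a : ℝ := ν / (3 * (d + 1)) * X.n j with ha
  have ha0 : 0 < a := by positivity
  have h1 : ∀ c : Fin d, X.μ {ω | a < ‖∑ i, X.hessianDeviation j (X.Z j i ω)
      (EuclideanSpace.basisFun (Fin d) ℝ c)‖} ≤
      ENNReal.ofReal (X.n j * (d * (18 * (1 + |σ₂|))) / a ^ 2) := fun c =>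
    measure_norm_gt_le_of_sq (Finset.measurable_fun_sum _ fun i _ =>
      (measurable_hessianDeviation hS hL hM j _).comp (hS.measurable_Z j i)).enorm.aemeasurable
      ha0 (lintegral_hessianDeviation_sum_sq_le hS hL hM hr₁ hr₂ j c)
  have h2 := measure_exists_le (fun _ => by positivity) h1
  refine (measure_mono fun ω hω => ?_).trans (h2.trans (le_of_eq ?_))
  · simp only [Set.mem_ofPred_eq] at hω ⊢
    by_contra! hcon
    have h3 := norm_clm_le_sum_columns (∑ i, X.hessianDeviation j (X.Z j i ω))
    have h4 : ∑ c, ‖(∑ i, X.hessianDeviation j (X.Z j i ω))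
        (EuclideanSpace.basisFun (Fin d) ℝ c)‖ ≤ ∑ _c : Fin d, a :=
      Finset.sum_le_sum fun c _ => by
        rw [sum_apply]
        exact hcon c
    rw [Finset.sum_const, Finset.card_univ, Fintype.card_fin, nsmul_eq_mul] at h4
    have h5 : (d : ℝ) * a ≤ (d + 1) * a := by nlinarith
    have h6 : (d + 1 : ℝ) * a = ν / 3 * X.n j := by rw [ha]; field_simp
    linarith
  · rw [Finset.sum_const, Finset.card_univ, Fintype.card_fin, nsmul_eq_mul, ha]
    congr 1
    field_simp

/-- The empirical gradient of a task is nearly linear with high probability. -/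
lemma measure_task_not_linear_le (j : Fin X.m) {ν r V : ℝ} (hν : 0 < ν) (hr0 : 0 < r) (hrM : r ≤ M)
    (hV : 0 ≤ V) (hmse : ∫⁻ ω, ‖X.ηhat j ω - X.ηstar j‖ₑ ^ 2 ∂X.μ ≤ ENNReal.ofReal V) :
    X.μ {ω | ¬ (X.ηhat j ω ∈ Metric.closedBall (X.ηstar j) M ∧
      ∀ θ ∈ Metric.closedBall (X.θstar j) r, ∀ θ' ∈ Metric.closedBall (X.θstar j) r,
        ‖X.taskGradient ω j θ - X.taskGradient ω j θ' -
          (X.n j : ℝ) • X.popHessian j (X.θstar j) (θ - θ')‖ ≤ ν * X.n j * ‖θ - θ'‖)} ≤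
      ENNReal.ofReal (V / M ^ 2 +
        d * (d * (18 * (1 + |σ₂|))) * (3 * (d + 1) / ν) ^ 2 / X.n j +
        3 * |σ₃| / ν * Real.sqrt V + 3 * |σ₃| / ν * r) := by
  obtain ⟨L, hLm, hL0, -, hLσ, hLip⟩ := hL.exists_lipschitz hM j
  have hn : (0 : ℝ) < X.n j := by exact_mod_cast hS.n_pos j
  have hLs : Measurable fun ω => ∑ i, ENNReal.ofReal (L (X.Z j i ω)) :=
    Finset.measurable_fun_sum _ fun i _ => (hLm.comp (hS.measurable_Z j i)).ennreal_ofReal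
  have hen : Measurable fun ω => ‖X.ηhat j ω - X.ηstar j‖ₑ :=
    (hS.measurable_enorm_nuisance j).comp (hS.measurable_ηhat j)
  have hmom := lintegral_lipschitz_mul_nuisance_le hS j hLm hLσ hV hmse
  have he1 : ∀ ω, ∑ i, ENNReal.ofReal (L (X.Z j i ω)) = ENNReal.ofReal (∑ i, L (X.Z j i ω)) :=
    fun ω => (ENNReal.ofReal_sum_of_nonneg fun i _ => hL0 _).symm
  have hs0 : ∀ ω, 0 ≤ ∑ i, L (X.Z j i ω) := fun ω => Finset.sum_nonneg fun i _ => hL0 _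
  -- the exceptional events
  have p1 := measure_nuisance_gt_le hS j hM hmse
  have p2 := measure_hessianDeviation_gt_le hS hL hM hr₁ hr₂ j hν
  have p3 : X.μ {ω | ν / 3 * X.n j < ‖(∑ i, L (X.Z j i ω)) * ‖X.ηhat j ω - X.ηstar j‖‖} ≤
      ENNReal.ofReal (X.n j * |σ₃| * Real.sqrt V / (ν / 3 * X.n j)) := by
    have e : ∀ ω, ‖(∑ i, L (X.Z j i ω)) * ‖X.ηhat j ω - X.ηstar j‖‖ₑ =
        (∑ i, ENNReal.ofReal (L (X.Z j i ω))) * ‖X.ηhat j ω - X.ηstar j‖ₑ := fun ω => by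
      rw [enorm_mul, he1, Real.enorm_eq_ofReal (hs0 ω), enorm_norm]
    refine measure_norm_gt_le ?_ (by positivity) ?_
    · simp only [e]
      exact (hLs.mul hen).aemeasurable
    · simp only [e]
      exact hmom.2
  have p4 : X.μ {ω | ν / (3 * r) * X.n j < ‖∑ i, L (X.Z j i ω)‖} ≤
      ENNReal.ofReal (X.n j * |σ₃| / (ν / (3 * r) * X.n j)) := by
    have e : ∀ ω, ‖∑ i, L (X.Z j i ω)‖ₑ = ∑ i, ENNReal.ofReal (L (X.Z j i ω)) := fun ω => by
      rw [he1, Real.enorm_eq_ofReal (hs0 ω)]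
    refine measure_norm_gt_le ?_ (by positivity) ?_
    · simp only [e]
      exact hLs.aemeasurable
    · simp only [e]
      exact hmom.1
  have p5 : X.μ {ω | ¬ ∀ i, X.HessianLipschitzAt M j (L (X.Z j i ω)) (X.Z j i ω)} = 0 := by
    rw [← ae_iff, ae_all_iff]
    intro i
    have := hS.law_Z j i
    rw [← this] at hLip
    exact ae_of_ae_map (hS.measurable_Z j i).aemeasurable hLip
  have e3 : X.n j * |σ₃| * Real.sqrt V / (ν / 3 * X.n j) = 3 * |σ₃| / ν * Real.sqrt V := by
    field_simp
  have e4 : X.n j * |σ₃| / (ν / (3 * r) * X.n j) = 3 * |σ₃| / ν * r := by field_simp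
  rw [e3] at p3
  rw [e4] at p4
  rw [ENNReal.ofReal_add (by positivity) (by positivity),
    ENNReal.ofReal_add (by positivity) (by positivity),
    ENNReal.ofReal_add (by positivity) (by positivity)]
  refine le_trans (measure_mono (t := ((({ω | M < ‖X.ηhat j ω - X.ηstar j‖} ∪
    {ω | ν / 3 * X.n j < ‖∑ i, X.hessianDeviation j (X.Z j i ω)‖}) ∪
    {ω | ν / 3 * X.n j < ‖(∑ i, L (X.Z j i ω)) * ‖X.ηhat j ω - X.ηstar j‖‖}) ∪
    {ω | ν / (3 * r) * X.n j < ‖∑ i, L (X.Z j i ω)‖}) ∪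
    {ω | ¬ ∀ i, X.HessianLipschitzAt M j (L (X.Z j i ω)) (X.Z j i ω)}) fun ω hω => ?_) ?_
  · contrapose hω
    simp only [Set.mem_union, Set.mem_ofPred_eq, not_or, not_lt, not_not] at hω ⊢
    obtain ⟨⟨⟨⟨h1, h2⟩, h3⟩, h4⟩, h5⟩ := hω
    have hη : X.ηhat j ω ∈ Metric.closedBall (X.ηstar j) M := by
      rwa [Metric.mem_closedBall, dist_eq_norm]
    refine ⟨hη, fun θ hθ θ' hθ' => taskGradient_linear hL hη hM hrM (fun i => hL0 _) h5 h2 ?_ ?_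
      hθ hθ'⟩
    · exact (le_abs_self _).trans h3
    · have := (le_abs_self _).trans h4
      calc (∑ i, L (X.Z j i ω)) * r ≤ ν / (3 * r) * X.n j * r := by gcongr
        _ = _ := by field_simp
  · refine (measure_union_le _ _).trans ?_
    rw [p5, add_zero]
    refine (measure_union_le _ _).trans (add_le_add ?_ p4)
    refine (measure_union_le _ _).trans (add_le_add ?_ p3)
    exact (measure_union_le _ _).trans (add_le_add p1 p2)

end Task

end Experiment
end

noncomputable section

namespace Experiment

variable {d : ℕ} {X : Experiment.{u, v, w} d} {M δ ρ κ σ₁ σ₂ σ₃ σ₅ r₁ r₂ : ℝ}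

lemma m_pos_of_task (j : Fin X.m) : (1 : ℝ) ≤ X.m := by
  exact_mod_cast (Nat.one_le_iff_ne_zero.2 fun h => (h ▸ j).elim0 : 1 ≤ X.m)

lemma n_le_N (j : Fin X.m) : X.n j ≤ X.N (X.cluster j) :=
  Finset.single_le_sum (f := fun i => X.n i) (fun _ _ => Nat.zero_le _) (by simp)

/-- The sample sizes and the nuisance rates dominate `A` times the number of tasks. -/
structure LargeSamples (X : Experiment.{u, v, w} d) (A : ℝ) (S : Fin X.m → ℝ) : Prop where
  one_le : 1 ≤ A
  sqrt_n : ∀ j, A * X.m ≤ Real.sqrt (X.n j)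
  rate : ∀ j, A * X.m ≤ S j

namespace LargeSamples

variable {A : ℝ} {S : Fin X.m → ℝ} (h : X.LargeSamples A S)

include h

lemma pos : 0 < A := one_pos.trans_le h.one_le

lemma le_n (j : Fin X.m) : (A * X.m) ^ 2 ≤ X.n j := by
  have h0 : 0 ≤ A * X.m := mul_nonneg h.pos.le (Nat.cast_nonneg _)
  exact (Real.le_sqrt h0 (Nat.cast_nonneg _)).1 (h.sqrt_n j)

lemma le_N (hS : X.Setting M δ) (k : Fin X.K) : (A * X.m) ^ 2 ≤ X.N k := by
  obtain ⟨j, rfl⟩ := hS.cluster_surjective k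
  exact (h.le_n j).trans (by exact_mod_cast n_le_N j)

lemma scale_pos (j : Fin X.m) : 0 < A * X.m :=
  mul_pos h.pos (one_pos.trans_le (m_pos_of_task j))

lemma inv_n_le (j : Fin X.m) {C : ℝ} (hC : 0 ≤ C) : C / X.n j ≤ C / A / X.m := by
  rw [div_div]
  have h0 := h.scale_pos j
  have h1 := h.le_n j
  have h2 : 1 ≤ A * X.m := by
    have := m_pos_of_task j
    nlinarith [h.one_le]
  gcongr
  nlinarith

lemma inv_rate_le (j : Fin X.m) {C : ℝ} (hC : 0 ≤ C) : C / S j ≤ C / A / X.m := by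
  rw [div_div]
  have := h.scale_pos j
  have := h.rate j
  gcongr

lemma inv_rate_sq_le (j : Fin X.m) {C : ℝ} (hC : 0 ≤ C) : C / S j ^ 2 ≤ C / A / X.m := by
  rw [div_div]
  have h0 := h.scale_pos j
  have h1 := h.rate j
  have h2 : 1 ≤ A * X.m := by
    have := m_pos_of_task j
    nlinarith [h.one_le]
  gcongr
  nlinarith

end LargeSamples

section Events

variable (hS : X.Setting M δ) (hL : X.LossRegularity M ρ κ σ₁ σ₂ σ₃ σ₅ r₁ r₂) (hM : 0 < M)
  (hr₁ : 2 < r₁) (hr₂ : 2 < r₂)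

include hS hL hM hr₁ hr₂

lemma measure_taskScore_gt_le {A : ℝ} {S : Fin X.m → ℝ} (hA : X.LargeSamples A S) :
    X.μ {ω | ∃ j, (X.n j : ℝ) < ‖X.taskScore j ω‖} ≤ ENNReal.ofReal ((1 + |σ₁|) / A) := by
  have hA0 := hA.pos
  refine measure_exists_le_const (by positivity) fun j => ?_
  have hn : (0 : ℝ) < X.n j := by exact_mod_cast hS.n_pos j
  refine (measure_norm_gt_le_of_sq (measurable_taskScore hS hL hM j).enorm.aemeasurable hn
    (lintegral_taskScore_sq_le hS hL hM hr₁ hr₂ j)).trans (ENNReal.ofReal_le_ofReal ?_)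
  have e : (X.n j : ℝ) * (1 + |σ₁|) / X.n j ^ 2 = (1 + |σ₁|) / X.n j := by field_simp
  rw [e]
  exact hA.inv_n_le j (by positivity)

lemma measure_scoreSum_gt_le {A : ℝ} {S : Fin X.m → ℝ} (hA : X.LargeSamples A S) {x : ℝ}
    (hx : 0 < x) :
    X.μ {ω | ∃ k, x * X.N k / X.m < ‖X.scoreSum k ω‖} ≤
      ENNReal.ofReal (X.K * ((1 + |σ₁|) / (x ^ 2 * A ^ 2))) := by
  have hA0 := hA.pos
  refine (measure_exists_le (q := fun _ => (1 + |σ₁|) / (x ^ 2 * A ^ 2))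
    (fun _ => by positivity) fun k => ?_).trans (by simp)
  have hN : (0 : ℝ) < X.N k := by exact_mod_cast N_pos hS k
  obtain ⟨j, -⟩ := hS.cluster_surjective k
  have hm : (0 : ℝ) < X.m := one_pos.trans_le (m_pos_of_task j)
  refine (measure_norm_gt_le_of_sq (measurable_scoreSum hS hL hM k).enorm.aemeasurable
    (a := x * X.N k / X.m) (by positivity)
    (lintegral_scoreSum_sq_le hS hL hM hr₁ hr₂ k)).trans (ENNReal.ofReal_le_ofReal ?_)
  have e : (X.N k : ℝ) * (1 + |σ₁|) / (x * X.N k / X.m) ^ 2 =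
      (1 + |σ₁|) * X.m ^ 2 / (x ^ 2 * X.N k) := by field_simp
  have h1 := hA.le_N hS k
  rw [e, div_le_div_iff₀ (by positivity) (by positivity)]
  have : (X.m : ℝ) ^ 2 * A ^ 2 ≤ X.N k := by nlinarith
  have h3 : 0 ≤ (1 + |σ₁|) * x ^ 2 := by positivity
  nlinarith [mul_le_mul_of_nonneg_left this h3]

lemma measure_normScore_gt_le (k : Fin X.K) {R : ℝ} (hR : 0 < R) :
    X.μ {ω | R < ‖X.normScore k ω‖} ≤ ENNReal.ofReal ((1 + |σ₁|) / R ^ 2) := by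
  have hN : (0 : ℝ) < X.N k := by exact_mod_cast N_pos hS k
  have hs := Real.sqrt_pos.2 hN
  have h1 := measure_norm_gt_le_of_sq (measurable_scoreSum hS hL hM k).enorm.aemeasurable
    (a := Real.sqrt (X.N k) * R) (by positivity) (lintegral_scoreSum_sq_le hS hL hM hr₁ hr₂ k)
  refine (measure_mono fun ω hω => ?_).trans (h1.trans (le_of_eq ?_))
  · simp only [Set.mem_ofPred_eq, normScore, norm_smul, norm_inv, Real.norm_of_nonneg hs.le] at hω ⊢
    rwa [inv_mul_eq_div, lt_div_iff₀ hs, mul_comm] at hω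
  · rw [mul_pow, Real.sq_sqrt hN.le]
    congr 1
    field_simp

section Nuisance

variable {A C : ℝ} {S : Fin X.m → ℝ} (hA : X.LargeSamples A S) (hC : 0 ≤ C)
  (hmse : ∀ j, ∫⁻ ω, ‖X.ηhat j ω - X.ηstar j‖ₑ ^ 2 ∂X.μ ≤ ENNReal.ofReal (C / S j ^ 2))

include hA hC hmse

lemma lintegral_nuisanceEffect_le (j : Fin X.m) :
    ∫⁻ ω, ‖X.nuisanceEffect j ω‖ₑ ∂X.μ ≤ ENNReal.ofReal
      (|σ₅| * C * (X.n j / S j ^ 2) + 2 * Real.sqrt (|σ₅| * C) * (Real.sqrt (X.n j) / S j)) := by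
  have hSj : 0 < S j := (hA.scale_pos j).trans_le (hA.rate j)
  refine (lintegral_sum_scoreIncrement_hat_le hS hL hM hr₁ hr₂ j (by positivity) (hmse j)).trans
    (le_of_eq ?_)
  congr 1
  rw [Real.sqrt_div hC, Real.sqrt_sq hSj.le, Real.sqrt_mul (by positivity),
    Real.sqrt_mul (by positivity)]
  ring

lemma measure_nuisanceEffect_gt_le {x : ℝ} (hx : 0 < x) :
    X.μ {ω | ∃ j, x * X.n j / X.m < ‖X.nuisanceEffect j ω‖} ≤
      ENNReal.ofReal ((|σ₅| * C + 2 * Real.sqrt (|σ₅| * C)) / (x * A)) := by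
  have hA0 := hA.pos
  refine measure_exists_le_const (by positivity) fun j => ?_
  have hn : (0 : ℝ) < X.n j := by exact_mod_cast hS.n_pos j
  have hm := m_pos_of_task j
  have hm0 : (0 : ℝ) < X.m := one_pos.trans_le hm
  have hs0 := hA.scale_pos j
  have hSj : 0 < S j := hs0.trans_le (hA.rate j)
  have hnj : 0 < Real.sqrt (X.n j) := Real.sqrt_pos.2 hn
  refine (measure_norm_gt_le (measurable_nuisanceEffect hS hL hM j).enorm.aemeasurable
    (a := x * X.n j / X.m) (by positivity)
    (lintegral_nuisanceEffect_le hS hL hM hr₁ hr₂ hA hC hmse j)).trans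
    (ENNReal.ofReal_le_ofReal ?_)
  have e : (|σ₅| * C * (X.n j / S j ^ 2) + 2 * Real.sqrt (|σ₅| * C) * (Real.sqrt (X.n j) / S j)) /
      (x * X.n j / X.m) = (X.m / x) * (|σ₅| * C / (S j * S j) +
        2 * Real.sqrt (|σ₅| * C) / (Real.sqrt (X.n j) * S j)) := by
    have hq : (X.n j : ℝ) = Real.sqrt (X.n j) * Real.sqrt (X.n j) :=
      (Real.mul_self_sqrt hn.le).symm
    generalize Real.sqrt (X.n j) = q at *
    rw [hq]
    field_simp
  rw [e]
  have h1 : |σ₅| * C / (S j * S j) ≤ |σ₅| * C / (A * X.m * (A * X.m)) := by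
    have := hA.rate j
    gcongr
  have h2 : 2 * Real.sqrt (|σ₅| * C) / (Real.sqrt (X.n j) * S j) ≤
      2 * Real.sqrt (|σ₅| * C) / (A * X.m * (A * X.m)) := by
    have := hA.rate j
    have := hA.sqrt_n j
    gcongr
  calc (X.m / x) * (|σ₅| * C / (S j * S j) +
        2 * Real.sqrt (|σ₅| * C) / (Real.sqrt (X.n j) * S j))
      ≤ (X.m / x) * (|σ₅| * C / (A * X.m * (A * X.m)) +
        2 * Real.sqrt (|σ₅| * C) / (A * X.m * (A * X.m))) := by gcongr
    _ = (|σ₅| * C + 2 * Real.sqrt (|σ₅| * C)) / (x * A) / X.m / A := by field_simp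
    _ ≤ _ := div_le_self (by positivity) hA.one_le

/-- The nuisance estimators of a cluster have a negligible effect on the normalized score if `b_k`
is small. -/
lemma measure_sum_nuisanceEffect_gt_le (k : Fin X.K) {t : ℝ}
    (hb : ∀ j, X.cluster j = k →
      Real.sqrt (X.clusterSize k) * (Real.sqrt (X.n j) / S j ^ 2) ≤ t) {x : ℝ} (hx : 0 < x) :
    X.μ {ω | x * Real.sqrt (X.N k) < ∑ j with X.cluster j = k, ‖X.nuisanceEffect j ω‖} ≤
      ENNReal.ofReal ((|σ₅| * C * t + 2 * Real.sqrt (|σ₅| * C) / A) / x) := by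
  have hA0 := hA.pos
  set D := |σ₅| * C * t + 2 * Real.sqrt (|σ₅| * C) / A with hD
  obtain ⟨j₀, hj₀⟩ := hS.cluster_surjective k
  have hmk : 0 < X.clusterSize k := Finset.card_pos.2 ⟨j₀, by simp [hj₀]⟩
  have hmk' : (0 : ℝ) < X.clusterSize k := by exact_mod_cast hmk
  have hq : 0 < Real.sqrt (X.clusterSize k) := Real.sqrt_pos.2 hmk'
  have ht : 0 ≤ t := le_trans (by positivity) (hb j₀ hj₀)
  have hD0 : 0 ≤ D := by positivity
  have hN : (0 : ℝ) < X.N k := by exact_mod_cast N_pos hS k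
  have hNs := Real.sqrt_pos.2 hN
  have hqm : Real.sqrt (X.clusterSize k) ≤ X.m := by
    have h1 : (X.clusterSize k : ℝ) ≤ X.m := by
      have := Finset.card_le_univ (Finset.univ.filter fun j => X.cluster j = k)
      rw [Fintype.card_fin] at this
      exact_mod_cast this
    have h2 := m_pos_of_task j₀
    rw [Real.sqrt_le_left (by positivity)]
    nlinarith
  have hj : ∀ j, X.cluster j = k → ∫⁻ ω, ‖X.nuisanceEffect j ω‖ₑ ∂X.μ ≤
      ENNReal.ofReal (D / Real.sqrt (X.clusterSize k) * Real.sqrt (X.n j)) := fun j hj => by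
    refine (lintegral_nuisanceEffect_le hS hL hM hr₁ hr₂ hA hC hmse j).trans
      (ENNReal.ofReal_le_ofReal ?_)
    have hSj : 0 < S j := (hA.scale_pos j).trans_le (hA.rate j)
    have hn : (0 : ℝ) < X.n j := by exact_mod_cast hS.n_pos j
    have hnj : 0 < Real.sqrt (X.n j) := Real.sqrt_pos.2 hn
    have h1 : (X.n j : ℝ) / S j ^ 2 ≤ t / Real.sqrt (X.clusterSize k) * Real.sqrt (X.n j) := by
      rw [div_mul_eq_mul_div, le_div_iff₀ hq]
      have := mul_le_mul_of_nonneg_right (hb j hj) hnj.le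
      calc _ = Real.sqrt (X.clusterSize k) *
            (Real.sqrt (X.n j) * Real.sqrt (X.n j) / S j ^ 2) := by
              rw [Real.mul_self_sqrt hn.le]; ring
        _ ≤ _ := by
          refine le_trans (le_of_eq ?_) this
          ring
    have h2 : Real.sqrt (X.n j) / S j ≤
        1 / A / Real.sqrt (X.clusterSize k) * Real.sqrt (X.n j) := by
      rw [div_eq_mul_inv, mul_comm, ← one_div, div_div]
      gcongr
      exact (mul_le_mul_of_nonneg_left hqm hA0.le).trans (hA.rate j)
    calc _ ≤ |σ₅| * C * (t / Real.sqrt (X.clusterSize k) * Real.sqrt (X.n j)) +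
          2 * Real.sqrt (|σ₅| * C) * (1 / A / Real.sqrt (X.clusterSize k) * Real.sqrt (X.n j)) := by
            gcongr
      _ = _ := by rw [hD]; ring
  have hsum : ∑ j with X.cluster j = k, Real.sqrt (X.n j) ≤
      Real.sqrt (X.clusterSize k) * Real.sqrt (X.N k) := by
    rw [← Real.sqrt_mul (by positivity)]
    refine Real.le_sqrt_of_sq_le ?_
    refine (sq_sum_le_card_mul_sum_sq).trans (le_of_eq ?_)
    rw [clusterSize]
    congr 1
    rw [N, Nat.cast_sum]
    exact Finset.sum_congr rfl fun j _ => Real.sq_sqrt (Nat.cast_nonneg _)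
  have hmeas : ∀ j, Measurable fun ω => ‖X.nuisanceEffect j ω‖ₑ := fun j =>
    (measurable_nuisanceEffect hS hL hM j).enorm
  have e : ∀ ω, ‖∑ j with X.cluster j = k, ‖X.nuisanceEffect j ω‖‖ₑ =
      ∑ j with X.cluster j = k, ‖X.nuisanceEffect j ω‖ₑ := fun ω => by
    rw [Real.enorm_eq_ofReal (Finset.sum_nonneg fun _ _ => norm_nonneg _),
      ENNReal.ofReal_sum_of_nonneg fun _ _ => norm_nonneg _]
    exact Finset.sum_congr rfl fun j _ => ofReal_norm _
  have key : X.μ {ω | x * Real.sqrt (X.N k) < ‖∑ j with X.cluster j = k, ‖X.nuisanceEffect j ω‖‖} ≤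
      ENNReal.ofReal (D * Real.sqrt (X.N k) / (x * Real.sqrt (X.N k))) := by
    refine measure_norm_gt_le ?_ (by positivity) ?_
    · simp only [e]
      exact (Finset.measurable_fun_sum _ fun j _ => hmeas j).aemeasurable
    · simp only [e]
      rw [lintegral_finsetSum _ fun j _ => hmeas j]
      calc _ ≤ ∑ j with X.cluster j = k,
            ENNReal.ofReal (D / Real.sqrt (X.clusterSize k) * Real.sqrt (X.n j)) :=
            Finset.sum_le_sum fun j hj' => hj j (Finset.mem_filter.1 hj').2
        _ = ENNReal.ofReal (D / Real.sqrt (X.clusterSize k) *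
              ∑ j with X.cluster j = k, Real.sqrt (X.n j)) := by
            rw [Finset.mul_sum, ENNReal.ofReal_sum_of_nonneg fun j _ => by positivity]
        _ ≤ _ := by
            refine ENNReal.ofReal_le_ofReal ?_
            calc _ ≤ D / Real.sqrt (X.clusterSize k) *
                  (Real.sqrt (X.clusterSize k) * Real.sqrt (X.N k)) := by gcongr
              _ = _ := by field_simp
  refine (measure_mono fun ω hω => ?_).trans (key.trans (le_of_eq ?_))
  · simp only [Set.mem_ofPred_eq] at hω ⊢
    exact hω.trans_le (le_abs_self _)
  · congr 1
    field_simp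

lemma measure_not_linearizable_le {ν c : ℝ} (hν : 0 < ν) (hc : 0 < c) (hcM : c ≤ M) :
    X.μ {ω | ¬ X.Linearizable M ν (c / X.m) ω} ≤ X.μ {ω | ∃ j, X.ηhat j ω ∉ X.T j} +
      ENNReal.ofReal ((C / M ^ 2 + d * (d * (18 * (1 + |σ₂|))) * (3 * (d + 1) / ν) ^ 2 +
        3 * |σ₃| / ν * Real.sqrt C) / A + 3 * |σ₃| / ν * c) := by
  have hA0 := hA.pos
  have h1 : X.μ {ω | ∃ j, ¬ (X.ηhat j ω ∈ Metric.closedBall (X.ηstar j) M ∧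
      ∀ θ ∈ Metric.closedBall (X.θstar j) (c / X.m),
        ∀ θ' ∈ Metric.closedBall (X.θstar j) (c / X.m),
        ‖X.taskGradient ω j θ - X.taskGradient ω j θ' -
          (X.n j : ℝ) • X.popHessian j (X.θstar j) (θ - θ')‖ ≤ ν * X.n j * ‖θ - θ'‖)} ≤
      ENNReal.ofReal ((C / M ^ 2 + d * (d * (18 * (1 + |σ₂|))) * (3 * (d + 1) / ν) ^ 2 +
        3 * |σ₃| / ν * Real.sqrt C) / A + 3 * |σ₃| / ν * c) := by
    refine measure_exists_le_const (by positivity) fun j => ?_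
    have hm := m_pos_of_task j
    have hm0 : (0 : ℝ) < X.m := one_pos.trans_le hm
    have hSj : 0 < S j := (hA.scale_pos j).trans_le (hA.rate j)
    refine (measure_task_not_linear_le hS hL hM hr₁ hr₂ j hν (by positivity)
      ((div_le_self hc.le hm).trans hcM) (by positivity) (hmse j)).trans
      (ENNReal.ofReal_le_ofReal ?_)
    have a1 := hA.inv_rate_sq_le j (C := C / M ^ 2) (by positivity)
    have a2 := hA.inv_n_le j (C := d * (d * (18 * (1 + |σ₂|))) * (3 * (d + 1) / ν) ^ 2)
      (by positivity)
    have a3 := hA.inv_rate_le j (C := 3 * |σ₃| / ν * Real.sqrt C) (by positivity)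
    rw [Real.sqrt_div hC, Real.sqrt_sq hSj.le]
    calc _ = C / M ^ 2 / S j ^ 2 + d * (d * (18 * (1 + |σ₂|))) * (3 * (d + 1) / ν) ^ 2 / X.n j +
          3 * |σ₃| / ν * Real.sqrt C / S j + 3 * |σ₃| / ν * c / X.m := by ring
      _ ≤ C / M ^ 2 / A / X.m +
          d * (d * (18 * (1 + |σ₂|))) * (3 * (d + 1) / ν) ^ 2 / A / X.m +
          3 * |σ₃| / ν * Real.sqrt C / A / X.m + 3 * |σ₃| / ν * c / X.m := by gcongr
      _ = _ := by ring
  refine le_trans (measure_mono (t := {ω | ∃ j, X.ηhat j ω ∉ X.T j} ∪ _) fun ω hω => ?_)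
    ((measure_union_le _ _).trans (add_le_add le_rfl h1))
  contrapose hω
  simp only [Set.mem_union, Set.mem_ofPred_eq, not_or, not_exists, not_not] at hω ⊢
  exact ⟨fun j => (hω.2 j).1, hω.1, fun j => (hω.2 j).2⟩

end Nuisance

end Events

end Experiment
end

noncomputable section

lemma ENNReal.rpow_neg_anti {a b : ℝ≥0∞} (h : a ≤ b) {p : ℝ} (hp : 0 ≤ p) :
    b ^ (-p) ≤ a ^ (-p) := by
  rw [ENNReal.rpow_neg, ENNReal.rpow_neg]
  exact ENNReal.inv_le_inv.2 (ENNReal.rpow_le_rpow h hp)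

namespace Experiment

variable {d : ℕ} {X : Experiment.{u, v, w} d} {M δ ρ κ σ₁ σ₂ σ₃ σ₅ r₁ r₂ : ℝ}

lemma nMin_le (j : Fin X.m) : X.nMin ≤ X.n j := ciInf_le (OrderBot.bddBelow _) j

lemma le_nMax (j : Fin X.m) : X.n j ≤ X.nMax := le_ciSup (Set.finite_range _).bddAbove j

lemma NMin_le (k : Fin X.K) : X.NMin ≤ X.N k := ciInf_le (OrderBot.bddBelow _) k

lemma nMin_pos (hS : X.Setting M δ) (j : Fin X.m) : 0 < X.nMin := by
  have : Nonempty (Fin X.m) := ⟨j⟩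
  obtain ⟨i, hi⟩ := exists_eq_ciInf_of_finite (f := X.n)
  rw [nMin, ← hi]
  exact hS.n_pos i

lemma exists_NMin_eq (k : Fin X.K) : ∃ k', X.NMin = X.N k' := by
  have : Nonempty (Fin X.K) := ⟨k⟩
  obtain ⟨i, hi⟩ := exists_eq_ciInf_of_finite (f := X.N)
  exact ⟨i, hi.symm⟩

lemma clusterSize_le (k : Fin X.K) : X.clusterSize k ≤ X.m := by
  have := Finset.card_le_univ (Finset.univ.filter fun j => X.cluster j = k)
  rwa [Fintype.card_fin] at this

lemma N_le (k : Fin X.K) : X.N k ≤ X.m * X.nMax := by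
  refine (Finset.sum_le_card_nsmul _ _ _ fun j _ => le_nMax j).trans ?_
  rw [smul_eq_mul]
  exact Nat.mul_le_mul_right _ (clusterSize_le k)

section Pilot

variable {cw γ τ ε e α : ℝ} {ω : X.Ω} (hS : X.Setting M δ) (hα : 0 < α) (he : 0 < e)
  (hω : ∀ j, (X.n j : ℝ) ^ α * ‖X.θinit j ω - X.θstar j‖ < e) (hγ : 0 < γ) (hcw : 0 < cw)

include hS hα he hω hγ hcw

lemma le_weight_of_cluster_eq {j j' : Fin X.m} (hc : X.cluster j = X.cluster j') :
    ENNReal.ofReal (cw * (2 * e) ^ (-γ) * (X.nMin : ℝ) ^ (α * γ)) ≤ X.weight cw γ j j' ω := by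
  have hn : (0 : ℝ) < X.nMin := by exact_mod_cast nMin_pos hS j
  have h1 : ∀ i, ‖X.θinit i ω - X.θstar i‖ ≤ e * (X.nMin : ℝ) ^ (-α) := fun i => by
    have h2 : (X.nMin : ℝ) ^ α ≤ (X.n i : ℝ) ^ α :=
      Real.rpow_le_rpow hn.le (by exact_mod_cast nMin_le i) hα.le
    have h3 := (mul_le_mul_of_nonneg_right h2 (norm_nonneg _)).trans (hω i).le
    rw [Real.rpow_neg hn.le, ← div_eq_mul_inv, le_div_iff₀ (Real.rpow_pos_of_pos hn _), mul_comm]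
    exact h3
  have h2 : ‖X.θinit j ω - X.θinit j' ω‖ ≤ 2 * e * (X.nMin : ℝ) ^ (-α) := by
    have e1 : X.θinit j ω - X.θinit j' ω =
        (X.θinit j ω - X.θstar j) - (X.θinit j' ω - X.θstar j') := by
      rw [θstar, θstar, hc]; abel
    rw [e1]
    have := norm_sub_le (X.θinit j ω - X.θstar j) (X.θinit j' ω - X.θstar j')
    linarith [h1 j, h1 j']
  have hq : 0 < 2 * e * (X.nMin : ℝ) ^ (-α) := by
    have := Real.rpow_pos_of_pos hn (-α)
    positivity
  have h3 : ENNReal.ofReal ((2 * e * (X.nMin : ℝ) ^ (-α)) ^ (-γ)) ≤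
      ‖X.θinit j ω - X.θinit j' ω‖ₑ ^ (-γ) := by
    rw [← ENNReal.ofReal_rpow_of_pos hq, ← ofReal_norm]
    exact ENNReal.rpow_neg_anti (ENNReal.ofReal_le_ofReal h2) hγ.le
  have h4 : (2 * e * (X.nMin : ℝ) ^ (-α)) ^ (-γ) = (2 * e) ^ (-γ) * (X.nMin : ℝ) ^ (α * γ) := by
    rw [Real.mul_rpow (by positivity) (Real.rpow_nonneg hn.le _), ← Real.rpow_mul hn.le]
    congr 2
    ring
  rw [weight, mul_assoc, ENNReal.ofReal_mul hcw.le, ← h4]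
  gcongr

lemma weight_le_of_cluster_ne (hδ : 0 < δ) (heδ : 2 * e ≤ δ / 2) {j j' : Fin X.m}
    (hc : X.cluster j ≠ X.cluster j') :
    X.weight cw γ j j' ω ≤ ENNReal.ofReal (cw * (δ / 2) ^ (-γ)) := by
  have h1 : ∀ i, ‖X.θinit i ω - X.θstar i‖ ≤ e := fun i => by
    have h2 : (1 : ℝ) ≤ (X.n i : ℝ) ^ α :=
      Real.one_le_rpow (by exact_mod_cast hS.n_pos i) hα.le
    have := hω i
    nlinarith [norm_nonneg (X.θinit i ω - X.θstar i)]
  have h2 : δ / 2 ≤ ‖X.θinit j ω - X.θinit j' ω‖ := by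
    have h3 := hS.separation _ _ hc
    have e1 : X.β (X.cluster j) - X.β (X.cluster j') = (X.θinit j ω - X.θinit j' ω) -
        (X.θinit j ω - X.θstar j) + (X.θinit j' ω - X.θstar j') := by
      rw [θstar, θstar]; abel
    rw [e1] at h3
    have h4 := norm_add_le ((X.θinit j ω - X.θinit j' ω) - (X.θinit j ω - X.θstar j))
      (X.θinit j' ω - X.θstar j')
    have h5 := norm_sub_le (X.θinit j ω - X.θinit j' ω) (X.θinit j ω - X.θstar j)
    linarith [h1 j, h1 j']
  rw [weight, ENNReal.ofReal_mul hcw.le, ← ENNReal.ofReal_rpow_of_pos (by positivity)]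
  refine mul_le_mul_right ?_ _
  rw [← ofReal_norm]
  exact ENNReal.rpow_neg_anti (ENNReal.ofReal_le_ofReal h2) hγ.le

lemma le_penalty_of_cluster_eq {Λ : ℝ} (hΛ : Λ ≤ cw * (2 * e) ^ (-γ) * (X.nMin : ℝ) ^ (α * γ))
    (hτ0 : 0 < τ) (hτ : τ < cw * (2 * e) ^ (-γ) * (X.nMin : ℝ) ^ (α * γ)) {j j' : Fin X.m}
    (hc : X.cluster j = X.cluster j') : ENNReal.ofReal Λ ≤ X.penalty cw γ τ ε j j' ω := by
  have h1 := le_weight_of_cluster_eq hS hα he hω hγ hcw hc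
  rw [penalty, if_neg]
  · exact (ENNReal.ofReal_le_ofReal hΛ).trans h1
  · exact not_le.2 (((ENNReal.ofReal_lt_ofReal_iff (hτ0.trans hτ)).2 hτ).trans_le h1)

lemma penalty_of_cluster_ne (hδ : 0 < δ) (heδ : 2 * e ≤ δ / 2) (hτ : cw * (δ / 2) ^ (-γ) ≤ τ)
    {j j' : Fin X.m} (hc : X.cluster j ≠ X.cluster j') :
    X.penalty cw γ τ ε j j' ω = ENNReal.ofReal ε := by
  rw [penalty, if_pos]
  exact (weight_le_of_cluster_ne hS hα he hω hγ hcw hδ heδ hc).trans (ENNReal.ofReal_le_ofReal hτ)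

end Pilot

/-- Realizations on which the empirical losses behave well; `k` is the cluster of interest. -/
structure WellBehaved (X : Experiment.{u, v, w} d) (M ν c x y R : ℝ) (k : Fin X.K) (ω : X.Ω) :
    Prop where
  linearizable : X.Linearizable M ν (c / X.m) ω
  taskScore_le : ∀ j, ‖X.taskScore j ω‖ ≤ X.n j
  scoreSum_le : ∀ k, ‖X.scoreSum k ω‖ ≤ x * X.N k / X.m
  nuisanceEffect_le : ∀ j, ‖X.nuisanceEffect j ω‖ ≤ x * X.n j / X.m
  sum_nuisanceEffect_le : ∑ j with X.cluster j = k, ‖X.nuisanceEffect j ω‖ ≤ y * Real.sqrt (X.N k)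
  normScore_le : ‖X.normScore k ω‖ ≤ R

section WellBehaved

variable {ν c x y R : ℝ} {k : Fin X.K} {ω : X.Ω} (h : X.WellBehaved M ν c x y R k ω)

include h

lemma WellBehaved.sum_nuisanceEffect_le' (k' : Fin X.K) :
    ∑ j with X.cluster j = k', ‖X.nuisanceEffect j ω‖ ≤ x * X.N k' / X.m := by
  refine (Finset.sum_le_sum fun j _ => h.nuisanceEffect_le j).trans (le_of_eq ?_)
  rw [← Finset.sum_div, ← Finset.mul_sum, N, Nat.cast_sum]

variable (hS : X.Setting M δ) (hL : X.LossRegularity M ρ κ σ₁ σ₂ σ₃ σ₅ r₁ r₂) (hM : 0 < M)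
  (hρ : 0 < ρ) (hr₁ : 2 < r₁) (hr₂ : 2 < r₂) (hν0 : 0 ≤ ν) (hν : ν ≤ ρ / 2) (hc : 0 < c)
  (hcM : c ≤ M) (hx : x = c * ρ / 8)

include hS hL hM hρ hr₁ hr₂ hν0 hν hc hcM hx

lemma WellBehaved.remainder_fusion_le (hcδ : 2 * c < δ) (hx1 : x ≤ 1) {cw γ τ ε Λ : ℝ} (hε : 0 ≤ ε)
    (hsame : ∀ j j', X.cluster j = X.cluster j' → ENNReal.ofReal Λ ≤ X.penalty cw γ τ ε j j' ω)
    (hdiff : ∀ j j', X.cluster j ≠ X.cluster j' → X.penalty cw γ τ ε j j' ω = ENNReal.ofReal ε)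
    (hε1 : ∀ k, ε * X.m * X.clusterSize k ≤ x * X.N k / X.m)
    (hε2 : ε * X.m * X.clusterSize k ≤ y * Real.sqrt (X.N k))
    (hΛ : (2 + (|κ| + ρ) * M) * X.nMax + ε * X.m ≤ Λ) {ϑ : Fin X.m → Euc d}
    (hmin : (argminOn (X.objective cw γ τ ε ω) {ϑ | ∀ j, ϑ j ∈ X.Θ}).Nonempty →
      ϑ ∈ argminOn (X.objective cw γ τ ε ω) {ϑ | ∀ j, ϑ j ∈ X.Θ}) {j : Fin X.m}
    (hj : X.cluster j = k) :
    ‖X.normScore k ω + X.psiOp k (Real.sqrt (X.N k) • (ϑ j - X.θstar j))‖ ≤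
      ν * (2 / ρ * (R + 2 * y)) + 2 * y := by
  subst hj
  have hm := m_pos_of_task j
  have hm0 : (0 : ℝ) < X.m := one_pos.trans_le hm
  have hr0 : 0 < c / X.m := by positivity
  have hrc : c / X.m ≤ c := div_le_self hc.le hm
  have hN : (0 : ℝ) < X.N (X.cluster j) := by exact_mod_cast N_pos hS _
  have hΛ0 : 0 ≤ Λ := le_trans (by positivity) hΛ
  obtain ⟨hb, hq⟩ := h.linearizable.fusion_estimator hS hL hM hρ hν0 hν hr0 (hrc.trans hcM) hr₁ hr₂
    (by linarith) hε hΛ0 hsame hdiff (fun k' => by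
      have hN' : (0 : ℝ) < X.N k' := by exact_mod_cast N_pos hS _
      have h1 := h.scoreSum_le k'
      have h2 := h.sum_nuisanceEffect_le' k'
      have h3 := hε1 k'
      have h4 : c / X.m * (ρ / 2) * X.N k' = 4 * (x * X.N k' / X.m) := by rw [hx]; ring
      have h5 : 0 < x * X.N k' / X.m := by rw [hx]; positivity
      linarith) (fun i => by
      have h1 := h.taskScore_le i
      have h2 := h.nuisanceEffect_le i
      have hn : (X.n i : ℝ) ≤ X.nMax := by exact_mod_cast le_nMax i
      have hx0 : 0 ≤ x := by rw [hx]; positivity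
      have h3 : x * X.n i / X.m ≤ X.n i := by
        rw [div_le_iff₀ hm0]
        have : (0 : ℝ) ≤ X.n i := by positivity
        nlinarith
      have h4 : (|κ| + ν) * (c / X.m) * X.n i ≤ (|κ| + ρ) * M * X.n i := by
        have : c / X.m ≤ M := hrc.trans hcM
        have : ν ≤ ρ := by linarith
        gcongr
      have h5 : (2 + (|κ| + ρ) * M) * X.n i ≤ (2 + (|κ| + ρ) * M) * X.nMax := by gcongr
      linarith) hmin j
  refine (h.linearizable.remainder_le hS hL hM hρ hν0 hν hr0.le _ hb hq
    h.sum_nuisanceEffect_le).trans ?_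
  have hs := Real.sqrt_pos.2 hN
  have h1 : (ε * X.m * X.clusterSize (X.cluster j) + y * Real.sqrt (X.N (X.cluster j))) /
      Real.sqrt (X.N (X.cluster j)) ≤ 2 * y := by
    rw [div_le_iff₀ hs]
    linarith
  have := h.normScore_le
  gcongr

lemma WellBehaved.remainder_oracle_le (hy : 0 ≤ y) {ϑ : Euc d}
    (hmin : (argminOn (fun θ => X.clusterLoss k θ (fun j => X.ηhat j ω) ω) X.Θ).Nonempty →
      ϑ ∈ argminOn (fun θ => X.clusterLoss k θ (fun j => X.ηhat j ω) ω) X.Θ) :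
    ‖X.normScore k ω + X.psiOp k (Real.sqrt (X.N k) • (ϑ - X.β k))‖ ≤
      ν * (2 / ρ * (R + 2 * y)) + 2 * y := by
  obtain ⟨j, hj⟩ := hS.cluster_surjective k
  have hm := m_pos_of_task j
  have hm0 : (0 : ℝ) < X.m := one_pos.trans_le hm
  have hr0 : 0 < c / X.m := by positivity
  have hrc : c / X.m ≤ c := div_le_self hc.le hm
  have hN : (0 : ℝ) < X.N k := by exact_mod_cast N_pos hS _
  obtain ⟨hb, hq⟩ := h.linearizable.oracle_estimator hS hL hM hρ hν0 hν hr0 (hrc.trans hcM) hr₁ hr₂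
    k (by
      have h1 := h.scoreSum_le k
      have h2 := h.sum_nuisanceEffect_le' k
      have h4 : c / X.m * (ρ / 2) * X.N k = 4 * (x * X.N k / X.m) := by rw [hx]; ring
      have h5 : 0 < x * X.N k / X.m := by rw [hx]; positivity
      linarith) hmin
  refine (h.linearizable.remainder_le hS hL hM hρ hν0 hν hr0.le _ hb hq
    h.sum_nuisanceEffect_le).trans ?_
  have hs := Real.sqrt_pos.2 hN
  have h1 : (0 + y * Real.sqrt (X.N k)) / Real.sqrt (X.N k) ≤ 2 * y := by
    rw [zero_add, mul_div_cancel_right₀ _ hs.ne']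
    linarith
  have := h.normScore_le
  gcongr

end WellBehaved

/-- Bad realizations are rare. -/
lemma measure_not_wellBehaved_le (hS : X.Setting M δ)
    (hL : X.LossRegularity M ρ κ σ₁ σ₂ σ₃ σ₅ r₁ r₂) (hM : 0 < M) (hr₁ : 2 < r₁) (hr₂ : 2 < r₂)
    {A C : ℝ} {S : Fin X.m → ℝ} (hA : X.LargeSamples A S) (hC : 0 ≤ C)
    (hmse : ∀ j, ∫⁻ ω, ‖X.ηhat j ω - X.ηstar j‖ₑ ^ 2 ∂X.μ ≤ ENNReal.ofReal (C / S j ^ 2))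
    {ν c x y R t : ℝ} (hν : 0 < ν) (hc : 0 < c) (hcM : c ≤ M) (hx : 0 < x) (hy : 0 < y) (hR : 0 < R)
    {k : Fin X.K} (hb : ∀ j, X.cluster j = k →
      Real.sqrt (X.clusterSize k) * (Real.sqrt (X.n j) / S j ^ 2) ≤ t) :
    X.μ {ω | ¬ X.WellBehaved M ν c x y R k ω} ≤ X.μ {ω | ∃ j, X.ηhat j ω ∉ X.T j} +
      ENNReal.ofReal ((C / M ^ 2 + d * (d * (18 * (1 + |σ₂|))) * (3 * (d + 1) / ν) ^ 2 +
        3 * |σ₃| / ν * Real.sqrt C) / A + 3 * |σ₃| / ν * c) +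
      ENNReal.ofReal ((1 + |σ₁|) / A) +
      ENNReal.ofReal (X.K * ((1 + |σ₁|) / (x ^ 2 * A ^ 2))) +
      ENNReal.ofReal ((|σ₅| * C + 2 * Real.sqrt (|σ₅| * C)) / (x * A)) +
      ENNReal.ofReal ((|σ₅| * C * t + 2 * Real.sqrt (|σ₅| * C) / A) / y) +
      ENNReal.ofReal ((1 + |σ₁|) / R ^ 2) := by
  refine le_trans (measure_mono (t := (((((_ ∪ _) ∪ _) ∪ _) ∪ _) ∪ _)) fun ω hω => ?_)
    ((measure_union_le _ _).trans (add_le_add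
    ((measure_union_le _ _).trans (add_le_add ((measure_union_le _ _).trans (add_le_add
    ((measure_union_le _ _).trans (add_le_add ((measure_union_le _ _).trans (add_le_add
      (measure_not_linearizable_le hS hL hM hr₁ hr₂ hA hC hmse hν hc hcM)
      (measure_taskScore_gt_le hS hL hM hr₁ hr₂ hA)))
      (measure_scoreSum_gt_le hS hL hM hr₁ hr₂ hA hx)))
      (measure_nuisanceEffect_gt_le hS hL hM hr₁ hr₂ hA hC hmse hx)))
      (measure_sum_nuisanceEffect_gt_le hS hL hM hr₁ hr₂ hA hC hmse k hb hy)))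
      (measure_normScore_gt_le hS hL hM hr₁ hr₂ k hR)))
  contrapose hω
  simp only [Set.mem_union, Set.mem_ofPred_eq, not_or, not_exists, not_not, not_lt] at hω ⊢
  obtain ⟨⟨⟨⟨⟨h1, h2⟩, h3⟩, h4⟩, h5⟩, h6⟩ := hω
  exact ⟨h1, h2, h3, h4, h5, h6⟩

end Experiment
end

noncomputable section

lemma norm_cexp_mul_I_sub_cexp_le (a b : ℝ) :
    ‖Complex.exp (a * Complex.I) - Complex.exp (b * Complex.I)‖ ≤ |a - b| := by
  have h1 : Complex.exp (a * Complex.I) - Complex.exp (b * Complex.I) =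
      Complex.exp (b * Complex.I) * (Complex.exp (Complex.I * (a - b : ℝ)) - 1) := by
    rw [mul_sub, ← Complex.exp_add, mul_one]
    congr 2
    push_cast
    ring
  rw [h1, norm_mul, Complex.norm_exp_ofReal_mul_I, one_mul]
  exact Real.norm_exp_I_mul_ofReal_sub_one_le

/-- Two random vectors whose projections are close with high probability have close
characteristic functions. -/
lemma norm_integral_cexp_sub_le {α : Type*} [MeasurableSpace α] {μ : Measure α}
    [IsProbabilityMeasure μ] {a b : α → ℝ} (ha : Measurable a) (hb : Measurable b) {s : Set α}
    (hs : MeasurableSet s) {e : ℝ} (he : 0 ≤ e) (h : ∀ ω, ω ∉ s → |a ω - b ω| ≤ e) :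
    ‖∫ ω, Complex.exp (a ω * Complex.I) ∂μ - ∫ ω, Complex.exp (b ω * Complex.I) ∂μ‖ ≤
      e + 2 * μ.real s := by
  have hi : ∀ {f : α → ℝ}, Measurable f → Integrable (fun ω => Complex.exp (f ω * Complex.I)) μ :=
    fun {f} hf => by
      refine (integrable_const (1 : ℝ)).mono' ?_ (Eventually.of_forall fun ω => ?_)
      · exact (Complex.measurable_exp.comp
          ((Complex.measurable_ofReal.comp hf).mul_const _)).aestronglyMeasurable
      · rw [Complex.norm_exp_ofReal_mul_I]
  rw [← integral_sub (hi ha) (hi hb)]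
  have hbd : ∀ ω, ‖Complex.exp (a ω * Complex.I) - Complex.exp (b ω * Complex.I)‖ ≤
      e + 2 * s.indicator 1 ω := fun ω => by
    by_cases hω : ω ∈ s
    · rw [Set.indicator_of_mem hω]
      refine (norm_sub_le _ _).trans ?_
      rw [Complex.norm_exp_ofReal_mul_I, Complex.norm_exp_ofReal_mul_I]
      simp only [Pi.one_apply]
      linarith
    · rw [Set.indicator_of_notMem hω, mul_zero, add_zero]
      exact (norm_cexp_mul_I_sub_cexp_le _ _).trans (h ω hω)
  have hind : Integrable (s.indicator (1 : α → ℝ)) μ :=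
    (integrable_const (1 : ℝ)).indicator hs
  refine (norm_integral_le_of_norm_le ((integrable_const e).add (hind.const_mul 2))
    (Eventually.of_forall hbd)).trans (le_of_eq ?_)
  simp only [Pi.add_apply]
  rw [integral_add (integrable_const e) (hind.const_mul 2), integral_const_mul,
    integral_indicator_one hs]
  simp

namespace Experiment

variable {d : ℕ} {X : Experiment.{u, v, w} d} {M δ ρ κ σ₁ σ₂ σ₃ σ₅ r₁ r₂ : ℝ}

section Single

variable (hS : X.Setting M δ) (hL : X.LossRegularity M ρ κ σ₁ σ₂ σ₃ σ₅ r₁ r₂) (hρ : 0 < ρ)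
  (hM : 0 < M) (hr₁ : 2 < r₁) (hr₂ : 2 < r₂) (k : Fin X.K)

/-- `Ψ_k⁻¹ t`. -/
def psiInv (X : Experiment.{u, v, w} d) (k : Fin X.K) (t : Euc d) : Euc d :=
  WithLp.toLp 2 ((X.Psi k)⁻¹.mulVec t.ofLp)

include hS hL hρ hM hr₁ hr₂

lemma psiOp_psiInv (t : Euc d) : X.psiOp k (X.psiInv k t) = t := by
  have h1 := toLp_Psi_mulVec hS hL hM hr₁ hr₂ k (X.psiInv k t)
  have hu : IsUnit (X.Psi k).det :=
    (Matrix.isUnit_iff_isUnit_det _).1 (posDef_Psi hS hL hρ hM hr₁ hr₂ k).isUnit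
  rw [psiInv, Matrix.mulVec_mulVec, Matrix.mul_nonsing_inv _ hu, Matrix.one_mulVec] at h1
  exact (WithLp.ofLp_injective 2 h1).symm

lemma norm_psiInv_le (t : Euc d) : ‖X.psiInv k t‖ ≤ ‖t‖ / ρ := by
  have h1 := le_inner_psiOp hS hL hM k (X.psiInv k t)
  rw [psiOp_psiInv hS hL hρ hM hr₁ hr₂] at h1
  have h2 := h1.trans (real_inner_le_norm _ _)
  rw [le_div_iff₀ hρ]
  rcases (norm_nonneg (X.psiInv k t)).eq_or_lt with h0 | h0
  · rw [← h0, zero_mul]; positivity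
  · refine le_of_mul_le_mul_left (le_trans (le_of_eq ?_) h2) h0
    ring

lemma dotProduct_asymptoticCov (t : Euc d) :
    t.ofLp ⬝ᵥ (X.asymptoticCov k).mulVec t.ofLp =
      (X.psiInv k t).ofLp ⬝ᵥ (X.Omega k).mulVec (X.psiInv k t).ofLp := by
  have hP := (posDef_Psi hS hL hρ hM hr₁ hr₂ k).isHermitian.inv
  have hT : Matrix.transpose (X.Psi k)⁻¹ = (X.Psi k)⁻¹ := by
    have := hP.eq
    rwa [Matrix.conjTranspose_eq_transpose_of_trivial] at this
  rw [asymptoticCov, ← Matrix.mulVec_mulVec, ← Matrix.mulVec_mulVec, Matrix.dotProduct_mulVec,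
    ← Matrix.mulVec_transpose, hT]
  rfl

lemma posSemidef_asymptoticCov : (X.asymptoticCov k).PosSemidef := by
  have hP := (posDef_Psi hS hL hρ hM hr₁ hr₂ k).isHermitian.inv
  have := (posSemidef_Omega hS hL hM hr₁ hr₂ k).mul_mul_conjTranspose_same (X.Psi k)⁻¹
  rwa [hP.eq] at this

lemma asymptoticCov_quadratic_le (t : Euc d) :
    t.ofLp ⬝ᵥ (X.asymptoticCov k).mulVec t.ofLp ≤ (1 + |σ₁|) / ρ ^ 2 * ‖t‖ ^ 2 := by
  rw [dotProduct_asymptoticCov hS hL hρ hM hr₁ hr₂]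
  refine (Omega_quadratic_le hS hL hM hr₁ hr₂ k _).trans ?_
  have := norm_psiInv_le hS hL hρ hM hr₁ hr₂ k t
  calc (1 + |σ₁|) * ‖X.psiInv k t‖ ^ 2 ≤ (1 + |σ₁|) * (‖t‖ / ρ) ^ 2 := by gcongr
    _ = _ := by rw [div_pow]; ring

/-- Random vectors that are almost linear in the normalized score are nearly Gaussian. -/
lemma norm_charFun_sub_le {Y : X.Ω → Euc d} (hY : Measurable Y) (t : Euc d) {e : ℝ} (he : 0 ≤ e)
    {p : ℝ} (hp : 2 ≤ p) (hp' : p ≤ 3) (hpr : p ≤ r₁) :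
    ‖charFun (X.μ.map Y) t - charFun (multivariateGaussian 0 (X.asymptoticCov k)) t‖ ≤
      ‖t‖ / ρ * e + 2 * X.μ.real {ω | e < ‖X.normScore k ω + X.psiOp k (Y ω)‖} +
      (4 * ((‖t‖ / ρ) ^ p * (1 + |σ₁|)) * (X.N k : ℝ) ^ (1 - p / 2) +
        ((‖t‖ / ρ) ^ 2 * (1 + |σ₁|)) ^ 2 * (X.N k : ℝ) ^ (-1 : ℝ)) := by
  set x := X.psiInv k t with hx
  have hxn : ‖x‖ ≤ ‖t‖ / ρ := norm_psiInv_le hS hL hρ hM hr₁ hr₂ k t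
  have hgm : Measurable (X.normScore k) :=
    (measurable_scoreSum hS hL hM k).const_smul (Real.sqrt (X.N k))⁻¹
  have hRm : Measurable fun ω => X.normScore k ω + X.psiOp k (Y ω) :=
    hgm.add ((X.psiOp k).continuous.measurable.comp hY)
  have hbad : MeasurableSet {ω | e < ‖X.normScore k ω + X.psiOp k (Y ω)‖} :=
    measurableSet_lt measurable_const hRm.norm
  have h1 := norm_integral_cexp_sub_le (μ := X.μ) (a := fun ω => inner ℝ (Y ω) t)
    (b := fun ω => inner ℝ (-x) (X.normScore k ω)) (hY.inner measurable_const)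
    (measurable_const.inner hgm) hbad (e := ‖t‖ / ρ * e) (by positivity) (fun ω hω => by
      simp only [Set.mem_ofPred_eq, not_lt] at hω
      have h2 : inner ℝ (Y ω) t - inner ℝ (-x) (X.normScore k ω) =
          inner ℝ x (X.normScore k ω + X.psiOp k (Y ω)) := by
        conv_lhs => rw [← psiOp_psiInv hS hL hρ hM hr₁ hr₂ k t]
        rw [← hx, psiOp_symm hS hL hM hr₁ hr₂, inner_neg_left, inner_add_right]
        ring
      rw [h2]
      exact (abs_real_inner_le_norm _ _).trans (mul_le_mul hxn hω (norm_nonneg _) (by positivity)))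
  have h3 := norm_charFun_normScore_sub_le hS hL hM hr₁ hr₂ k (-x) hp hp' hpr
  have h4 : charFun (X.μ.map Y) t = ∫ ω, Complex.exp ((inner ℝ (Y ω) t : ℝ) * Complex.I) ∂X.μ := by
    rw [charFun_apply, integral_map hY.aemeasurable]
    exact (by fun_prop : Continuous fun y : Euc d =>
      Complex.exp ((inner ℝ y t : ℝ) * Complex.I)).aestronglyMeasurable
  have h5 : charFun (multivariateGaussian 0 (X.asymptoticCov k)) t =
      Real.exp (-((-x).ofLp ⬝ᵥ (X.Omega k).mulVec (-x).ofLp) / 2) := by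
    rw [charFun_multivariateGaussian (posSemidef_asymptoticCov hS hL hρ hM hr₁ hr₂ k),
      dotProduct_asymptoticCov hS hL hρ hM hr₁ hr₂]
    simp only [inner_zero_right, Complex.ofReal_zero, zero_mul, zero_sub, ← hx, WithLp.ofLp_neg,
      Matrix.mulVec_neg, dotProduct_neg, neg_dotProduct, neg_neg]
    push_cast
    ring_nf
  rw [h4, h5]
  refine (norm_sub_le_norm_sub_add_norm_sub _
    (∫ ω, Complex.exp ((inner ℝ (-x) (X.normScore k ω) : ℝ) * Complex.I) ∂X.μ) _).trans ?_
  refine add_le_add h1 (h3.trans ?_)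
  rw [norm_neg]
  have : ‖x‖ ^ p ≤ (‖t‖ / ρ) ^ p := Real.rpow_le_rpow (norm_nonneg _) hxn (by linarith)
  gcongr

end Single

/-- Random vectors that are asymptotically linear in the normalized score are asymptotically
normal. -/
lemma asymptoticallyNormal_of_linear {X : ℕ → Experiment.{u, v, w} d}
    (hS : ∀ n, (X n).Setting M δ) (hL : ∀ n, (X n).LossRegularity M ρ κ σ₁ σ₂ σ₃ σ₅ r₁ r₂)
    (hρ : 0 < ρ) (hM : 0 < M) (hr₁ : 2 < r₁) (hr₂ : 2 < r₂) {k : ∀ n, Fin (X n).K}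
    (hN : Tendsto (fun n => ((X n).N (k n) : ℝ)) atTop atTop) {Y : ∀ n, (X n).Ω → Euc d}
    (hY : ∀ n, Measurable (Y n))
    (hlin : ∀ e : ℝ, 0 < e → Tendsto (fun n => (X n).μ {ω | e < ‖(X n).normScore (k n) ω +
      (X n).psiOp (k n) (Y n ω)‖}) atTop (𝓝 0)) :
    AsymptoticallyNormal X Y fun n => (X n).asymptoticCov (k n) := by
  intro g
  have hprob : ∀ n, IsProbabilityMeasure ((X n).μ.map (Y n)) := fun n =>
    Measure.isProbabilityMeasure_map (hY n).aemeasurable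
  have key := tendsto_integral_sub_gaussian (μ := fun n => (X n).μ.map (Y n))
    (fun n => posSemidef_asymptoticCov (hS n) (hL n) hρ hM hr₁ hr₂ (k n))
    (fun n t => asymptoticCov_quadratic_le (hS n) (hL n) hρ hM hr₁ hr₂ (k n) t) (fun t => ?_) g
  · refine key.congr fun n => ?_
    rw [integral_map (hY n).aemeasurable g.continuous.aestronglyMeasurable]
  set p := min r₁ 3 with hp
  have hp2 : 2 < p := lt_min hr₁ (by norm_num)
  have hlim : Tendsto (fun n => 4 * ((‖t‖ / ρ) ^ p * (1 + |σ₁|)) *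
      ((X n).N (k n) : ℝ) ^ (1 - p / 2) +
        ((‖t‖ / ρ) ^ 2 * (1 + |σ₁|)) ^ 2 * ((X n).N (k n) : ℝ) ^ (-1 : ℝ)) atTop (𝓝 0) := by
    have a1 : Tendsto (fun n => ((X n).N (k n) : ℝ) ^ (1 - p / 2)) atTop (𝓝 0) := by
      have := (tendsto_rpow_neg_atTop (y := p / 2 - 1) (by linarith)).comp hN
      refine this.congr fun n => ?_
      simp only [Function.comp]
      congr 1
      ring
    have a2 : Tendsto (fun n => ((X n).N (k n) : ℝ) ^ (-1 : ℝ)) atTop (𝓝 0) :=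
      (tendsto_rpow_neg_atTop one_pos).comp hN
    simpa using (a1.const_mul _).add (a2.const_mul _)
  rw [Metric.tendsto_nhds]
  intro e he
  set e' := e / (3 * (‖t‖ / ρ + 1)) with he'
  have hden : 0 < ‖t‖ / ρ + 1 := by positivity
  have he0 : 0 < e' := by positivity
  have hb1 : ‖t‖ / ρ * e' ≤ e / 3 := by
    calc ‖t‖ / ρ * e' ≤ (‖t‖ / ρ + 1) * e' := by gcongr; linarith
      _ = _ := by rw [he']; field_simp
  have hb2 : Tendsto (fun n => 2 * (X n).μ.real {ω | e' < ‖(X n).normScore (k n) ω +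
      (X n).psiOp (k n) (Y n ω)‖}) atTop (𝓝 0) := by
    have := (ENNReal.tendsto_toReal ENNReal.zero_ne_top).comp (hlin e' he0)
    simpa [Measure.real] using this.const_mul 2
  filter_upwards [hlim.eventually (gt_mem_nhds (by positivity : (0 : ℝ) < e / 3)),
    hb2.eventually (gt_mem_nhds (by positivity : (0 : ℝ) < e / 3))] with n h1 h2
  rw [dist_zero_right]
  have := norm_charFun_sub_le (hS n) (hL n) hρ hM hr₁ hr₂ (k n) (hY n) t he0.le hp2.le
    (min_le_right _ _) (min_le_left _ _)
  linarith

end Experiment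
end

noncomputable section

namespace Experiment

section Tuning

variable {d : ℕ} {X : Experiment.{u, v, w} d} {M δ : ℝ} (hS : X.Setting M δ) {A : ℝ}
  {S : Fin X.m → ℝ} (hA : X.LargeSamples A S) {c₁ ζ ε : ℝ} (hc₁ : 0 < c₁) (hζ : ζ < 1 / 2)
  (hε : ε ≤ c₁ * (X.m : ℝ) ^ (-2 : ℝ) * (X.NMin : ℝ) ^ ζ) (j : Fin X.m)

include hS j in
lemma one_le_NMin : (1 : ℝ) ≤ X.NMin := by
  obtain ⟨k, hk⟩ := exists_NMin_eq (X.cluster j)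
  rw [hk]
  exact_mod_cast N_pos hS k

include hA hS j in
lemma LargeSamples.le_NMin : A ≤ X.NMin := by
  obtain ⟨k, hk⟩ := exists_NMin_eq (X.cluster j)
  rw [hk]
  have h1 := hA.le_N hS k
  have h2 := hA.one_le
  have h3 := m_pos_of_task j
  have h4 : A ≤ A * X.m := le_mul_of_one_le_right hA.pos.le h3
  nlinarith

include hε j in
lemma fusion_weight_le : ε * X.m ≤ c₁ * (X.NMin : ℝ) ^ ζ / X.m := by
  have hm : (0 : ℝ) < X.m := one_pos.trans_le (m_pos_of_task j)
  have e : (X.m : ℝ) ^ (-2 : ℝ) = ((X.m : ℝ) ^ 2)⁻¹ := by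
    rw [Real.rpow_neg hm.le]
    norm_cast
  rw [e] at hε
  rw [le_div_iff₀ hm]
  calc ε * X.m * X.m ≤ (c₁ * ((X.m : ℝ) ^ 2)⁻¹ * (X.NMin : ℝ) ^ ζ) * X.m * X.m := by gcongr
    _ = _ := by field_simp

include hS hζ j in
lemma NMin_rpow_le (k : Fin X.K) : (X.NMin : ℝ) ^ ζ ≤ Real.sqrt (X.N k) := by
  refine (Real.rpow_le_rpow_of_exponent_le (one_le_NMin hS j) hζ.le).trans ?_
  rw [← Real.sqrt_eq_rpow]
  exact Real.sqrt_le_sqrt (by exact_mod_cast NMin_le k)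

include hS hA hc₁ hζ hε j in
lemma fusion_weight_cluster_le {x : ℝ} (hx : c₁ ≤ x * A) (k : Fin X.K) :
    ε * X.m * X.clusterSize k ≤ x * X.N k / X.m := by
  have hm : (0 : ℝ) < X.m := one_pos.trans_le (m_pos_of_task j)
  have h1 := fusion_weight_le hε j
  have h2 := NMin_rpow_le hS hζ j k
  have h3 : (X.clusterSize k : ℝ) ≤ X.m := by exact_mod_cast clusterSize_le k
  have h4 : A * X.m ≤ Real.sqrt (X.N k) := by
    rw [Real.le_sqrt (by have := hA.pos; positivity) (by positivity)]
    exact hA.le_N hS k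
  have hs : 0 ≤ Real.sqrt (X.N k) := Real.sqrt_nonneg _
  have hA0 := hA.pos
  have hx0 : 0 ≤ x := by
    by_contra! hneg
    nlinarith
  rw [le_div_iff₀ hm]
  calc ε * X.m * X.clusterSize k * X.m
      ≤ (c₁ * (X.NMin : ℝ) ^ ζ / X.m) * X.clusterSize k * X.m := by gcongr
    _ = c₁ * (X.NMin : ℝ) ^ ζ * X.clusterSize k := by field_simp
    _ ≤ (x * A) * Real.sqrt (X.N k) * X.m := by gcongr
    _ = x * Real.sqrt (X.N k) * (A * X.m) := by ring
    _ ≤ x * Real.sqrt (X.N k) * Real.sqrt (X.N k) := by gcongr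
    _ = x * X.N k := by rw [mul_assoc, Real.mul_self_sqrt (by positivity)]

include hS hc₁ hε j in
lemma fusion_weight_root_le {y : ℝ} (hy : c₁ * (X.NMin : ℝ) ^ (ζ - 1 / 2) ≤ y) (k : Fin X.K) :
    ε * X.m * X.clusterSize k ≤ y * Real.sqrt (X.N k) := by
  have hm : (0 : ℝ) < X.m := one_pos.trans_le (m_pos_of_task j)
  have hN : (0 : ℝ) < X.NMin := one_pos.trans_le (one_le_NMin hS j)
  have h1 := fusion_weight_le hε j
  have h3 : (X.clusterSize k : ℝ) ≤ X.m := by exact_mod_cast clusterSize_le k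
  have h4 : Real.sqrt X.NMin ≤ Real.sqrt (X.N k) :=
    Real.sqrt_le_sqrt (by exact_mod_cast NMin_le k)
  have h5 : (X.NMin : ℝ) ^ ζ = (X.NMin : ℝ) ^ (ζ - 1 / 2) * Real.sqrt X.NMin := by
    rw [Real.sqrt_eq_rpow, ← Real.rpow_add hN]
    congr 1
    ring
  have h6 : 0 ≤ c₁ * (X.NMin : ℝ) ^ (ζ - 1 / 2) := by positivity
  calc ε * X.m * X.clusterSize k
      ≤ (c₁ * (X.NMin : ℝ) ^ ζ / X.m) * X.clusterSize k := by gcongr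
    _ ≤ (c₁ * (X.NMin : ℝ) ^ ζ / X.m) * X.m := by gcongr
    _ = c₁ * (X.NMin : ℝ) ^ (ζ - 1 / 2) * Real.sqrt X.NMin := by rw [h5]; field_simp
    _ ≤ y * Real.sqrt (X.N k) := by
        have := h6.trans hy
        gcongr

include hS hc₁ hζ hε j in
lemma fusion_weight_le_nMax : ε * X.m ≤ c₁ * X.nMax := by
  have hm1 := m_pos_of_task j
  have hm : (0 : ℝ) < X.m := one_pos.trans_le hm1
  have hn1 : (1 : ℝ) ≤ X.nMax := by
    have : 1 ≤ X.nMax := (hS.n_pos j).trans_le (le_nMax j)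
    exact_mod_cast this
  have h1 := fusion_weight_le hε j
  have h2 := NMin_rpow_le hS hζ j (X.cluster j)
  have h3 : Real.sqrt (X.N (X.cluster j)) ≤ X.m * X.nMax := by
    rw [Real.sqrt_le_left (by positivity)]
    have h4 : (X.N (X.cluster j) : ℝ) ≤ X.m * X.nMax := by exact_mod_cast N_le _
    have h5 : (1 : ℝ) ≤ X.m * X.nMax := by nlinarith
    nlinarith
  refine h1.trans ?_
  rw [div_le_iff₀ hm]
  calc c₁ * (X.NMin : ℝ) ^ ζ ≤ c₁ * (X.m * X.nMax) := by
        have := h2.trans h3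
        gcongr
    _ = _ := by ring

end Tuning

lemma exists_pilot_radius {δ cw γ B : ℝ} (hδ : 0 < δ) (hcw : 0 < cw) (hγ : 0 < γ) :
    ∃ e : ℝ, 0 < e ∧ 2 * e ≤ δ / 2 ∧ B ≤ cw * (2 * e) ^ (-γ) := by
  set D := (|B| + 1) / cw with hD
  have hD0 : 0 < D := by positivity
  have hr : 0 < D ^ (-γ⁻¹) := Real.rpow_pos_of_pos hD0 _
  have he : 0 < min (D ^ (-γ⁻¹) / 2) (δ / 4) := lt_min (by positivity) (by positivity)
  refine ⟨min (D ^ (-γ⁻¹) / 2) (δ / 4), he, ?_, ?_⟩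
  · linarith [min_le_right (D ^ (-γ⁻¹) / 2) (δ / 4)]
  · have h1 : D ≤ (2 * min (D ^ (-γ⁻¹) / 2) (δ / 4)) ^ (-γ) := by
      calc D = (D ^ (-γ⁻¹)) ^ (-γ) := by
            rw [← Real.rpow_mul hD0.le, neg_mul_neg, inv_mul_cancel₀ hγ.ne', Real.rpow_one]
        _ ≤ _ := by
            refine Real.rpow_le_rpow_of_nonpos (by linarith) ?_ (by linarith)
            linarith [min_le_left (D ^ (-γ⁻¹) / 2) (δ / 4)]
    calc B ≤ cw * D := by
          rw [hD, mul_div_cancel₀ _ hcw.ne']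
          linarith [le_abs_self B]
      _ ≤ _ := by gcongr

lemma exists_constants {M δ ρ e t : ℝ} (σ₁ σ₃ : ℝ) (hM : 0 < M) (hδ : 0 < δ) (hρ : 0 < ρ)
    (he : 0 < e) (ht : 0 < t) :
    ∃ R y ν c : ℝ, 0 < R ∧ 0 < y ∧ 0 < ν ∧ 0 < c ∧ ν ≤ ρ / 2 ∧ c ≤ M ∧ 2 * c < δ ∧
      c * ρ / 8 ≤ 1 ∧ (1 + |σ₁|) / R ^ 2 ≤ t ∧ 3 * |σ₃| / ν * c ≤ t ∧
      ν * (2 / ρ * (R + 2 * y)) + 2 * y ≤ e := by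
  set R := Real.sqrt ((1 + |σ₁|) / t) with hR
  have hR0 : 0 < R := Real.sqrt_pos.2 (by positivity)
  set y := e / 8 with hy
  have hy0 : 0 < y := by positivity
  set ν := min (ρ / 2) (e * ρ / (8 * (R + 2 * y))) with hν
  have hν0 : 0 < ν := lt_min (by positivity) (by positivity)
  set c := min (min M (δ / 4)) (min (8 / ρ) (t * ν / (3 * |σ₃| + 1))) with hc
  have hc0 : 0 < c := lt_min (lt_min hM (by positivity)) (lt_min (by positivity) (by positivity))
  have c1 : c ≤ M := (min_le_left _ _).trans (min_le_left _ _)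
  have c2 : c ≤ δ / 4 := (min_le_left _ _).trans (min_le_right _ _)
  have c3 : c ≤ 8 / ρ := (min_le_right _ _).trans (min_le_left _ _)
  have c4 : c ≤ t * ν / (3 * |σ₃| + 1) := (min_le_right _ _).trans (min_le_right _ _)
  refine ⟨R, y, ν, c, hR0, hy0, hν0, hc0, min_le_left _ _, c1, by linarith, ?_, ?_, ?_, ?_⟩
  · rw [le_div_iff₀ hρ] at c3
    linarith
  · rw [hR, Real.sq_sqrt (by positivity)]
    exact le_of_eq (by field_simp)
  · rw [le_div_iff₀ (by positivity)] at c4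
    rw [div_mul_eq_mul_div, div_le_iff₀ hν0]
    linarith
  · have h1 : ν ≤ e * ρ / (8 * (R + 2 * y)) := min_le_right _ _
    have h2 : ν * (2 / ρ * (R + 2 * y)) ≤ e / 4 := by
      calc _ ≤ e * ρ / (8 * (R + 2 * y)) * (2 / ρ * (R + 2 * y)) := by gcongr
        _ = _ := by field_simp; norm_num
    linarith

section Sequence

variable {d : ℕ} {X : ℕ → Experiment.{u, v, w} d}
  {M δ ρ κ σ₁ σ₂ σ₃ σ₄ σ₅ r₁ r₂ : ℝ} {s : ℕ → ℝ}

lemma eventually_largeSamples (hS : ∀ n, (X n).Setting M δ) (hr₂ : 2 < r₂)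
    (hgrowth : ∀ A : ℝ, ∀ᶠ n in atTop, ∀ j,
      A * (X n).m ≤ min (((X n).n j : ℝ) ^ (r₂ / (2 * (r₂ + d)))) (s ((X n).n j)))
    {A : ℝ} (hA : 1 ≤ A) :
    ∀ᶠ n in atTop, (X n).LargeSamples A fun j => s ((X n).n j) := by
  filter_upwards [hgrowth A] with n hn
  refine ⟨hA, fun j => ((hn j).trans (min_le_left _ _)).trans ?_,
    fun j => (hn j).trans (min_le_right _ _)⟩
  rw [Real.sqrt_eq_rpow]
  refine Real.rpow_le_rpow_of_exponent_le (by exact_mod_cast (hS n).n_pos j) ?_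
  have hd : (0 : ℝ) ≤ d := by positivity
  rw [div_le_div_iff₀ (by positivity) (by positivity)]
  linarith

lemma tendsto_NMin (hS : ∀ n, (X n).Setting M δ) (hr₂ : 2 < r₂)
    (hgrowth : ∀ A : ℝ, ∀ᶠ n in atTop, ∀ j,
      A * (X n).m ≤ min (((X n).n j : ℝ) ^ (r₂ / (2 * (r₂ + d)))) (s ((X n).n j)))
    (k : ∀ n, Fin (X n).K) : Tendsto (fun n => ((X n).NMin : ℝ)) atTop atTop ∧
    Tendsto (fun n => ((X n).N (k n) : ℝ)) atTop atTop := by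
  have h1 : Tendsto (fun n => ((X n).NMin : ℝ)) atTop atTop := by
    refine tendsto_atTop.2 fun b => ?_
    filter_upwards [eventually_largeSamples hS hr₂ hgrowth (le_max_left 1 b)] with n hA
    obtain ⟨j, -⟩ := (hS n).cluster_surjective (k n)
    exact (le_max_right 1 b).trans (hA.le_NMin (hS n) j)
  exact ⟨h1, tendsto_atTop_mono (fun n => by exact_mod_cast NMin_le (k n)) h1⟩

lemma eventually_div_le (D : ℝ) {t : ℝ} (ht : 0 < t) : ∀ᶠ A : ℝ in atTop, D / A ≤ t :=
  (tendsto_const_nhds.div_atTop tendsto_id).eventually_le_const ht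

variable (hS : ∀ n, (X n).Setting M δ) (hL : ∀ n, (X n).LossRegularity M ρ κ σ₁ σ₂ σ₃ σ₅ r₁ r₂)
  (hM : 0 < M) (hr₁ : 2 < r₁) (hr₂ : 2 < r₂) (hnuis : NuisanceRegularity X s σ₄)
  (hgrowth : ∀ A : ℝ, ∀ᶠ n in atTop, ∀ j,
    A * (X n).m ≤ min (((X n).n j : ℝ) ^ (r₂ / (2 * (r₂ + d)))) (s ((X n).n j)))
  (hK : ∃ B : ℕ, ∀ n, (X n).K ≤ B) {k : ∀ n, Fin (X n).K}
  (hb : Tendsto (fun n => (X n).b s (k n)) atTop (𝓝 0))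

include hS hL hM hr₁ hr₂ hnuis hgrowth hK hb

/-- With high probability, the empirical losses behave well. -/
lemma eventually_measure_not_wellBehaved_le {ν c x y R t : ℝ} (hν : 0 < ν) (hc : 0 < c)
    (hcM : c ≤ M) (hx : 0 < x) (hy : 0 < y) (hR : 0 < R) (ht : 0 < t)
    (ht1 : 3 * |σ₃| / ν * c ≤ t) (ht2 : (1 + |σ₁|) / R ^ 2 ≤ t) :
    ∀ᶠ n in atTop, (X n).μ {ω | ¬ (X n).WellBehaved M ν c x y R (k n) ω} ≤
      ENNReal.ofReal (9 * t) := by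
  obtain ⟨B, hB⟩ := hK
  set C := |σ₄| with hC
  have hC0 : 0 ≤ C := abs_nonneg _
  set b' := t * y / (|σ₅| * C + 1) with hb'
  have hb0 : 0 < b' := by positivity
  obtain ⟨A, hA1, hA2, hA3, hA4, hA5, hA6⟩ := ((eventually_ge_atTop (1 : ℝ)).and <|
    (eventually_div_le (C / M ^ 2 + d * (d * (18 * (1 + |σ₂|))) * (3 * (d + 1) / ν) ^ 2 +
        3 * |σ₃| / ν * Real.sqrt C) ht).and <|
    (eventually_div_le (1 + |σ₁|) ht).and <|
    (eventually_div_le (B * ((1 + |σ₁|) / x ^ 2)) ht).and <|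
    (eventually_div_le ((|σ₅| * C + 2 * Real.sqrt (|σ₅| * C)) / x) ht).and <|
    (eventually_div_le (2 * Real.sqrt (|σ₅| * C) / y) ht)).exists
  have hT := hnuis.realization.eventually_le_const (u := ENNReal.ofReal t) (by simpa using ht)
  filter_upwards [eventually_largeSamples hS hr₂ hgrowth hA1, hT, hb.eventually_le_const hb0]
    with n hA hTn hbn
  have hA0 := hA.pos
  have hmse : ∀ j, ∫⁻ ω, ‖(X n).ηhat j ω - (X n).ηstar j‖ₑ ^ 2 ∂(X n).μ ≤
      ENNReal.ofReal (C / s ((X n).n j) ^ 2) := fun j =>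
    (hnuis.mse n j).trans (ENNReal.ofReal_le_ofReal (by gcongr; exact le_abs_self _))
  have hbj : ∀ j, (X n).cluster j = k n → Real.sqrt ((X n).clusterSize (k n)) *
      (Real.sqrt ((X n).n j) / s ((X n).n j) ^ 2) ≤ b' := fun j hj => by
    refine le_trans ?_ hbn
    have h1 := le_ciSup (f := fun j : {j : Fin (X n).m // (X n).cluster j = k n} =>
      Real.sqrt ((X n).n j) / s ((X n).n j) ^ 2) (Set.finite_range _).bddAbove ⟨j, hj⟩
    have h2 : (1 : ℝ) ≤ (X n).K := by
      exact_mod_cast (Nat.one_le_iff_ne_zero.2 fun h => (h ▸ k n).elim0 : 1 ≤ (X n).K)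
    have h3 : 0 ≤ Real.sqrt ((X n).clusterSize (k n)) := Real.sqrt_nonneg _
    have h4 : 0 ≤ Real.sqrt ((X n).n j) / s ((X n).n j) ^ 2 := by positivity
    rw [b]
    calc _ = 1 * Real.sqrt ((X n).clusterSize (k n)) *
          (Real.sqrt ((X n).n j) / s ((X n).n j) ^ 2) := by ring
      _ ≤ _ := by gcongr
  refine (measure_not_wellBehaved_le (hS n) (hL n) hM hr₁ hr₂ hA hC0 hmse hν hc hcM hx hy hR
    hbj).trans ?_
  have q1 : B * ((1 + |σ₁|) / x ^ 2) / A ≤ t := hA4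
  have q2 : ((X n).K : ℝ) * ((1 + |σ₁|) / (x ^ 2 * A ^ 2)) ≤ t := by
    have hKB : ((X n).K : ℝ) ≤ B := by exact_mod_cast hB n
    calc _ ≤ B * ((1 + |σ₁|) / (x ^ 2 * A)) := by
          have : A ≤ A ^ 2 := by nlinarith
          gcongr
      _ = B * ((1 + |σ₁|) / x ^ 2) / A := by field_simp
      _ ≤ t := hA4
  have q3 : (|σ₅| * C + 2 * Real.sqrt (|σ₅| * C)) / (x * A) ≤ t := by
    rwa [← div_div]
  have q4 : (|σ₅| * C * b' + 2 * Real.sqrt (|σ₅| * C) / A) / y ≤ 2 * t := by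
    have h1 : |σ₅| * C * b' / y ≤ t := by
      rw [div_le_iff₀ hy, hb', mul_div_assoc', div_le_iff₀ (by positivity)]
      have : 0 ≤ t * y := by positivity
      nlinarith
    have h2 : 2 * Real.sqrt (|σ₅| * C) / A / y ≤ t := by rwa [div_right_comm]
    rw [add_div]
    linarith
  have e9 : ENNReal.ofReal (9 * t) = ENNReal.ofReal t + ENNReal.ofReal (2 * t) +
      ENNReal.ofReal t + ENNReal.ofReal t + ENNReal.ofReal t + ENNReal.ofReal (2 * t) +
      ENNReal.ofReal t := by
    rw [← ENNReal.ofReal_add (by positivity) (by positivity),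
      ← ENNReal.ofReal_add (by positivity) (by positivity),
      ← ENNReal.ofReal_add (by positivity) (by positivity),
      ← ENNReal.ofReal_add (by positivity) (by positivity),
      ← ENNReal.ofReal_add (by positivity) (by positivity),
      ← ENNReal.ofReal_add (by positivity) (by positivity)]
    congr 1
    ring
  rw [e9]
  refine add_le_add (add_le_add (add_le_add (add_le_add (add_le_add (add_le_add hTn ?_) ?_) ?_)
    ?_) ?_) ?_ <;> refine ENNReal.ofReal_le_ofReal ?_
  · linarith
  · exact hA3
  · exact q2
  · exact q3
  · exact q4
  · exact ht2

variable (hδ : 0 < δ) (hρ : 0 < ρ)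

include hδ hρ

/-- The oracle estimator is asymptotically linear in the score. -/
lemma tendsto_measure_oracle_remainder {βtilde : ∀ n, (X n).Ω → Euc d}
    (hβ : ∀ n, (X n).IsOracleEstimator (k n) (βtilde n)) {e : ℝ} (he : 0 < e) :
    Tendsto (fun n => (X n).μ {ω | e < ‖(X n).normScore (k n) ω + (X n).psiOp (k n)
      (Real.sqrt ((X n).N (k n)) • (βtilde n ω - (X n).β (k n)))‖}) atTop (𝓝 0) := by
  rw [ENNReal.tendsto_nhds_zero]
  intro q hq
  obtain ⟨q', hq0, hq'⟩ := ENNReal.lt_iff_exists_nnreal_btwn.1 hq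
  have hq0' : (0 : ℝ) < q' := by exact_mod_cast hq0
  obtain ⟨R, y, ν, c, hR, hy, hν, hc, hνρ, hcM, -, -, ht2, ht1, hfin⟩ :=
    exists_constants (t := q' / 9) σ₁ σ₃ hM hδ hρ he (by positivity)
  filter_upwards [eventually_measure_not_wellBehaved_le hS hL hM hr₁ hr₂ hnuis hgrowth hK hb hν hc
    hcM (x := c * ρ / 8) (by positivity) hy hR (by positivity) ht1 ht2] with n hn
  have hnull := ae_iff.1 (hβ n).2
  refine (measure_mono (t := {ω | ¬ (X n).WellBehaved M ν c (c * ρ / 8) y R (k n) ω} ∪ _)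
    fun ω hω => ?_).trans ((measure_union_le _ _).trans ((add_le_add hn hnull.le).trans ?_))
  · contrapose hω
    simp only [Set.mem_union, Set.mem_ofPred_eq, not_or, not_not, not_lt] at hω ⊢
    exact (hω.1.remainder_oracle_le (hS n) (hL n) hM hρ hr₁ hr₂ hν.le hνρ hc hcM rfl hy.le
      hω.2).trans hfin
  · rw [add_zero, mul_div_cancel₀ _ (by norm_num)]
    exact (le_of_eq (ENNReal.ofReal_coe_nnreal)).trans hq'.le

/-- The fusion estimator is asymptotically linear in the score. -/
lemma tendsto_measure_fusion_remainder {α cw γ ζ c₀ c₁ c₂ : ℝ} (hα : 0 < α) (hcw : 0 < cw)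
    (hγ : 0 ≤ γ) (hζ : ζ < 1 / 2) (hc₀ : 0 < c₀) (hc₁ : 0 < c₁)
    (hc₂ : cw * (δ / 2) ^ (-γ) ≤ c₂) (hinit : PilotConsistency X α) {τ ε : ℕ → ℝ}
    (hpilot : ∀ᶠ n in atTop, c₀ * (X n).nMax ≤ ((X n).nMin : ℝ) ^ (α * γ))
    (hε₀ : ∀ n, 0 ≤ ε n)
    (hε : ∀ᶠ n in atTop, ε n ≤ c₁ * ((X n).m : ℝ) ^ (-2 : ℝ) * ((X n).NMin : ℝ) ^ ζ)
    (hτ : ∀ᶠ n in atTop, c₂ < τ n ∧ τ n < c₂ * ((X n).nMin : ℝ) ^ (α * γ))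
    {θhat : ∀ n, Fin (X n).m → (X n).Ω → Euc d}
    (hθhat : ∀ n, (X n).IsFusionEstimator cw γ (τ n) (ε n) (θhat n))
    {j : ∀ n, Fin (X n).m} (hjk : ∀ n, (X n).cluster (j n) = k n) {e : ℝ} (he : 0 < e) :
    Tendsto (fun n => (X n).μ {ω | e < ‖(X n).normScore (k n) ω + (X n).psiOp (k n)
      (Real.sqrt ((X n).N (k n)) • (θhat n (j n) ω - (X n).θstar (j n)))‖}) atTop (𝓝 0) := by
  have hγ0 : 0 < γ := by
    rcases hγ.eq_or_lt with h | h
    · obtain ⟨n, hn⟩ := hτ.exists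
      rw [← h, mul_zero, Real.rpow_zero, mul_one] at hn
      exact absurd (hn.1.trans hn.2) (lt_irrefl _)
    · exact h
  have hc₂0 : 0 < c₂ := lt_of_lt_of_le (by positivity) hc₂
  set Λ₀ := 2 + (|κ| + ρ) * M + c₁ with hΛ₀
  have hΛ0 : 0 < Λ₀ := by positivity
  obtain ⟨p, hp0, hpδ, hp⟩ := exists_pilot_radius (B := max (Λ₀ / c₀) c₂) hδ hcw hγ0
  rw [ENNReal.tendsto_nhds_zero]
  intro q hq
  obtain ⟨q', hq0, hq'⟩ := ENNReal.lt_iff_exists_nnreal_btwn.1 hq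
  have hq0' : (0 : ℝ) < q' := by exact_mod_cast hq0
  obtain ⟨R, y, ν, c, hR, hy, hν, hc, hνρ, hcM, hcδ, hx1, ht2, ht1, hfin⟩ :=
    exists_constants (t := q' / 10) σ₁ σ₃ hM hδ hρ he (by positivity)
  set x := c * ρ / 8 with hx
  have hx0 : 0 < x := by positivity
  have hNζ : ∀ᶠ n in atTop, c₁ * ((X n).NMin : ℝ) ^ (ζ - 1 / 2) ≤ y := by
    have h1 := (tendsto_rpow_neg_atTop (y := 1 / 2 - ζ) (by linarith)).comp
      (tendsto_NMin hS hr₂ hgrowth k).1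
    have h2 := (h1.const_mul c₁).eventually_le_const (u := y) (by simpa using hy)
    filter_upwards [h2] with n hn
    simpa using hn
  have hpe := (hinit p hp0).eventually_le_const (u := ENNReal.ofReal (q' / 10))
    (ENNReal.ofReal_pos.2 (by positivity))
  filter_upwards [eventually_measure_not_wellBehaved_le hS hL hM hr₁ hr₂ hnuis hgrowth hK hb hν hc
    hcM (x := x) hx0 hy hR (by positivity) ht1 ht2, hpe, hNζ, hpilot, hε, hτ,
    eventually_largeSamples hS hr₂ hgrowth (le_max_left 1 (c₁ / x))]
    with n hn hpn hNn hpil hεn hτn hA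
  have hnull := ae_iff.1 (hθhat n).2
  refine (measure_mono (t := ({ω | ¬ (X n).WellBehaved M ν c x y R (k n) ω} ∪
    {ω | ¬ ∀ j, ((X n).n j : ℝ) ^ α * ‖(X n).θinit j ω - (X n).θstar j‖ < p}) ∪ _)
    fun ω hω => ?_).trans ((measure_union_le _ _).trans ((add_le_add
      ((measure_union_le _ _).trans (add_le_add hn hpn)) hnull.le).trans ?_))
  · contrapose hω
    simp only [Set.mem_union, Set.mem_ofPred_eq, not_or, not_not, not_lt] at hω ⊢
    obtain ⟨⟨hW, hpω⟩, hmin⟩ := hω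
    have hn0 : (0 : ℝ) ≤ ((X n).nMin : ℝ) ^ (α * γ) := by positivity
    have hΛle : Λ₀ * (X n).nMax ≤ cw * (2 * p) ^ (-γ) * ((X n).nMin : ℝ) ^ (α * γ) := by
      calc Λ₀ * (X n).nMax = Λ₀ / c₀ * (c₀ * (X n).nMax) := by field_simp
        _ ≤ cw * (2 * p) ^ (-γ) * ((X n).nMin : ℝ) ^ (α * γ) := by
            have := (le_max_left _ _).trans hp
            gcongr
    have hτle : τ n < cw * (2 * p) ^ (-γ) * ((X n).nMin : ℝ) ^ (α * γ) :=
      hτn.2.trans_le (by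
        have := (le_max_right _ _).trans hp
        gcongr)
    have hcA : c₁ ≤ x * max 1 (c₁ / x) := by
      calc c₁ = x * (c₁ / x) := by field_simp
        _ ≤ _ := by gcongr; exact le_max_right _ _
    refine (hW.remainder_fusion_le (hS n) (hL n) hM hρ hr₁ hr₂ hν.le hνρ hc hcM hx hcδ hx1
      (cw := cw) (γ := γ) (τ := τ n) (ε := ε n) (Λ := Λ₀ * (X n).nMax) (hε₀ n)
      (fun i i' hii => le_penalty_of_cluster_eq (hS n) hα hp0 hpω hγ0 hcw hΛle
        (hc₂0.trans hτn.1) hτle hii)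
      (fun i i' hii => penalty_of_cluster_ne (hS n) hα hp0 hpω hγ0 hcw hδ hpδ
        (hc₂.trans hτn.1.le) hii)
      (fun k' => fusion_weight_cluster_le (hS n) hA hc₁ hζ hεn (j n) hcA k')
      (fusion_weight_root_le (hS n) hc₁ hεn (j n) hNn (k n)) ?_ hmin (hjk n)).trans hfin
    have := fusion_weight_le_nMax (hS n) hc₁ hζ hεn (j n)
    rw [hΛ₀]
    linarith
  · rw [add_zero, ← ENNReal.ofReal_add (by positivity) (by positivity)]
    refine le_trans (le_of_eq ?_) hq'.le
    rw [← ENNReal.ofReal_coe_nnreal]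
    congr 1
    ring

end Sequence

end Experiment
end

theorem theorem2 {d : ℕ} (X : ℕ → Experiment.{u, v, w} d)
    -- constants that do not depend on the index `n` of the sequence
    (M δ ρ κ σ₁ σ₂ σ₃ σ₄ σ₅ r₁ r₂ α cw γ ζ c₀ c₁ c₂ : ℝ)
    (hM : 0 < M) (hδ : 0 < δ) (hρ : 0 < ρ) (hr₁ : 2 < r₁) (hr₂ : 2 < r₂)
    (hα : 0 < α) (hα' : α ≤ 1 / 2) (hcw : 0 < cw) (hγ : 0 ≤ γ) (hζ : ζ < 1 / 2)
    (hc₀ : 0 < c₀) (hc₁ : 0 < c₁) (hc₂ : cw * (δ / 2) ^ (-γ) ≤ c₂)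
    -- the setting and the regularity assumptions
    (s : ℕ → ℝ)
    (hsetting : ∀ n, (X n).Setting M δ)
    (hloss : ∀ n, (X n).LossRegularity M ρ κ σ₁ σ₂ σ₃ σ₅ r₁ r₂)
    (hnuis : NuisanceRegularity X s σ₄)
    (hinit : PilotConsistency X α)
    -- the tuning parameters
    (τ ε : ℕ → ℝ)
    (hpilot : ∀ᶠ n in atTop, c₀ * (X n).nMax ≤ ((X n).nMin : ℝ) ^ (α * γ))
    (hε₀ : ∀ n, 0 ≤ ε n)
    (hε : ∀ᶠ n in atTop, ε n ≤ c₁ * ((X n).m : ℝ) ^ (-2 : ℝ) * ((X n).NMin : ℝ) ^ ζ)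
    (hτ : ∀ᶠ n in atTop, c₂ < τ n ∧ τ n < c₂ * ((X n).nMin : ℝ) ^ (α * γ))
    -- `m⁻¹ min_j (n_j ^ (r₂ / (2 (r₂ + d))) ∧ s (n_j)) → ∞`
    (hgrowth : ∀ A : ℝ, ∀ᶠ n in atTop, ∀ j,
      A * (X n).m ≤ min (((X n).n j : ℝ) ^ (r₂ / (2 * (r₂ + d)))) (s ((X n).n j)))
    -- `K = O(1)`
    (hK : ∃ B : ℕ, ∀ n, (X n).K ≤ B)
    -- the estimator
    (θhat : ∀ n, Fin (X n).m → (X n).Ω → Euc d)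
    (hθhat : ∀ n, (X n).IsFusionEstimator cw γ (τ n) (ε n) (θhat n))
    -- a task, and its cluster `k n`, with `b_{k,n} = o(1)`
    (j : ∀ n, Fin (X n).m) (k : ∀ n, Fin (X n).K) (hjk : ∀ n, (X n).cluster (j n) = k n)
    (hb : Tendsto (fun n => (X n).b s (k n)) atTop (𝓝 0)) :
    -- the matrices in the limit law are well defined
    (∀ n, (∀ a c, Integrable (fun ω => (X n).pooledHessian (k n) ω a c) (X n).μ) ∧
      (∀ a c, Integrable (fun ω => (X n).pooledScoreOuter (k n) ω a c) (X n).μ) ∧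
      ((X n).Psi (k n)).PosDef ∧ ((X n).Omega (k n)).PosSemidef) ∧
    -- asymptotic normality of the task estimator
    AsymptoticallyNormal X
      (fun n ω => Real.sqrt ((X n).N (k n)) • (θhat n (j n) ω - (X n).θstar (j n)))
      (fun n => (X n).asymptoticCov (k n)) ∧
    -- the oracle estimator of the cluster has the same limit law
    (∀ βtilde : ∀ n, (X n).Ω → Euc d, (∀ n, (X n).IsOracleEstimator (k n) (βtilde n)) →
      AsymptoticallyNormal X
        (fun n ω => Real.sqrt ((X n).N (k n)) • (βtilde n ω - (X n).β (k n)))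
        (fun n => (X n).asymptoticCov (k n))) := by
  have hN := (Experiment.tendsto_NMin hsetting hr₂ hgrowth k).2
  refine ⟨fun n => ⟨fun a c => Experiment.integrable_pooledHessian_entry (hsetting n) (hloss n) hM
      hr₂ (k n) a c, fun a c => Experiment.integrable_pooledScoreOuter (hsetting n) (hloss n) hM
      hr₁ hr₂ (k n) a c, Experiment.posDef_Psi (hsetting n) (hloss n) hρ hM hr₁ hr₂ (k n),
      Experiment.posSemidef_Omega (hsetting n) (hloss n) hM hr₁ hr₂ (k n)⟩, ?_, fun βtilde hβ => ?_⟩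
  · exact Experiment.asymptoticallyNormal_of_linear hsetting hloss hρ hM hr₁ hr₂ hN
      (fun n => ((hθhat n).1 (j n)).sub_const _ |>.const_smul (Real.sqrt ((X n).N (k n))))
      fun e he => Experiment.tendsto_measure_fusion_remainder hsetting hloss hM hr₁ hr₂ hnuis
        hgrowth hK hb hδ hρ hα hcw hγ hζ hc₀ hc₁ hc₂ hinit hpilot hε₀ hε hτ hθhat hjk he
  · exact Experiment.asymptoticallyNormal_of_linear hsetting hloss hρ hM hr₁ hr₂ hN
      (fun n => ((hβ n).1.sub_const _).const_smul (Real.sqrt ((X n).N (k n))))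
      fun e he => Experiment.tendsto_measure_oracle_remainder hsetting hloss hM hr₁ hr₂ hnuis
        hgrowth hK hb hδ hρ hβ he
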